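/- **Setting.** Let $O_1,O_2,\dots$ be i.i.d. with law $P_0$, let $P_n$ be the empirical measure of the first $n$ observations, and let $X=X(O)\in[0,1]^d$ be a measurable part of the observation; for $f:[0,1]^d\to\mathbb R$ write $\|f\|_{q,P_0}=\{P_0|f(X)|^q\}^{1/q}$. Let $D^{(k)}([0,1]^d)$ be the functions with finite $k$-th order sectional variation norm, $D^{(k)}_M([0,1]^d)$ those with norm at most $M$. Let $L(\psi)(O)$ be a loss, $\psi_0\in\arg\min_{\psi\in D^{(0)}([0,1]^d)}P_0L(\psi)$, $d_0(\theta,\psi_0)=P_0L(\theta)-P_0L(\psi_0)$, and let the score be the directional derivative $\frac{d}{d\theta}L(\theta)(f)=\frac{d}{dt}L(\theta+tf)|_{t=0}$. Assume that the risk can be differentiated at $\psi_0$ under the integral sign along every direction in $D^{(k)}([0,1]^d)$. For each $n$ (possibly depending on the data) let $\phi_1,\dots,\phi_N$ be $k$-th order spline basis functions, $x_1,\dots,x_m\in[0,1]^d$ design points, $H=(\phi_j(x_i))_{i,j}$, $H^\top$ its adjoint for the standard inner product on $\mathbb R^N$ and some inner product on $\mathbb R^m$, $E_1,\dots,E_p$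 orthonormal eigenvectors of $H^\top H$ with non-zero eigenvalues, and $\tilde\phi_l=\sum_jE_l(j)\phi_j$, $\theta_\alpha=\sum_l\alpha(l)\tilde\phi_l$. Let $C_n$ be any (data-dependent) bound, $\alpha_n\in\arg\min_{\|\alpha\|_1\le C_n}P_nL(\theta_\alpha)$ and $\theta_n=\theta_{\alpha_n}$ (PC-HAL). Assume that $L$ is Gâteaux differentiable at $\theta_n$ along the span of the $\tilde\phi_l$, with derivative linear in the direction. Let $\mathcal E(J_n)=\{l:\alpha_n(l)\ne0\}$, $J_n=\#\mathcal E(J_n)$, $D(\mathcal E(J_n))=\{\theta_\alpha:\alpha\text{ supported on }\mathcal E(J_n)\}$, with inner product $\langle\theta_\alpha,\theta_{\alpha'}\rangle_n=\sum_l\alpha(l)\alpha'(l)$ and norm $\|\cdot\|_2$, and $D_M(\mathcal E(J_n))=\{\theta_\alpha\in D(\mathcal E(J_n)):\|\alpha\|_1\le M\}$. Let $\ell_n=\operatorname{sign}(\alpha_n)$, $f_{\ell_n}=J_n^{-1/2}\sum_l\ell_n(l)\tilde\phi_l$, $f^*_{\ell_n}=J_n^{-1/2}f_{\ell_n}$,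 $D_n(\mathcal E(J_n))=\{f\in D(\mathcal E(J_n)):\langle f,f_{\ell_n}\rangle_n=0\}$, and let $\tilde f_{\ell_n}$ minimize $P_0(f^*_{\ell_n}-f)^2$ over $f\in D_n(\mathcal E(J_n))$. **Theorem, part 1 (for every sample).** $\theta_n$ minimizes $P_nL$ over $D_{C_n}(\mathcal E(J_n))$, and $P_n\frac{d}{d\theta_n}L(\theta_n)(f)=0$ for all $f\in D_n(\mathcal E(J_n))$, i.e. in all directions $\sum_l\alpha(l)\tilde\phi_l$ with $\alpha$ supported on $\mathcal E(J_n)$ and $\alpha\perp\ell_n$. If $J_n\ge1$, then $\|f_{\ell_n}\|_2=1$, the coefficients of $f^*_{\ell_n}$ have $L_1$-norm $1$ and $L_2$-norm $J_n^{-1/2}$, and $D_n(\mathcal E(J_n))$ has dimension $J_n-1$. For all $f^*\in D(\mathcal E(J_n))$, $$P_n\tfrac{d}{d\theta_n}L(\theta_n)(f^*)=J_n^{1/2}\langle f^*,f_{\ell_n}\rangle_n\,P_n\tfrac{d}{d\theta_n}L(\theta_n)(f^*_{\ell_n}-\tilde f_{\ell_n}),$$ so that $|P_n\frac{d}{d\theta_n}L(\theta_n)(f^*)|\le|P_n\frac{d}{d\theta_n}L(\theta_n)(f^*_{\ell_n}-\tilde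 f_{\ell_n})|$ if $\|f^*\|_2\le J_n^{-1/2}$ (where $0^{-1/2}$ is read as $0$). Moreover $\|f^*_{\ell_n}-\tilde f_{\ell_n}\|_{q,P_0}\le\min_{l\in\mathcal E(J_n)}\|\tilde\phi_l\|_{2,P_0}$ for $q=1,2$ if $J_n\ge 1$. **Part 2.** Let $0<M<\infty$ and assume: 1. (Entropy) There are deterministic classes $\mathcal F_n$ of measurable functions, each with a countable subset whose sequential pointwise limits exhaust it, and a positive integer $K$ such that $N(\epsilon,\mathcal F_n)\le N(\epsilon/K,D^{(k)}_M([0,1]^d))^K$ for all $n$ and $\epsilon>0$, where $N(\epsilon,\mathcal F)$ is the supremum over finitely supported uniform distributions $Q$ on points (with repetitions) of the $L^2(Q)$ covering number; and with probability tending to one $\{\frac{d}{d\theta}L(\theta)(f):\theta,f\in D_M(\mathcal E(J_n))\}\subset\mathcal F_n$, $\theta_n\in D_M(\mathcal E(J_n))$ and $f^*_{\ell_n}-\tilde f_{\ell_n}\in D_M(\mathcal E(J_n))$. 2. $\|\frac{d}{d\theta_n}L(\theta_n)(f^*_{\ell_n}-\tilde f_{\ell_n})\|_{L^2(P_0)}=o_P(1)$.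 3. Either (a) $\|\theta_n-\psi_0\|_\infty\|f^*_{\ell_n}-\tilde f_{\ell_n}\|_{1,P_0}=o_P(n^{-1/2})$ and, for a constant $K'$, $|P_0\{\frac{d}{d\theta}L(\theta)(f)-\frac{d}{d\psi_0}L(\psi_0)(f)\}|\le K'\|\theta-\psi_0\|_\infty\|f\|_{1,P_0}$ for all $n$, all samples and all $\theta,f\in D_M(\mathcal E(J_n))$; or (b) $d_0^{1/2}(\theta_n,\psi_0)\|f^*_{\ell_n}-\tilde f_{\ell_n}\|_{2,P_0}=o_P(n^{-1/2})$ and, for all such $\theta,f$, $L(\theta)$ is $P_0$-integrable and the same difference is at most $K'd_0^{1/2}(\theta,\psi_0)\|f\|_{2,P_0}$. Then $$\sup_{f^*\in D_M(\mathcal E(J_n)),\ \|f^*\|_2\le J_n^{-1/2}}\left|P_n\tfrac{d}{d\theta_n}L(\theta_n)(f^*)\right|=o_P(n^{-1/2}).$$ -/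

import Mathlib

open MeasureTheory ProbabilityTheory Filter Topology
open scoped NNReal ENNReal

namespace PCHAL

/-- The unit cube `[0,1]^d`. -/
abbrev Cube (d : ℕ) : Type := Fin d → unitInterval

/-- The iterated primitive over the coordinates in `t`: `x ↦ ∫_{(0, x(t)]} g(u) du`, for a function
`g` of the coordinates `u(t)`.  (The cube has Lebesgue measure one, so the coordinates
outside `t` integrate out.) -/
noncomputable def primitive {d : ℕ} (t : Finset (Fin d)) (g : Cube d → ℝ) : Cube d → ℝ :=
  fun x => ∫ u : Cube d, Set.indicator {u : Cube d | ∀ i ∈ t, u i ≤ x i} g u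

/-- The functions of the coordinates `x(s)` whose `k`-th order sectional variation norm
is at most `M`.

For `k = 0`: `f x = μ [0, x]` for a finite signed measure `μ` on the cube, carried by the face
`{u : u i = 0 for i ∉ s}`, with total variation at most `M`.  Splitting the cube according to the
set of non-zero coordinates of `u`, the total variation of `μ` is
`|f 0| + ∑_{∅ ≠ t ⊆ s} ∫ |d f_t|`, the sectional variation norm.

For `k + 1`: `f x = ∑_{t ⊆ s} ∫_{(0, x(t)]} g_t(u) du`, where `g_t` is the Lebesgue derivative of
the `t`-section of `f` (and `g_∅ = f 0`); the norm of `f` is the sum of the `k`-th order norms of the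
`g_t`. -/
def svBall (d : ℕ) : ℕ → Finset (Fin d) → ℝ≥0 → Set (Cube d → ℝ)
  | 0, s, M => {f | ∃ μ : SignedMeasure (Cube d),
      μ.totalVariation {u | ∃ i, i ∉ s ∧ u i ≠ 0} = 0 ∧
      μ.totalVariation Set.univ ≤ (M : ℝ≥0∞) ∧
      ∀ x, f x = μ (Set.Iic x)}
  | k + 1, s, M => {f | ∃ (g : Finset (Fin d) → Cube d → ℝ) (c : Finset (Fin d) → ℝ≥0),
      (∀ t ∈ s.powerset, g t ∈ svBall d k t (c t)) ∧
      (∑ t ∈ s.powerset, c t) ≤ M ∧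
      ∀ x, f x = ∑ t ∈ s.powerset, primitive t (g t) x}

/-- `D^(k)_M([0,1]^d)`. -/
def DBall (d k : ℕ) (M : ℝ≥0) : Set (Cube d → ℝ) := svBall d k Finset.univ M

/-- `D^(k)([0,1]^d)`. -/
def DSpace (d k : ℕ) : Set (Cube d → ℝ) := {f | ∃ M : ℝ≥0, f ∈ DBall d k M}

/-- The `k`-th order spline basis functions in the coordinates `x(s)`: `x ↦ I(x ≥ u)` for `k = 0`, with a
knot point `u` in the face of `s`, and then iterated primitives along nested sets of coordinates. -/
def splines (d : ℕ) : ℕ → Finset (Fin d) → Set (Cube d → ℝ)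
  | 0, s => {φ | ∃ u : Cube d, (∀ i, i ∉ s → u i = 0) ∧
      φ = Set.indicator (Set.Ici u) (fun _ => (1 : ℝ))}
  | k + 1, s => {φ | ∃ t ∈ s.powerset, ∃ g ∈ splines d k t, φ = primitive t g}

/-- Principal component design: `N` spline basis functions `phi j` of order `k`, design points `x i`,
an inner product `⟨v, w⟩ = vᵀ W w` on the image of the design matrix `H i j = phi j (x i)`, and
orthonormal eigenvectors (the `p` columns of `E`) of `Hᵀ W H` with non-zero eigenvalues. -/
structure PCDesign (d k : ℕ) where
  N : ℕ
  m : ℕ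
  p : ℕ
  phi : Fin N → Cube d → ℝ
  phi_mem : ∀ j, phi j ∈ splines d k Finset.univ
  x : Fin m → Cube d
  W : Matrix (Fin m) (Fin m) ℝ
  W_posDef : W.PosDef
  E : Matrix (Fin N) (Fin p) ℝ
  E_orthonormal : E.transpose * E = 1
  eig : Fin p → ℝ
  eig_ne_zero : ∀ l, eig l ≠ 0
  E_eig :
    let H : Matrix (Fin m) (Fin N) ℝ := Matrix.of fun i j => phi j (x i)
    (H.transpose * W * H) * E = E * Matrix.diagonal eig

/-- The PC basis functions `∑_j E(j, l) phi_j`. -/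
def PCDesign.basis {d k : ℕ} (B : PCDesign d k) (l : Fin B.p) : Cube d → ℝ :=
  ∑ j, B.E j l • B.phi j

/-- `α ↦ θ_α = ∑_l α(l) · basis l`. -/
noncomputable def PCDesign.fn {d k : ℕ} (B : PCDesign d k) :
    (Fin B.p → ℝ) →ₗ[ℝ] (Cube d → ℝ) :=
  Fintype.linearCombination ℝ B.basis

section Coefficients

variable {p : ℕ}

/-- `‖α‖₁`. -/
def l1 (a : Fin p → ℝ) : ℝ := ∑ l, |a l|

/-- `‖α‖₂`. -/
noncomputable def l2 (a : Fin p → ℝ) : ℝ := Real.sqrt (∑ l, a l ^ 2)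

/-- The active set `{l : α(l) ≠ 0}`. -/
def active (α : Fin p → ℝ) : Set (Fin p) := {l | α l ≠ 0}

/-- The number of active coefficients. -/
noncomputable def numActive (α : Fin p → ℝ) : ℕ := (active α).ncard

/-- Coefficient vectors supported on the active set of `α`. -/
def activeSpace (α : Fin p → ℝ) : Submodule ℝ (Fin p → ℝ) where
  carrier := {a | ∀ l, l ∉ active α → a l = 0}
  zero_mem' := by intro l _; rfl
  add_mem' := by
    intro a b ha hb l hl
    simp [ha l hl, hb l hl]
  smul_mem' := by
    intro c a ha l hl
    simp [ha l hl]

/-- Coefficient vectors supported on the active set with `‖a‖₁ ≤ C`. -/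
def activeBall (α : Fin p → ℝ) (C : ℝ) : Set (Fin p → ℝ) := {a | a ∈ activeSpace α ∧ l1 a ≤ C}

/-- The sign vector `ℓ(l) = I(α(l) > 0) - I(α(l) < 0)`. -/
noncomputable def signVec (α : Fin p → ℝ) : Fin p → ℝ := fun l => Real.sign (α l)

/-- Coefficient vectors supported on the active set and orthogonal to the sign vector. -/
def orthSpace (α : Fin p → ℝ) : Submodule ℝ (Fin p → ℝ) where
  carrier := {a | a ∈ activeSpace α ∧ ∑ l, a l * signVec α l = 0}
  zero_mem' := by
    refine ⟨Submodule.zero_mem _, ?_⟩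
    simp
  add_mem' := by
    rintro a b ⟨ha, ha'⟩ ⟨hb, hb'⟩
    refine ⟨Submodule.add_mem _ ha hb, ?_⟩
    simp [add_mul, Finset.sum_add_distrib, ha', hb']
  smul_mem' := by
    rintro c a ⟨ha, ha'⟩
    refine ⟨Submodule.smul_mem _ c ha, ?_⟩
    simp [mul_assoc, ← Finset.mul_sum, ha']

/-- Coefficients of `f_ℓ`: `ℓ(l) / J^{1/2}`. -/
noncomputable def unitDir (α : Fin p → ℝ) : Fin p → ℝ :=
  fun l => signVec α l / Real.sqrt (numActive α)

/-- Coefficients of `f*_ℓ = f_ℓ / J^{1/2}`: `ℓ(l) / J`. -/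
noncomputable def starDir (α : Fin p → ℝ) : Fin p → ℝ :=
  fun l => signVec α l / (numActive α : ℝ)

end Coefficients

section Empirical

variable {T : Type*}

/-- The empirical mean `P_n f` of `f` over the first `n` observations. -/
noncomputable def empMean (n : ℕ) (o : ℕ → T) (f : T → ℝ) : ℝ :=
  (∑ i ∈ Finset.range n, f (o i)) / n

/-- The smallest number of `L²(Q)`-balls of radius `ε` covering `F`, where `Q` is the uniform
distribution on the points `y 0, …, y m` (repetitions allowed). -/
noncomputable def coveringAt {m : ℕ} (y : Fin (m + 1) → T) (F : Set (T → ℝ)) (ε : ℝ) : ℕ∞ :=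
  ⨅ (N : ℕ) (_ : ∃ c : Fin N → T → ℝ, ∀ f ∈ F, ∃ r : Fin N,
      Real.sqrt ((∑ i, (f (y i) - c r (y i)) ^ 2) / (m + 1)) ≤ ε), (N : ℕ∞)

/-- The uniform `L²` covering number of `F`: the supremum of the `L²(Q)` covering numbers over
finitely supported distributions `Q`. -/
noncomputable def unifCovering (F : Set (T → ℝ)) (ε : ℝ) : ℕ∞ :=
  ⨆ (m : ℕ) (y : Fin (m + 1) → T), coveringAt y F ε

/-- Every member of `F` is a pointwise limit of a sequence from one countable subset of `F`. -/
def PointwiseSeparable (F : Set (T → ℝ)) : Prop :=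
  ∃ G ⊆ F, G.Countable ∧ ∀ f ∈ F, ∃ g : ℕ → T → ℝ, (∀ j, g j ∈ G) ∧
    ∀ t, Tendsto (fun j => g j t) atTop (𝓝 (f t))

/-- `Y_n = o_P(r_n)` for non-negative `Y_n` (with `μ` read as outer measure if `Y_n` is not
measurable). -/
def IsLittleOP {Ω : Type*} [MeasurableSpace Ω] (μ : Measure Ω) (Y : ℕ → Ω → ℝ≥0∞)
    (r : ℕ → ℝ) : Prop :=
  ∀ ε : ℝ, 0 < ε → Tendsto (fun n => μ {ω | ENNReal.ofReal (ε * r n) < Y n ω}) atTop (𝓝 0)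

/-- The event `A_n` has probability tending to one. -/
def WithProbTendingToOne {Ω : Type*} [MeasurableSpace Ω] (μ : Measure Ω) (A : ℕ → Set Ω) : Prop :=
  Tendsto (fun n => μ (A n)ᶜ) atTop (𝓝 0)

end Empirical

section Loss

variable {d : ℕ} {𝒪 : Type*}

/-- The score `d/dθ L(θ)(f)`: the directional derivative of the loss at `θ` in direction `f`. -/
noncomputable def score (L : (Cube d → ℝ) → 𝒪 → ℝ) (θ f : Cube d → ℝ) : 𝒪 → ℝ :=
  fun o => deriv (fun t : ℝ => L (θ + t • f) o) 0

/-- The loss is Gâteaux differentiable at `θ` along the directions `V`, with a derivative that is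
linear in the direction. -/
def GateauxAt (L : (Cube d → ℝ) → 𝒪 → ℝ) (θ : Cube d → ℝ) (V : Set (Cube d → ℝ)) : Prop :=
  ∀ o, ∃ A : (Cube d → ℝ) →ₗ[ℝ] ℝ, ∀ f ∈ V,
    HasDerivAt (fun t : ℝ => L (θ + t • f) o) (A f) 0

variable [MeasurableSpace 𝒪]

/-- `ψ₀ = argmin P₀ L(ψ)` over `D^(0)([0,1]^d)` (loss functions that are not integrable count as infinite
risk). -/
def IsRiskMinimizer (L : (Cube d → ℝ) → 𝒪 → ℝ) (P0 : Measure 𝒪) (ψ0 : Cube d → ℝ) : Prop :=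
  ψ0 ∈ DSpace d 0 ∧ Integrable (L ψ0) P0 ∧
    ∀ ψ ∈ DSpace d 0, Integrable (L ψ) P0 → ∫ o, L ψ0 o ∂P0 ≤ ∫ o, L ψ o ∂P0

/-- Along each direction in `D^(k)([0,1]^d)` the risk `P₀ L` can be differentiated at `ψ₀` under the
integral sign. -/
def RiskDifferentiableAt (k : ℕ) (L : (Cube d → ℝ) → 𝒪 → ℝ) (P0 : Measure 𝒪)
    (ψ0 : Cube d → ℝ) : Prop :=
  ∀ f ∈ DSpace d k,
    (∀ᶠ t : ℝ in 𝓝 0, Integrable (L (ψ0 + t • f)) P0) ∧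
    Integrable (score L ψ0 f) P0 ∧
    HasDerivAt (fun t : ℝ => ∫ o, L (ψ0 + t • f) o ∂P0) (∫ o, score L ψ0 f o ∂P0) 0

/-- The loss-based dissimilarity `d₀(θ, ψ₀) = P₀ L(θ) - P₀ L(ψ₀)`. -/
noncomputable def dissim (L : (Cube d → ℝ) → 𝒪 → ℝ) (P0 : Measure 𝒪) (θ ψ0 : Cube d → ℝ) : ℝ :=
  (∫ o, L θ o ∂P0) - ∫ o, L ψ0 o ∂P0

/-- `‖θ - ψ‖_∞`. -/
noncomputable def supDist (θ ψ : Cube d → ℝ) : ℝ≥0∞ := ⨆ x, ENNReal.ofReal |θ x - ψ x|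

/-- `‖f‖_{q, P₀}`, the `L^q`-norm of `f(X)` for `O ∼ P₀`, where `X = X(O)` is the part of the
observation at which functions on the cube are evaluated. -/
noncomputable def normP (q : ℝ≥0∞) (X : 𝒪 → Cube d) (P0 : Measure 𝒪) (f : Cube d → ℝ) : ℝ≥0∞ :=
  eLpNorm (fun o => f (X o)) q P0

end Loss

section Estimator

variable {d k : ℕ} {𝒪 : Type*}

/-- `α` are the coefficients of a PC-HAL fit with bound `C` on the `L₁`-norm: `θ_α` minimizes the
empirical risk over `‖α‖₁ ≤ C`. -/
def IsPCHAL (L : (Cube d → ℝ) → 𝒪 → ℝ) (n : ℕ) (o : ℕ → 𝒪) (B : PCDesign d k) (C : ℝ)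
    (α : Fin B.p → ℝ) : Prop :=
  l1 α ≤ C ∧ ∀ a : Fin B.p → ℝ, l1 a ≤ C → empMean n o (L (B.fn α)) ≤ empMean n o (L (B.fn a))

/-- `b` are coefficients of the `L²(P₀)`-projection of `f*_ℓ` on the functions with coefficients in
`orthSpace α`. -/
def IsProjCoef [MeasurableSpace 𝒪] (X : 𝒪 → Cube d) (P0 : Measure 𝒪) (B : PCDesign d k)
    (α b : Fin B.p → ℝ) : Prop :=
  b ∈ orthSpace α ∧ ∀ a ∈ orthSpace α,
    ∫ o, (B.fn (starDir α) (X o) - B.fn b (X o)) ^ 2 ∂P0 ≤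
      ∫ o, (B.fn (starDir α) (X o) - B.fn a (X o)) ^ 2 ∂P0

/-- The scores `d/dθ L(θ)(f)` with `θ` and `f` in the `L₁`-ball of radius `M` of the active model. -/
def scoreClass (L : (Cube d → ℝ) → 𝒪 → ℝ) (B : PCDesign d k) (α : Fin B.p → ℝ) (M : ℝ) :
    Set (𝒪 → ℝ) :=
  {h | ∃ a ∈ activeBall α M, ∃ b ∈ activeBall α M, h = score L (B.fn a) (B.fn b)}

end Estimator

end PCHAL

open PCHAL

/-!
Why the theorem is true.

*Deterministic part.* Along a direction supported on the active set and orthogonal to the sign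
vector, small steps leave the `L₁`-norm of the coefficients unchanged (`eventually_l1_add_smul`),
so the constrained minimizer solves the score equations in these directions
(`empMean_score_eq_zero`). These directions have codimension one in the active model, and the
residual `f*_ℓ - f̃_ℓ` spans a complement; by linearity each score of the active model is a
multiple of the score of the residual (`empMean_score_eq_mul`), with a factor that Cauchy–Schwarz
bounds by one when `‖f*‖₂ ≤ J ^ (-1/2)`.

*Asymptotic part.* It remains to show that the score `g` of the residual is
`o_P(n ^ (-1/2))` in empirical mean. Write `Pₙ g = (Pₙ - P₀) g + P₀ g`. The population score at the risk minimizer `ψ₀`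
vanishes (`integral_score_eq_zero`), so the second-order condition bounds `P₀ g`. For the first
term `‖g‖_{L²(P₀)} = o_P(1)` and `g` belongs to `F n`, so it suffices that the empirical process
is asymptotically equicontinuous at zero, uniformly over the varying classes `F n`
(`exists_eventually_measure_empirical_le`). This is proved by symmetrization
(`lintegral_iSup_empirical_le_radSum`) and chaining (`exists_radSum_majorant_of_entropy`), the
latter applied to the class and, to control the random `L²(Pₙ)`-radius, to the squares of its
members. The classes are bounded without an envelope being assumed: the covering number of
`D^(k)_M` is one at radius `M`, and `F n` contains the zero score (`abs_le_of_unifCovering_le`).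

Chaining needs uniform entropy of order `ε ^ (-r)` with `r < 2` for `D^(k)_M([0,1]^d)`
(`entropyBound_DBall`). Iterated primitives are again distribution functions of signed measures
(`svBall_subset_svBall_zero`), so only `k = 0` matters, where the restrictions to a finite sample
lie in `M` times the absolutely convex hull of the orthant indicators. Orthants have polynomial
covering numbers (`exists_orthant_net`). Maurey's method alone would give the borderline exponent
`2`; it is applied after the nearest element of a coarse net has been subtracted from each
orthant, which makes the atoms small, while the combinations of the net are covered by a grid
(`exists_cover_absConvexHull`).
-/

namespace PCHAL

/-! ### Rademacher averages of finite sets of vectors, and chaining -/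

section Chaining

variable {ι : Type*} [Fintype ι]

/-- The Rademacher sum `∑ᵢ ±vᵢ`, with the sign pattern encoded by booleans. -/
def radSum (σ : ι → Bool) (v : ι → ℝ) : ℝ := ∑ i, (if σ i then 1 else -1) * v i

/-- The set `V` of vectors has covering numbers at most `exp (A ε ^ (-r))` for the normalized
Euclidean norm `(n⁻¹ ∑ᵢ vᵢ²)^{1/2}`. The centres need not belong to `V`. -/
def EntropyBound (V : Set (ι → ℝ)) (A r : ℝ) : Prop :=
  ∀ ε : ℝ, 0 < ε → ∃ (N : ℕ) (c : Fin N → ι → ℝ), (N : ℝ) ≤ Real.exp (A * ε ^ (-r)) ∧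
    ∀ v ∈ V, ∃ j, ∑ i, (v i - c j i) ^ 2 ≤ Fintype.card ι * ε ^ 2

lemma radSum_sub (σ : ι → Bool) (v w : ι → ℝ) :
    radSum σ (v - w) = radSum σ v - radSum σ w := by
  simp [radSum, mul_sub, Finset.sum_sub_distrib]

lemma abs_radSum_le (σ : ι → Bool) (v : ι → ℝ) : |radSum σ v| ≤ ∑ i, |v i| := by
  refine (Finset.abs_sum_le_sum_abs _ _).trans (Finset.sum_le_sum fun i _ => ?_)
  by_cases h : σ i <;> simp [h]

lemma sum_sub_sq_le (a b c : ι → ℝ) :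
    ∑ i, (a i - b i) ^ 2 ≤ 2 * ∑ i, (c i - a i) ^ 2 + 2 * ∑ i, (c i - b i) ^ 2 := by
  rw [Finset.mul_sum, Finset.mul_sum, ← Finset.sum_add_distrib]
  refine Finset.sum_le_sum fun i _ => ?_
  nlinarith [sq_nonneg (c i - a i + (c i - b i))]

/-- The squares of a uniformly bounded set of vectors inherit an entropy bound. -/
lemma EntropyBound.sq {V : Set (ι → ℝ)} {A r b : ℝ} (hb : 0 < b)
    (hV : EntropyBound V A r) (hVb : ∀ v ∈ V, ∀ i, |v i| ≤ b) :
    EntropyBound ((fun v i => v i ^ 2) '' V) (A * (2 * b) ^ r) r := by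
  intro ε hε
  obtain ⟨N, c, hN, hc⟩ := hV (ε / (2 * b)) (by positivity)
  -- centres are truncated at `b`, which does not increase the distance to members of `V`
  refine ⟨N, fun j i => (max (-b) (min b (c j i))) ^ 2, ?_, ?_⟩
  · refine hN.trans (le_of_eq ?_)
    rw [Real.div_rpow hε.le (by positivity), Real.rpow_neg (by positivity : 0 ≤ 2 * b),
      div_inv_eq_mul]
    ring_nf
  · rintro _ ⟨v, hv, rfl⟩
    obtain ⟨j, hj⟩ := hc v hv
    refine ⟨j, ?_⟩
    have key : ∀ i, (v i ^ 2 - (max (-b) (min b (c j i))) ^ 2) ^ 2 ≤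
        (2 * b) ^ 2 * (v i - c j i) ^ 2 := by
      intro i
      have h1 := abs_le.1 (hVb v hv i)
      set w := max (-b) (min b (c j i)) with hw
      have hw1 : -b ≤ w := le_max_left _ _
      have hw2 : w ≤ b := max_le (by linarith) (min_le_left _ _)
      have h3 : (v i - w) ^ 2 ≤ (v i - c j i) ^ 2 := by
        rw [sq_le_sq, hw]
        rcases le_total b (c j i) with h | h
        · rw [min_eq_left h, max_eq_right (by linarith)]
          rw [abs_of_nonpos (by linarith), abs_of_nonpos (by linarith)]; linarith
        · rw [min_eq_right h]
          rcases le_total (-b) (c j i) with h' | h'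
          · rw [max_eq_right h']
          · rw [max_eq_left h', abs_of_nonneg (by linarith), abs_of_nonneg (by linarith)]
            linarith
      have h4 : (v i + w) ^ 2 ≤ (2 * b) ^ 2 := sq_le_sq' (by linarith) (by linarith)
      calc (v i ^ 2 - w ^ 2) ^ 2 = (v i + w) ^ 2 * (v i - w) ^ 2 := by ring
        _ ≤ _ := mul_le_mul h4 h3 (sq_nonneg _) (sq_nonneg _)
    calc ∑ i, (v i ^ 2 - (max (-b) (min b (c j i))) ^ 2) ^ 2
        ≤ (2 * b) ^ 2 * ∑ i, (v i - c j i) ^ 2 := by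
          rw [Finset.mul_sum]; exact Finset.sum_le_sum fun i _ => key i
      _ ≤ (2 * b) ^ 2 * (Fintype.card ι * (ε / (2 * b)) ^ 2) := by gcongr
      _ = Fintype.card ι * ε ^ 2 := by field_simp

variable [DecidableEq ι]

/-- Sub-Gaussian moment generating function of a Rademacher sum. -/
lemma sum_exp_radSum_le (v : ι → ℝ) (l : ℝ) :
    ∑ σ : ι → Bool, Real.exp (l * radSum σ v) ≤
      2 ^ Fintype.card ι * Real.exp (l ^ 2 * (∑ i, v i ^ 2) / 2) := by
  have h1 : ∑ σ : ι → Bool, Real.exp (l * radSum σ v) =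
      ∏ i, ∑ b : Bool, Real.exp (l * ((if b then 1 else -1) * v i)) := by
    rw [Finset.prod_univ_sum]
    rw [Fintype.piFinset_univ]
    refine Finset.sum_congr rfl fun σ _ => ?_
    rw [radSum, Finset.mul_sum, Real.exp_sum]
  rw [h1]
  have h2 : ∀ i, ∑ b : Bool, Real.exp (l * ((if b then 1 else -1) * v i)) =
      2 * Real.cosh (l * v i) := by
    intro i
    simp [Real.cosh_eq]
    ring
  simp_rw [h2]
  rw [Finset.prod_mul_distrib, Finset.prod_const, Finset.card_univ]
  gcongr
  calc ∏ i, Real.cosh (l * v i) ≤ ∏ i, Real.exp ((l * v i) ^ 2 / 2) :=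
        Finset.prod_le_prod (fun i _ => (Real.cosh_pos _).le)
          fun i _ => Real.cosh_le_exp_half_sq _
    _ = Real.exp (l ^ 2 * (∑ i, v i ^ 2) / 2) := by
        rw [← Real.exp_sum, Finset.mul_sum, Finset.sum_div]
        simp_rw [mul_pow]

/-- The maximal inequality for finitely many Rademacher sums. The maximum is represented by a
majorant `m`, obtained from the tangent line of the logarithm instead of Jensen's inequality. -/
lemma exists_radSum_majorant {T : Type*} [Fintype T] (t : T → ι → ℝ) {v H : ℝ} (hv : 0 < v)
    (hH : 0 < H) (ht : ∀ a, ∑ i, t a i ^ 2 ≤ v) (hT : 2 * (Fintype.card T : ℝ) ≤ Real.exp H) :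
    ∃ m : (ι → Bool) → ℝ, (∀ σ a, |radSum σ (t a)| ≤ m σ) ∧
      ∑ σ, m σ ≤ 2 ^ Fintype.card ι * Real.sqrt (2 * v * H) := by
  set l := Real.sqrt (2 * H / v) with hl
  have hlpos : 0 < l := Real.sqrt_pos.2 (by positivity)
  have hl2 : l ^ 2 = 2 * H / v := Real.sq_sqrt (by positivity)
  let S : (ι → Bool) → ℝ := fun σ =>
    ∑ a, (Real.exp (l * radSum σ (t a)) + Real.exp (-l * radSum σ (t a)))
  have hS : ∑ σ, S σ ≤ 2 ^ Fintype.card ι * Real.exp (2 * H) := by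
    have hb : ∀ a, ∀ l' : ℝ, l' ^ 2 = l ^ 2 →
        ∑ σ : ι → Bool, Real.exp (l' * radSum σ (t a)) ≤ 2 ^ Fintype.card ι * Real.exp H := by
      intro a l' h'
      refine (sum_exp_radSum_le (t a) l').trans ?_
      gcongr
      rw [h', hl2]
      calc 2 * H / v * (∑ i, t a i ^ 2) / 2 ≤ 2 * H / v * v / 2 := by
            gcongr
            exact ht a
        _ = H := by field_simp
    calc ∑ σ, S σ = ∑ a, (∑ σ : ι → Bool, Real.exp (l * radSum σ (t a)) +
          ∑ σ : ι → Bool, Real.exp (-l * radSum σ (t a))) := by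
          simp only [S]
          rw [Finset.sum_comm]
          simp_rw [Finset.sum_add_distrib]
      _ ≤ ∑ a : T, (2 ^ Fintype.card ι * Real.exp H + 2 ^ Fintype.card ι * Real.exp H) := by
          refine Finset.sum_le_sum fun a _ => add_le_add (hb a l rfl) (hb a (-l) (by ring))
      _ = 2 ^ Fintype.card ι * ((2 * (Fintype.card T : ℝ)) * Real.exp H) := by
          rw [Finset.sum_const, Finset.card_univ, nsmul_eq_mul]; ring
      _ ≤ 2 ^ Fintype.card ι * (Real.exp H * Real.exp H) := by gcongr
      _ = _ := by rw [← Real.exp_add]; ring_nf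
  refine ⟨fun σ => (2 * H + S σ / Real.exp (2 * H) - 1) / l, ?_, ?_⟩
  · intro σ a
    rw [le_div_iff₀ hlpos]
    have h1 : Real.exp (l * |radSum σ (t a)|) ≤ S σ := by
      have h2 : Real.exp (l * |radSum σ (t a)|) ≤
          Real.exp (l * radSum σ (t a)) + Real.exp (-l * radSum σ (t a)) := by
        rcases abs_cases (radSum σ (t a)) with h | h <;> rw [h.1]
        · linarith [Real.exp_pos (-l * radSum σ (t a))]
        · rw [mul_neg, ← neg_mul]
          linarith [Real.exp_pos (l * radSum σ (t a))]
      exact h2.trans (Finset.single_le_sum (f := fun a =>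
        Real.exp (l * radSum σ (t a)) + Real.exp (-l * radSum σ (t a)))
        (fun i _ => by positivity) (Finset.mem_univ a))
    have h3 : l * |radSum σ (t a)| - 2 * H + 1 ≤ Real.exp (l * |radSum σ (t a)|) /
        Real.exp (2 * H) := by
      rw [← Real.exp_sub]
      exact Real.add_one_le_exp _
    have h4 : Real.exp (l * |radSum σ (t a)|) / Real.exp (2 * H) ≤ S σ / Real.exp (2 * H) := by
      gcongr
    linarith
  · rw [← Finset.sum_div, div_le_iff₀ hlpos, Finset.sum_sub_distrib, Finset.sum_add_distrib,
      ← Finset.sum_div]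
    simp only [Finset.sum_const, Finset.card_univ, nsmul_eq_mul, Fintype.card_fun,
      Fintype.card_bool, Nat.cast_pow, Nat.cast_ofNat, mul_one]
    have h5 : (∑ σ, S σ) / Real.exp (2 * H) ≤ 2 ^ Fintype.card ι := by
      rw [div_le_iff₀ (Real.exp_pos _)]; exact hS
    have h6 : Real.sqrt (2 * v * H) * l = 2 * H := by
      rw [hl, ← Real.sqrt_mul (by positivity)]
      rw [show 2 * v * H * (2 * H / v) = (2 * H) ^ 2 by field_simp]
      exact Real.sqrt_sq (by positivity)
    rw [mul_assoc, h6]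
    linarith

/-- The constant of the chaining bound: the square root bounds a link of the chain, the denominator
sums the geometric series over the scales, and the last summand pays for stopping the chain. -/
noncomputable def chainConst (A r D : ℝ) : ℝ :=
  Real.sqrt (20 * (D ^ r + 2 * A)) / (1 - (1 / 2) ^ (1 - r / 2)) + 1

lemma chainConst_nonneg {r : ℝ} (hr2 : r < 2) (A D : ℝ) : 0 ≤ chainConst A r D := by
  have : (1 / 2 : ℝ) ^ (1 - r / 2) < 1 :=
    Real.rpow_lt_one (by norm_num) (by norm_num) (by linarith)
  unfold chainConst
  have : 0 ≤ Real.sqrt (20 * (D ^ r + 2 * A)) / (1 - (1 / 2) ^ (1 - r / 2)) :=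
    div_nonneg (Real.sqrt_nonneg _) (by linarith)
  linarith

/-- Dudley's chaining bound for the Rademacher average of a set of vectors in a ball of radius `R`
whose metric entropy grows at a rate `ε ^ (-r)` with `r < 2`. -/
lemma exists_radSum_majorant_of_entropy [Nonempty ι] {V : Set (ι → ℝ)} {A r D R : ℝ} (hA : 0 ≤ A)
    (hr : 0 < r) (hr2 : r < 2) (hR : 0 < R) (hRD : R ≤ D) (hV : EntropyBound V A r)
    (hVR : ∀ v ∈ V, ∑ i, v i ^ 2 ≤ Fintype.card ι * R ^ 2) :
    ∃ m : (ι → Bool) → ℝ, (∀ σ, ∀ v ∈ V, |radSum σ v| ≤ m σ) ∧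
      ∑ σ, m σ ≤ 2 ^ Fintype.card ι *
        (chainConst A r D * Real.sqrt (Fintype.card ι) * R ^ (1 - r / 2)) := by
  set n : ℝ := ((Fintype.card ι : ℕ) : ℝ) with hn
  have hnpos : 0 < n := by
    rw [hn]; exact_mod_cast Fintype.card_pos
  set e : ℕ → ℝ := fun j => R * (1 / 2) ^ j with he
  have hepos : ∀ j, 0 < e j := fun j => by positivity
  have heD : ∀ j, e j ≤ D := fun j => by
    refine le_trans ?_ hRD
    exact mul_le_of_le_one_right hR.le (pow_le_one₀ (by norm_num) (by norm_num))
  have hehalf : ∀ j, e j = 2 * e (j + 1) := fun j => by simp only [he, pow_succ]; ring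
  -- nets at the dyadic scales, with the trivial net at scale `R`
  have hnet : ∀ j : ℕ, ∃ (N : ℕ) (c : Fin N → ι → ℝ), (N : ℝ) ≤ Real.exp (A * e j ^ (-r)) ∧
      (∀ v ∈ V, ∃ a, ∑ i, (v i - c a i) ^ 2 ≤ n * e j ^ 2) ∧ (j = 0 → ∀ a, c a = 0) := by
    intro j
    rcases Nat.eq_zero_or_pos j with rfl | hj
    · refine ⟨1, fun _ => 0, ?_, ?_, by simp⟩
      · simpa using (mul_nonneg hA (Real.rpow_nonneg (hepos 0).le _))
      · intro v hv
        refine ⟨0, ?_⟩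
        simpa [he] using hVR v hv
    · obtain ⟨N, c, h1, h2⟩ := hV (e j) (hepos j)
      exact ⟨N, c, h1, h2, fun h => absurd h hj.ne'⟩
  choose N c hN hc hc0 using hnet
  -- majorants of the links of the chain; consecutive centres for the same `v` are at squared distance
  -- at most `2 n e_{j+1}² + 2 n e_j² = 10 n e_{j+1}²`
  set G : ℝ := D ^ r + 2 * A with hG
  have hDpos : 0 < D := hR.trans_le hRD
  have hGpos : 0 < G := by
    have : 0 < D ^ r := Real.rpow_pos_of_pos hDpos r
    positivity
  have hlink : ∀ j : ℕ, ∃ m : (ι → Bool) → ℝ,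
      (∀ σ (a : Fin (N (j + 1))) (b : Fin (N j)),
        ∑ i, (c (j + 1) a i - c j b i) ^ 2 ≤ 10 * n * e (j + 1) ^ 2 →
        |radSum σ (c (j + 1) a - c j b)| ≤ m σ) ∧
      ∑ σ, m σ ≤ 2 ^ Fintype.card ι *
        Real.sqrt (2 * (10 * n * e (j + 1) ^ 2) * (G * e (j + 1) ^ (-r))) := by
    intro j
    let T := {p : Fin (N (j + 1)) × Fin (N j) //
      ∑ i, (c (j + 1) p.1 i - c j p.2 i) ^ 2 ≤ 10 * n * e (j + 1) ^ 2}
    have hepr : 0 < e (j + 1) ^ (-r) := Real.rpow_pos_of_pos (hepos _) _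
    have hT : 2 * (Fintype.card T : ℝ) ≤ Real.exp (G * e (j + 1) ^ (-r)) := by
      have hcard : (Fintype.card T : ℝ) ≤ N (j + 1) * N j := by
        have := Fintype.card_subtype_le (fun p : Fin (N (j + 1)) × Fin (N j) =>
          ∑ i, (c (j + 1) p.1 i - c j p.2 i) ^ 2 ≤ 10 * n * e (j + 1) ^ 2)
        simp only [Fintype.card_prod, Fintype.card_fin] at this
        exact_mod_cast this
      have hle : e j ^ (-r) ≤ e (j + 1) ^ (-r) := by
        refine Real.rpow_le_rpow_of_nonpos (hepos _) ?_ (by linarith)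
        rw [hehalf j]; linarith [hepos (j + 1)]
      have h2 : (2 : ℝ) ≤ Real.exp 1 := by linarith [Real.add_one_le_exp (1 : ℝ)]
      have h1 : (1 : ℝ) ≤ D ^ r * e (j + 1) ^ (-r) := by
        rw [Real.rpow_neg (hepos _).le, ← div_eq_mul_inv, one_le_div (by
          exact Real.rpow_pos_of_pos (hepos _) _)]
        exact Real.rpow_le_rpow (hepos _).le (heD _) hr.le
      calc 2 * (Fintype.card T : ℝ) ≤ Real.exp 1 * (Real.exp (A * e (j + 1) ^ (-r)) *
            Real.exp (A * e (j + 1) ^ (-r))) := by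
            refine mul_le_mul h2 (hcard.trans ?_) (by positivity) (by positivity)
            refine mul_le_mul (hN _) ((hN j).trans ?_) (by positivity) (by positivity)
            exact Real.exp_le_exp.2 (by gcongr)
        _ = Real.exp (1 + 2 * A * e (j + 1) ^ (-r)) := by
            rw [← Real.exp_add, ← Real.exp_add]; ring_nf
        _ ≤ _ := Real.exp_le_exp.2 (by rw [hG, add_mul]; linarith)
    obtain ⟨m, hm1, hm2⟩ := exists_radSum_majorant
      (T := T) (fun p => c (j + 1) p.1.1 - c j p.1.2)
      (v := 10 * n * e (j + 1) ^ 2) (H := G * e (j + 1) ^ (-r))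
      (by have := hepos (j + 1); positivity) (by positivity) (fun p => p.2) hT
    exact ⟨m, fun σ a b hab => hm1 σ ⟨(a, b), hab⟩, hm2⟩
  choose m hm1 hm2 using hlink
  set s : ℝ := 1 - r / 2 with hs
  have hspos : 0 < s := by rw [hs]; linarith
  set q : ℝ := (1 / 2 : ℝ) ^ s with hq
  have hq0 : 0 < q := by positivity
  have hq1 : q < 1 := Real.rpow_lt_one (by norm_num) (by norm_num) hspos
  have hes : ∀ j, e j ^ s = R ^ s * q ^ j := by
    intro j
    rw [he, hq, Real.mul_rpow hR.le (by positivity), ← Real.rpow_natCast, ← Real.rpow_natCast,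
      ← Real.rpow_mul (by norm_num), ← Real.rpow_mul (by norm_num), mul_comm s]
  have hsqrt : ∀ j, Real.sqrt (2 * (10 * n * e (j + 1) ^ 2) * (G * e (j + 1) ^ (-r))) =
      Real.sqrt (20 * G) * Real.sqrt n * (R ^ s * q ^ (j + 1)) := by
    intro j
    rw [← hes, ← Real.sqrt_mul (by positivity)]
    have h1 : e (j + 1) ^ 2 * e (j + 1) ^ (-r) = (e (j + 1) ^ s) ^ 2 := by
      rw [← Real.rpow_natCast, ← Real.rpow_natCast, ← Real.rpow_mul (hepos _).le,
        ← Real.rpow_add (hepos _)]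
      congr 1; rw [hs]; push_cast; ring
    rw [show 2 * (10 * n * e (j + 1) ^ 2) * (G * e (j + 1) ^ (-r)) =
      20 * G * n * (e (j + 1) ^ 2 * e (j + 1) ^ (-r)) by ring, h1,
      Real.sqrt_mul (by positivity), Real.sqrt_sq (Real.rpow_nonneg (hepos _).le _)]
  -- the scale at which the chain is stopped
  obtain ⟨J, hJ⟩ : ∃ J : ℕ, n * e J ≤ Real.sqrt n * R ^ s := by
    have hlim : Tendsto (fun j => n * e j) atTop (𝓝 0) := by
      have := (tendsto_pow_atTop_nhds_zero_of_lt_one (r := (1 / 2 : ℝ)) (by norm_num)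
        (by norm_num)).const_mul (n * R)
      simpa [he, mul_assoc] using this
    have hpos : 0 < Real.sqrt n * R ^ s :=
      mul_pos (Real.sqrt_pos.2 hnpos) (Real.rpow_pos_of_pos hR _)
    exact ((hlim.eventually (gt_mem_nhds hpos)).mono fun j hj => le_of_lt hj).exists
  refine ⟨fun σ => ∑ j ∈ Finset.range J, m j σ + n * e J, ?_, ?_⟩
  · intro σ v hv
    choose a ha using fun j => hc j v hv
    have htel : v = (v - c J (a J)) +
        ∑ j ∈ Finset.range J, (c (j + 1) (a (j + 1)) - c j (a j)) := by
      rw [Finset.sum_range_sub (fun j => c j (a j)), hc0 0 rfl]; abel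
    have hrad : radSum σ v = radSum σ (v - c J (a J)) +
        ∑ j ∈ Finset.range J, radSum σ (c (j + 1) (a (j + 1)) - c j (a j)) := by
      simp_rw [radSum_sub]
      rw [Finset.sum_range_sub (fun j => radSum σ (c j (a j))), hc0 0 rfl]
      simp [radSum]
    rw [hrad, add_comm]
    refine (abs_add_le _ _).trans (add_le_add ?_ ?_)
    · refine (Finset.abs_sum_le_sum_abs _ _).trans (Finset.sum_le_sum fun j _ => ?_)
      refine hm1 j σ _ _ ?_
      refine (sum_sub_sq_le _ _ v).trans ?_
      have h1 := ha (j + 1)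
      have h2 := ha j
      rw [hehalf j] at h2
      linarith
    · refine (abs_radSum_le _ _).trans ?_
      have h1 := sq_sum_le_card_mul_sum_sq (s := Finset.univ)
        (f := fun i => |(v - c J (a J)) i|)
      simp only [sq_abs, Finset.card_univ, Pi.sub_apply] at h1
      have h2 : (∑ i, |(v - c J (a J)) i|) ^ 2 ≤ (n * e J) ^ 2 := by
        refine h1.trans ?_
        rw [← hn, mul_pow, sq n, mul_assoc]
        exact mul_le_mul_of_nonneg_left (ha J) hnpos.le
      exact le_of_sq_le_sq h2 (by have := hepos J; positivity)
  · rw [Finset.sum_add_distrib, Finset.sum_comm]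
    have h1 : ∑ j ∈ Finset.range J, ∑ σ, m j σ ≤ 2 ^ Fintype.card ι *
        (Real.sqrt (20 * G) * Real.sqrt n * R ^ s * (1 / (1 - q))) := by
      calc ∑ j ∈ Finset.range J, ∑ σ, m j σ ≤ ∑ j ∈ Finset.range J, 2 ^ Fintype.card ι *
            (Real.sqrt (20 * G) * Real.sqrt n * (R ^ s * q ^ (j + 1))) :=
            Finset.sum_le_sum fun j _ => by rw [← hsqrt]; exact hm2 j
        _ = 2 ^ Fintype.card ι * (Real.sqrt (20 * G) * Real.sqrt n * R ^ s *
            ∑ j ∈ Finset.range J, q ^ (j + 1)) := by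
            rw [Finset.mul_sum, Finset.mul_sum]
            exact Finset.sum_congr rfl fun j _ => by ring
        _ ≤ _ := by
            have : ∑ j ∈ Finset.range J, q ^ (j + 1) ≤ 1 / (1 - q) := by
              calc ∑ j ∈ Finset.range J, q ^ (j + 1) ≤ ∑ j ∈ Finset.range J, q ^ j :=
                    Finset.sum_le_sum fun j _ => pow_le_pow_of_le_one hq0.le hq1.le (by omega)
                _ ≤ 1 / (1 - q) := by
                    rw [le_div_iff₀ (by linarith), mul_comm, mul_neg_geom_sum]
                    linarith [pow_pos hq0 J]
            have hRs := Real.rpow_nonneg hR.le s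
            gcongr
    have h2 : ∑ _σ : ι → Bool, n * e J ≤ 2 ^ Fintype.card ι * (Real.sqrt n * R ^ s) := by
      simp only [Finset.sum_const, Finset.card_univ, nsmul_eq_mul, Fintype.card_fun,
        Fintype.card_bool, Nat.cast_pow, Nat.cast_ofNat]
      gcongr
    refine (add_le_add h1 h2).trans (le_of_eq ?_)
    rw [chainConst, ← hs, ← hq, ← hG]
    ring

end Chaining

/-! ### Symmetrization -/

section Symmetrization

variable {T κ ι : Type*} [MeasurableSpace T] [Countable κ] [Fintype ι]

lemma measurable_iSup_abs {S : Type*} [MeasurableSpace S] {f : κ → S → ℝ}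
    (hf : ∀ k, Measurable (f k)) : Measurable fun x => ⨆ k, ENNReal.ofReal |f k x| :=
  Measurable.iSup fun k => (continuous_abs.measurable.comp (hf k)).ennreal_ofReal

lemma measurable_radSum_comp {h : T → ℝ} (hm : Measurable h) (σ : ι → Bool) :
    Measurable fun x : ι → T => radSum σ (fun i => h (x i)) :=
  Finset.measurable_sum _ fun i _ => (hm.comp (measurable_pi_apply i)).const_mul _

/-- The mean is replaced by an independent copy of the sample, by Jensen's inequality for the
supremum of absolute values. -/
lemma lintegral_iSup_centered_le (P : Measure T) [IsProbabilityMeasure P] (h : κ → T → ℝ)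
    (hm : ∀ k, Measurable (h k)) (hint : ∀ k, Integrable (h k) P) :
    ∫⁻ x : ι → T, ⨆ k, ENNReal.ofReal |∑ i, (h k (x i) - ∫ t, h k t ∂P)|
        ∂(Measure.pi fun _ => P) ≤
      ∫⁻ z : ι → T × T, ⨆ k, ENNReal.ofReal |∑ i, (h k (z i).1 - h k (z i).2)|
        ∂(Measure.pi fun _ => P.prod P) := by
  have hmF : Measurable fun p : (ι → T) × (ι → T) =>
      ⨆ k, ENNReal.ofReal |∑ i, (h k (p.1 i) - h k (p.2 i))| :=
    measurable_iSup_abs fun k => Finset.measurable_sum _ fun i _ =>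
      ((hm k).comp ((measurable_pi_apply i).comp measurable_fst)).sub
        ((hm k).comp ((measurable_pi_apply i).comp measurable_snd))
  have h1 := (measurePreserving_arrowProdEquivProdArrow T T ι (fun _ => P)
    (fun _ => P)).lintegral_comp hmF
  have h2 : ∫⁻ z : ι → T × T, ⨆ k, ENNReal.ofReal |∑ i, (h k (z i).1 - h k (z i).2)|
        ∂(Measure.pi fun _ => P.prod P) =
      ∫⁻ x : ι → T, ∫⁻ x' : ι → T, ⨆ k, ENNReal.ofReal |∑ i, (h k (x i) - h k (x' i))|
        ∂(Measure.pi fun _ => P) ∂(Measure.pi fun _ => P) := by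
    rw [← lintegral_prod _ hmF.aemeasurable, ← h1]
    rfl
  rw [h2]
  refine lintegral_mono fun x => iSup_le fun k => ?_
  have hint' : ∀ i, Integrable (fun x' : ι → T => h k (x' i)) (Measure.pi fun _ => P) := fun i =>
    (measurePreserving_eval (fun _ : ι => P) i).integrable_comp_of_integrable (hint k)
  have h3 : ∑ i, (h k (x i) - ∫ t, h k t ∂P) =
      ∫ x' : ι → T, ∑ i, (h k (x i) - h k (x' i)) ∂(Measure.pi fun _ => P) := by
    rw [integral_finsetSum (f := fun i (x' : ι → T) => h k (x i) - h k (x' i)) _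
      fun i _ => (integrable_const _).sub (hint' i)]
    refine Finset.sum_congr rfl fun i _ => ?_
    rw [integral_sub (integrable_const _) (hint' i)]
    have h4 : ∫ x' : ι → T, h k (x' i) ∂(Measure.pi fun _ => P) = ∫ t, h k t ∂P := by
      refine (integral_map (μ := Measure.pi fun _ : ι => P) (φ := Function.eval i)
        (measurable_pi_apply i).aemeasurable (hm k).aestronglyMeasurable).symm.trans ?_
      rw [(measurePreserving_eval (fun _ : ι => P) i).map_eq]
    rw [h4]; simp
  rw [h3, ← Real.norm_eq_abs, ofReal_norm]
  refine (enorm_integral_le_lintegral_enorm _).trans (lintegral_mono fun x' => ?_)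
  rw [← ofReal_norm, Real.norm_eq_abs]
  exact le_iSup (fun k => ENNReal.ofReal |∑ i, (h k (x i) - h k (x' i))|) k

/-- Exchanging the two copies of the coordinates selected by a sign pattern preserves the law of the
doubled sample, and hence turns the difference of the copies into a Rademacher sum. -/
lemma lintegral_iSup_doubled_le (P : Measure T) [IsProbabilityMeasure P] (h : κ → T → ℝ)
    (hm : ∀ k, Measurable (h k)) (σ : ι → Bool) :
    ∫⁻ z : ι → T × T, ⨆ k, ENNReal.ofReal |∑ i, (h k (z i).1 - h k (z i).2)|
        ∂(Measure.pi fun _ => P.prod P) ≤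
      2 * ∫⁻ x : ι → T, ⨆ k, ENNReal.ofReal |radSum σ (fun i => h k (x i))|
        ∂(Measure.pi fun _ => P) := by
  have hswap : MeasurePreserving
      (fun (z : ι → T × T) i => if σ i then z i else (z i).swap)
      (Measure.pi fun _ => P.prod P) (Measure.pi fun _ => P.prod P) := by
    refine measurePreserving_pi (f := fun i (p : T × T) => if σ i then p else p.swap) _ _
      fun i => ?_
    by_cases hi : σ i
    · simp only [hi, if_true]
      exact MeasurePreserving.id _
    · simpa [hi] using Measure.measurePreserving_swap
  have hfst : MeasurePreserving (fun (z : ι → T × T) i => (z i).1)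
      (Measure.pi fun _ => P.prod P) (Measure.pi fun _ => P) :=
    measurePreserving_pi (f := fun _ (p : T × T) => p.1) _ _ fun _ => measurePreserving_fst
  have hsnd : MeasurePreserving (fun (z : ι → T × T) i => (z i).2)
      (Measure.pi fun _ => P.prod P) (Measure.pi fun _ => P) :=
    measurePreserving_pi (f := fun _ (p : T × T) => p.2) _ _ fun _ => measurePreserving_snd
  have hmD : Measurable fun z : ι → T × T =>
      ⨆ k, ENNReal.ofReal |∑ i, (h k (z i).1 - h k (z i).2)| :=
    measurable_iSup_abs fun k => Finset.measurable_sum _ fun i _ =>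
      ((hm k).comp (measurable_fst.comp (measurable_pi_apply i))).sub
        ((hm k).comp (measurable_snd.comp (measurable_pi_apply i)))
  have hmS : Measurable fun x : ι → T =>
      ⨆ k, ENNReal.ofReal |radSum σ (fun i => h k (x i))| :=
    measurable_iSup_abs fun k => measurable_radSum_comp (hm k) σ
  rw [← hswap.lintegral_comp hmD, two_mul]
  nth_rewrite 1 [← hfst.lintegral_comp hmS]
  rw [← hsnd.lintegral_comp hmS]
  refine le_trans ?_ (lintegral_add_left (hmS.comp hfst.measurable) _).le
  refine lintegral_mono fun z => iSup_le fun k => ?_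
  have heq : ∑ i, (h k (if σ i then z i else (z i).swap).1 -
      h k (if σ i then z i else (z i).swap).2) =
      radSum σ (fun i => h k (z i).1) - radSum σ (fun i => h k (z i).2) := by
    rw [← radSum_sub]
    refine Finset.sum_congr rfl fun i _ => ?_
    by_cases hi : σ i <;> simp [hi]
  rw [heq]
  refine (ENNReal.ofReal_le_ofReal (abs_sub _ _)).trans ?_
  rw [ENNReal.ofReal_add (abs_nonneg _) (abs_nonneg _)]
  exact add_le_add (le_iSup (fun k => ENNReal.ofReal |radSum σ (fun i => h k (z i).1)|) k)
    (le_iSup (fun k => ENNReal.ofReal |radSum σ (fun i => h k (z i).2)|) k)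

variable [DecidableEq ι]

/-- Symmetrization: the expected supremum of a centred empirical process is at most twice the
expected supremum of its Rademacher averages. -/
lemma lintegral_iSup_empirical_le_radSum (P : Measure T) [IsProbabilityMeasure P] (h : κ → T → ℝ)
    (hm : ∀ k, Measurable (h k)) (hint : ∀ k, Integrable (h k) P) :
    ∫⁻ x : ι → T, ⨆ k, ENNReal.ofReal |∑ i, (h k (x i) - ∫ t, h k t ∂P)|
        ∂(Measure.pi fun _ => P) ≤
      2 * ∫⁻ x : ι → T, (2 ^ Fintype.card ι)⁻¹ *
        ∑ σ : ι → Bool, ⨆ k, ENNReal.ofReal |radSum σ (fun i => h k (x i))|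
        ∂(Measure.pi fun _ => P) := by
  have hmS : ∀ σ : ι → Bool, Measurable fun x : ι → T =>
      ⨆ k, ENNReal.ofReal |radSum σ (fun i => h k (x i))| :=
    fun σ => measurable_iSup_abs fun k => measurable_radSum_comp (hm k) σ
  refine (lintegral_iSup_centered_le P h hm hint).trans ?_
  rw [lintegral_const_mul _ (Finset.measurable_sum _ fun σ _ => hmS σ),
    lintegral_finsetSum _ fun σ _ => hmS σ, ← mul_assoc, mul_comm 2, mul_assoc, Finset.mul_sum]
  have hcard : ((2 : ℝ≥0∞) ^ Fintype.card ι)⁻¹ * 2 ^ Fintype.card ι = 1 :=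
    ENNReal.inv_mul_cancel (by positivity) (by finiteness)
  calc _ = ((2 : ℝ≥0∞) ^ Fintype.card ι)⁻¹ * ∑ _σ : ι → Bool, ∫⁻ z : ι → T × T,
        ⨆ k, ENNReal.ofReal |∑ i, (h k (z i).1 - h k (z i).2)|
        ∂(Measure.pi fun _ => P.prod P) := by
        rw [Finset.sum_const, Finset.card_univ, nsmul_eq_mul, ← mul_assoc]
        simp [hcard]
    _ ≤ _ := by
        gcongr with σ
        exact lintegral_iSup_doubled_le P h hm σ

end Symmetrization

/-! ### Maximal inequality for the empirical process -/

section MaximalInequality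

variable {κ ι : Type*} [Fintype ι] [DecidableEq ι] [Nonempty ι]

lemma radAverage_le (v : κ → ι → ℝ) {A r D R : ℝ} (hA : 0 ≤ A) (hr : 0 < r) (hr2 : r < 2)
    (hR : 0 < R) (hRD : R ≤ D) (hV : EntropyBound (Set.range v) A r)
    (hVR : ∀ k, ∑ i, v k i ^ 2 ≤ Fintype.card ι * R ^ 2) :
    (2 ^ Fintype.card ι)⁻¹ * ∑ σ : ι → Bool, ⨆ k, ENNReal.ofReal |radSum σ (v k)| ≤
      ENNReal.ofReal (chainConst A r D * Real.sqrt (Fintype.card ι) * R ^ (1 - r / 2)) := by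
  obtain ⟨m, hm, hsum⟩ := exists_radSum_majorant_of_entropy hA hr hr2 hR hRD hV (by
    rintro _ ⟨k, rfl⟩; exact hVR k)
  have h1 : ∑ σ : ι → Bool, ⨆ k, ENNReal.ofReal |radSum σ (v k)| ≤
      2 ^ Fintype.card ι * ENNReal.ofReal
        (chainConst A r D * Real.sqrt (Fintype.card ι) * R ^ (1 - r / 2)) := by
    rcases isEmpty_or_nonempty κ with hκ | ⟨⟨k₀⟩⟩
    · simp
    · calc _ ≤ ∑ σ : ι → Bool, ENNReal.ofReal (m σ) :=
            Finset.sum_le_sum fun σ _ => iSup_le fun k =>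
              ENNReal.ofReal_le_ofReal (hm σ _ ⟨k, rfl⟩)
        _ = ENNReal.ofReal (∑ σ : ι → Bool, m σ) :=
            (ENNReal.ofReal_sum_of_nonneg fun σ _ =>
              (abs_nonneg _).trans (hm σ _ ⟨k₀, rfl⟩)).symm
        _ ≤ ENNReal.ofReal (2 ^ Fintype.card ι *
              (chainConst A r D * Real.sqrt (Fintype.card ι) * R ^ (1 - r / 2))) :=
            ENNReal.ofReal_le_ofReal hsum
        _ = _ := by
            rw [ENNReal.ofReal_mul (by positivity), ENNReal.ofReal_pow (by norm_num)]
            simp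
  calc _ ≤ ((2 : ℝ≥0∞) ^ Fintype.card ι)⁻¹ * (2 ^ Fintype.card ι * ENNReal.ofReal
        (chainConst A r D * Real.sqrt (Fintype.card ι) * R ^ (1 - r / 2))) := by gcongr
    _ = _ := by
        rw [← mul_assoc, ENNReal.inv_mul_cancel (by positivity) (by finiteness), one_mul]

/-- The Rademacher average in terms of the empirical radius `sup_k n⁻¹ ∑ᵢ v_k(i)²`. The concave
bound `R ^ s` of chaining is replaced by its majorant `δ ^ s + δ ^ (s - 2) R ^ 2`, whose
expectation is explicit. -/
lemma radAverage_le_radius (v : κ → ι → ℝ) {A r b δ : ℝ} (hA : 0 ≤ A) (hr : 0 < r) (hr2 : r < 2)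
    (hδ : 0 < δ) (hδb : δ ≤ b) (hV : EntropyBound (Set.range v) A r)
    (hb : ∀ k i, |v k i| ≤ b) :
    (2 ^ Fintype.card ι)⁻¹ * ∑ σ : ι → Bool, ⨆ k, ENNReal.ofReal |radSum σ (v k)| ≤
      ENNReal.ofReal (chainConst A r b * Real.sqrt (Fintype.card ι)) *
        (ENNReal.ofReal (δ ^ (1 - r / 2)) + ENNReal.ofReal (δ ^ (1 - r / 2 - 2)) *
          ⨆ k, ENNReal.ofReal ((∑ i, v k i ^ 2) / Fintype.card ι)) := by
  have hn : (0 : ℝ) < Fintype.card ι := by exact_mod_cast Fintype.card_pos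
  have hbpos : 0 < b := hδ.trans_le hδb
  have hsq : ∀ k, (∑ i, v k i ^ 2) / Fintype.card ι ≤ b ^ 2 := by
    intro k
    rw [div_le_iff₀ hn]
    calc ∑ i, v k i ^ 2 ≤ ∑ _i : ι, b ^ 2 :=
          Finset.sum_le_sum fun i _ => sq_le_sq' (abs_le.1 (hb k i)).1 (abs_le.1 (hb k i)).2
      _ = b ^ 2 * Fintype.card ι := by
          rw [Finset.sum_const, Finset.card_univ, nsmul_eq_mul, mul_comm]
  set E : ℝ≥0∞ := ⨆ k, ENNReal.ofReal ((∑ i, v k i ^ 2) / Fintype.card ι) with hE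
  have hEb : E ≤ ENNReal.ofReal (b ^ 2) := iSup_le fun k => ENNReal.ofReal_le_ofReal (hsq k)
  have hEtop : E ≠ ∞ := ne_top_of_le_ne_top ENNReal.ofReal_ne_top hEb
  have hEE : E = ENNReal.ofReal E.toReal := (ENNReal.ofReal_toReal hEtop).symm
  have hEb' : E.toReal ≤ b ^ 2 := ENNReal.toReal_le_of_le_ofReal (by positivity) hEb
  have hle : ∀ k, (∑ i, v k i ^ 2) / Fintype.card ι ≤ E.toReal := fun k =>
    (ENNReal.ofReal_le_iff_le_toReal hEtop).1
      (le_iSup (fun k => ENNReal.ofReal ((∑ i, v k i ^ 2) / Fintype.card ι)) k)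
  set R : ℝ := max δ (Real.sqrt E.toReal) with hR
  have hRpos : 0 < R := hδ.trans_le (le_max_left _ _)
  have hRb : R ≤ b := max_le hδb ((Real.sqrt_le_left hbpos.le).2 hEb')
  refine (radAverage_le v hA hr hr2 hRpos hRb hV fun k => ?_).trans ?_
  · have h1 : E.toReal ≤ R ^ 2 := by
      rw [← Real.sqrt_le_left hRpos.le]; exact le_max_right _ _
    have h2 := (div_le_iff₀ hn).1 ((hle k).trans h1)
    linarith
  · rw [hEE, ← ENNReal.ofReal_mul (Real.rpow_nonneg hδ.le _),
      ← ENNReal.ofReal_add (Real.rpow_nonneg hδ.le _)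
        (mul_nonneg (Real.rpow_nonneg hδ.le _) ENNReal.toReal_nonneg),
      ← ENNReal.ofReal_mul (mul_nonneg (chainConst_nonneg hr2 _ _) (Real.sqrt_nonneg _))]
    refine ENNReal.ofReal_le_ofReal (mul_le_mul_of_nonneg_left ?_
      (mul_nonneg (chainConst_nonneg hr2 _ _) (Real.sqrt_nonneg _)))
    rcases le_total (Real.sqrt E.toReal) δ with h | h
    · rw [hR, max_eq_left h]
      exact le_add_of_nonneg_right (mul_nonneg (Real.rpow_nonneg hδ.le _) ENNReal.toReal_nonneg)
    · have h1 : R ^ 2 = E.toReal := by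
        rw [hR, max_eq_right h, Real.sq_sqrt ENNReal.toReal_nonneg]
      have h2 : R ^ (1 - r / 2) = R ^ (1 - r / 2 - 2) * E.toReal := by
        rw [← h1, ← Real.rpow_natCast, ← Real.rpow_add hRpos]
        congr 1; push_cast; ring
      rw [h2]
      have h3 : R ^ (1 - r / 2 - 2) ≤ δ ^ (1 - r / 2 - 2) :=
        Real.rpow_le_rpow_of_nonpos hδ (le_max_left _ _) (by linarith)
      have := mul_le_mul_of_nonneg_right h3 (ENNReal.toReal_nonneg (a := E))
      linarith [Real.rpow_nonneg hδ.le (1 - r / 2)]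

variable {T : Type*} [MeasurableSpace T] [Countable κ]

lemma integrable_of_abs_le (P : Measure T) [IsFiniteMeasure P] {f : T → ℝ} (hf : Measurable f)
    {b : ℝ} (hb : ∀ t, |f t| ≤ b) : Integrable f P :=
  Integrable.of_bound hf.aestronglyMeasurable b (Eventually.of_forall hb)

/-- The expected squared empirical radius of a bounded class exceeds the squared `L²(P)`-radius by a
term of order `n ^ (-1/2)`. -/
lemma lintegral_iSup_sq_le (P : Measure T) [IsProbabilityMeasure P] (h : κ → T → ℝ)
    (hm : ∀ k, Measurable (h k)) {A r b δ : ℝ} (hA : 0 ≤ A) (hr : 0 < r) (hr2 : r < 2)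
    (hbpos : 0 < b) (hb : ∀ k t, |h k t| ≤ b)
    (hV : ∀ y : ι → T, EntropyBound (Set.range fun k i => h k (y i)) A r)
    (hδ : ∀ k, ∫ t, h k t ^ 2 ∂P ≤ δ ^ 2) :
    ∫⁻ x : ι → T, ⨆ k, ENNReal.ofReal ((∑ i, h k (x i) ^ 2) / Fintype.card ι)
        ∂(Measure.pi fun _ => P) ≤
      ENNReal.ofReal (δ ^ 2 + 2 * (chainConst (A * (2 * b) ^ r) r (b ^ 2) *
        (b ^ 2) ^ (1 - r / 2) / Real.sqrt (Fintype.card ι))) := by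
  have hn : (0 : ℝ) < Fintype.card ι := by exact_mod_cast Fintype.card_pos
  set n : ℝ := ((Fintype.card ι : ℕ) : ℝ) with hndef
  have hb2 : ∀ k t, |h k t ^ 2| ≤ b ^ 2 := fun k t => by
    rw [abs_pow]; exact pow_le_pow_left₀ (abs_nonneg _) (hb k t) 2
  have hmsq : ∀ k, Measurable fun t => h k t ^ 2 := fun k => (hm k).pow_const 2
  have hsym := lintegral_iSup_empirical_le_radSum (ι := ι) P (fun k t => h k t ^ 2) hmsq
    fun k => integrable_of_abs_le P (hmsq k) (hb2 k)
  have hC : 0 ≤ chainConst (A * (2 * b) ^ r) r (b ^ 2) := chainConst_nonneg hr2 _ _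
  have hrad : ∀ x : ι → T, (2 ^ Fintype.card ι)⁻¹ * ∑ σ : ι → Bool,
      ⨆ k, ENNReal.ofReal |radSum σ (fun i => h k (x i) ^ 2)| ≤
      ENNReal.ofReal (chainConst (A * (2 * b) ^ r) r (b ^ 2) * Real.sqrt n *
        (b ^ 2) ^ (1 - r / 2)) := by
    intro x
    refine radAverage_le (fun k i => h k (x i) ^ 2) (by positivity) hr hr2 (by positivity) le_rfl
      ?_ fun k => ?_
    · have := (hV x).sq hbpos (by rintro _ ⟨k, rfl⟩ i; exact hb k (x i))
      convert this using 1
      ext w; simp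
    · calc ∑ i, (h k (x i) ^ 2) ^ 2 ≤ ∑ _i : ι, (b ^ 2) ^ 2 :=
            Finset.sum_le_sum fun i _ => sq_le_sq' (abs_le.1 (hb2 k (x i))).1
              (abs_le.1 (hb2 k (x i))).2
        _ = _ := by rw [Finset.sum_const, Finset.card_univ, nsmul_eq_mul]
  have hterm : ∀ (x : ι → T), ⨆ k, ENNReal.ofReal ((∑ i, h k (x i) ^ 2) / n) ≤
      ENNReal.ofReal (δ ^ 2) + ENNReal.ofReal n⁻¹ *
        ⨆ k, ENNReal.ofReal |∑ i, (h k (x i) ^ 2 - ∫ t, h k t ^ 2 ∂P)| := by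
    intro x
    refine iSup_le fun k => ?_
    refine le_trans ?_ (add_le_add_right (mul_le_mul_right (le_iSup (fun k =>
      ENNReal.ofReal |∑ i, (h k (x i) ^ 2 - ∫ t, h k t ^ 2 ∂P)|) k) _) _)
    rw [← ENNReal.ofReal_mul (by positivity), ← ENNReal.ofReal_add (by positivity) (by positivity)]
    refine ENNReal.ofReal_le_ofReal ?_
    rw [Finset.sum_sub_distrib, Finset.sum_const, Finset.card_univ, nsmul_eq_mul, ← hndef]
    have h1 := le_abs_self (∑ i, h k (x i) ^ 2 - n * ∫ t, h k t ^ 2 ∂P)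
    have h2 : (∑ i, h k (x i) ^ 2) / n =
        ∫ t, h k t ^ 2 ∂P + n⁻¹ * (∑ i, h k (x i) ^ 2 - n * ∫ t, h k t ^ 2 ∂P) := by
      field_simp; ring
    rw [h2]
    gcongr
    exact hδ k
  calc _ ≤ ∫⁻ x : ι → T, (ENNReal.ofReal (δ ^ 2) + ENNReal.ofReal n⁻¹ *
        ⨆ k, ENNReal.ofReal |∑ i, (h k (x i) ^ 2 - ∫ t, h k t ^ 2 ∂P)|)
        ∂(Measure.pi fun _ => P) := lintegral_mono hterm
    _ = ENNReal.ofReal (δ ^ 2) + ENNReal.ofReal n⁻¹ * ∫⁻ x : ι → T,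
        ⨆ k, ENNReal.ofReal |∑ i, (h k (x i) ^ 2 - ∫ t, h k t ^ 2 ∂P)|
        ∂(Measure.pi fun _ => P) := by
        rw [lintegral_add_left measurable_const, lintegral_const_mul]
        · simp
        · exact measurable_iSup_abs fun k => Finset.measurable_sum _ fun i _ =>
            ((hmsq k).comp (measurable_pi_apply i)).sub_const _
    _ ≤ ENNReal.ofReal (δ ^ 2) + ENNReal.ofReal n⁻¹ * (2 * ENNReal.ofReal
        (chainConst (A * (2 * b) ^ r) r (b ^ 2) * Real.sqrt n * (b ^ 2) ^ (1 - r / 2))) := by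
        gcongr
        refine hsym.trans ?_
        gcongr
        refine (lintegral_mono hrad).trans ?_
        simp
    _ = _ := by
        rw [show (2 : ℝ≥0∞) = ENNReal.ofReal 2 by simp, ← ENNReal.ofReal_mul (by norm_num),
          ← ENNReal.ofReal_mul (by positivity), ← ENNReal.ofReal_add (by positivity) ?_]
        · congr 2
          have : Real.sqrt n * Real.sqrt n = n := Real.mul_self_sqrt hn.le
          have h0 : 0 < Real.sqrt n := Real.sqrt_pos.2 hn
          have h3 : n⁻¹ = (Real.sqrt n)⁻¹ * (Real.sqrt n)⁻¹ := by rw [← mul_inv, this]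
          rw [h3]
          field_simp
        · positivity

/-- Maximal inequality: the expected supremum of the empirical process over a bounded class with
uniform entropy of order `ε ^ (-r)`, `r < 2`, and `L²(P)`-radius at most `δ`. -/
lemma lintegral_iSup_empirical_le (P : Measure T) [IsProbabilityMeasure P] (h : κ → T → ℝ)
    (hm : ∀ k, Measurable (h k)) {A r b δ : ℝ} (hA : 0 ≤ A) (hr : 0 < r) (hr2 : r < 2)
    (hδ0 : 0 < δ) (hδb : δ ≤ b) (hb : ∀ k t, |h k t| ≤ b)
    (hV : ∀ y : ι → T, EntropyBound (Set.range fun k i => h k (y i)) A r)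
    (hδ : ∀ k, ∫ t, h k t ^ 2 ∂P ≤ δ ^ 2) :
    ∫⁻ x : ι → T, ⨆ k, ENNReal.ofReal |∑ i, (h k (x i) - ∫ t, h k t ∂P)|
        ∂(Measure.pi fun _ => P) ≤
      ENNReal.ofReal (2 * (chainConst A r b * Real.sqrt (Fintype.card ι) *
        (2 * δ ^ (1 - r / 2) + δ ^ (1 - r / 2 - 2) *
          (2 * (chainConst (A * (2 * b) ^ r) r (b ^ 2) *
            (b ^ 2) ^ (1 - r / 2) / Real.sqrt (Fintype.card ι)))))) := by
  have hbpos : 0 < b := hδ0.trans_le hδb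
  set s := 1 - r / 2 with hs
  set C := chainConst A r b with hC
  set C' := chainConst (A * (2 * b) ^ r) r (b ^ 2) with hC'
  have hC0 : 0 ≤ C := chainConst_nonneg hr2 _ _
  have hC'0 : 0 ≤ C' := chainConst_nonneg hr2 _ _
  refine (lintegral_iSup_empirical_le_radSum P h hm fun k =>
    integrable_of_abs_le P (hm k) (hb k)).trans ?_
  have h1 : ∫⁻ x : ι → T, (2 ^ Fintype.card ι)⁻¹ *
        ∑ σ : ι → Bool, ⨆ k, ENNReal.ofReal |radSum σ (fun i => h k (x i))|
        ∂(Measure.pi fun _ => P) ≤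
      ENNReal.ofReal (C * Real.sqrt (Fintype.card ι)) *
        (ENNReal.ofReal (δ ^ s) + ENNReal.ofReal (δ ^ (s - 2)) *
          ENNReal.ofReal (δ ^ 2 + 2 * (C' * (b ^ 2) ^ s / Real.sqrt (Fintype.card ι)))) := by
    have hcond := fun x : ι → T => radAverage_le_radius (fun k i => h k (x i)) hA hr hr2 hδ0 hδb
      (hV x) fun k i => hb k (x i)
    refine (lintegral_mono hcond).trans ?_
    have hmE : Measurable fun x : ι → T =>
        ⨆ k, ENNReal.ofReal ((∑ i, h k (x i) ^ 2) / Fintype.card ι) :=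
      Measurable.iSup fun k => ((Finset.measurable_sum _ fun i _ =>
        ((hm k).comp (measurable_pi_apply i)).pow_const 2).div_const _).ennreal_ofReal
    rw [lintegral_const_mul _ ((hmE.const_mul _).const_add _), lintegral_add_left measurable_const,
      lintegral_const_mul _ hmE]
    simp only [lintegral_const, measure_univ, mul_one]
    gcongr
    exact lintegral_iSup_sq_le P h hm hA hr hr2 hbpos hb hV hδ
  refine (mul_le_mul_right h1 2).trans (le_of_eq ?_)
  have hds : 0 ≤ δ ^ s := Real.rpow_nonneg hδ0.le _
  have hds2 : 0 ≤ δ ^ (s - 2) := Real.rpow_nonneg hδ0.le _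
  have hpos : 0 ≤ 2 * (C' * (b ^ 2) ^ s / Real.sqrt (Fintype.card ι)) := by positivity
  rw [show (2 : ℝ≥0∞) = ENNReal.ofReal 2 by simp, ← ENNReal.ofReal_mul hds2,
    ← ENNReal.ofReal_add hds (by positivity), ← ENNReal.ofReal_mul (by positivity),
    ← ENNReal.ofReal_mul (by norm_num)]
  have h2 : δ ^ (s - 2) * δ ^ 2 = δ ^ s := by
    rw [← Real.rpow_natCast, ← Real.rpow_add hδ0]
    congr 1; push_cast; ring
  congr 3
  rw [mul_add, h2]
  ring

end MaximalInequality

/-! ### Metric entropy of convex hulls -/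

section ConvexHull

variable {E : Type*} [NormedAddCommGroup E] [InnerProductSpace ℝ E]

/-- Maurey's empirical method, derandomized. The hypothesis `hx` says that `x` lies in the closed
convex hull of the vectors `z j`, in its dual form; the terms of the approximating sum are selected
greedily. -/
lemma exists_sum_near_smul {J : Type*} (z : J → E) (x : E) {ρ : ℝ}
    (hx : ∀ y : E, ∃ j, inner ℝ y (z j) ≤ inner ℝ y x) (hz : ∀ j, ‖z j‖ ≤ ρ) (k : ℕ) :
    ∃ t : Fin k → J, ‖∑ a, z (t a) - (k : ℝ) • x‖ ^ 2 ≤ k * ρ ^ 2 := by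
  induction k with
  | zero => exact ⟨Fin.elim0, by simp⟩
  | succ k ih =>
    obtain ⟨t, ht⟩ := ih
    set S := ∑ a, z (t a) - (k : ℝ) • x with hS
    obtain ⟨j, hj⟩ := hx (S - x)
    refine ⟨Fin.cons j t, ?_⟩
    have h1 : ∑ a, z ((Fin.cons j t : Fin (k + 1) → J) a) - ((k + 1 : ℕ) : ℝ) • x =
        (S - x) + z j := by
      rw [Fin.sum_univ_succ]
      simp only [Fin.cons_zero, Fin.cons_succ, hS]
      push_cast
      rw [add_smul, one_smul]
      abel
    rw [h1, norm_add_sq_real, norm_sub_sq_real]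
    have h2 : ‖z j‖ ^ 2 ≤ ρ ^ 2 := pow_le_pow_left₀ (norm_nonneg _) (hz j) 2
    have h3 : inner ℝ (S - x) x = inner ℝ S x - ‖x‖ ^ 2 := by
      rw [inner_sub_left, real_inner_self_eq_norm_sq]
    push_cast
    nlinarith [sq_nonneg ‖x‖]

/-- Vectors `∑ w_c e_c` with `∑ |w_c| ≤ 1` lie in the convex hull of `0` and the `±e_c`, stated in
the dual form that is used by Maurey's method. -/
lemma exists_inner_le_of_sum_abs_le_one {C : Type*} [Fintype C] (w : C → ℝ) (hw : ∑ c, |w c| ≤ 1)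
    (e : C → E) (y : E) :
    inner ℝ y (0 : E) ≤ inner ℝ y (∑ c, w c • e c) ∨
      ∃ c, inner ℝ y (e c) ≤ inner ℝ y (∑ c, w c • e c) ∨
        inner ℝ y (-e c) ≤ inner ℝ y (∑ c, w c • e c) := by
  by_contra! h
  obtain ⟨h0, h1⟩ := h
  set q := inner ℝ y (∑ c, w c • e c) with hq
  rw [inner_zero_right] at h0
  have hsum : q = ∑ c, w c * inner ℝ y (e c) := by
    rw [hq, inner_sum]; simp_rw [real_inner_smul_right]
  have hb : ∀ c, |inner ℝ y (e c)| < -q := fun c => by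
    have := h1 c
    rw [inner_neg_right] at this
    exact abs_lt.2 ⟨by linarith [this.1], by linarith [this.2]⟩
  have habs : |q| ≤ ∑ c, |w c| * |inner ℝ y (e c)| := by
    rw [hsum]
    refine (Finset.abs_sum_le_sum_abs _ _).trans (le_of_eq ?_)
    simp_rw [abs_mul]
  rw [abs_of_neg h0] at habs
  obtain ⟨c₀, hc₀⟩ : ∃ c, w c ≠ 0 := by
    by_contra! hall
    rw [hsum] at h0
    simp [hall] at h0
  have hlt : ∑ c, |w c| * |inner ℝ y (e c)| < ∑ c, |w c| * (-q) :=
    Finset.sum_lt_sum (fun c _ => mul_le_mul_of_nonneg_left (hb c).le (abs_nonneg _))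
      ⟨c₀, Finset.mem_univ _, mul_lt_mul_of_pos_left (hb c₀) (abs_pos.2 hc₀)⟩
  rw [← Finset.sum_mul] at hlt
  nlinarith

/-- Rounding the coefficients of a combination of finitely many vectors of norm at most one. -/
lemma exists_grid_near {S : Type*} [Fintype S] (u : S → E) (hu : ∀ s, ‖u s‖ ≤ 1) (W : S → ℝ)
    (hW : ∀ s, |W s| ≤ 1) {m : ℕ} (hm : 0 < m) :
    ∃ g : S → Fin (2 * m + 1),
      ‖∑ s, W s • u s - ∑ s, ((((g s : ℕ) : ℝ) - m) / m) • u s‖ ≤ Fintype.card S / m := by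
  have hm' : (0 : ℝ) < m := by exact_mod_cast hm
  have hnn : ∀ s, 0 ≤ (W s + 1) * m := fun s =>
    mul_nonneg (by linarith [(abs_le.1 (hW s)).1]) hm'.le
  have hlt : ∀ s, ⌊(W s + 1) * m⌋₊ < 2 * m + 1 := fun s => by
    refine Nat.lt_succ_of_le (Nat.floor_le_of_le ?_)
    push_cast
    exact mul_le_mul_of_nonneg_right (by linarith [(abs_le.1 (hW s)).2]) hm'.le
  refine ⟨fun s => ⟨⌊(W s + 1) * m⌋₊, hlt s⟩, ?_⟩
  rw [← Finset.sum_sub_distrib]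
  calc _ ≤ ∑ s, ‖W s • u s - (((⌊(W s + 1) * m⌋₊ : ℝ) - m) / m) • u s‖ := norm_sum_le _ _
    _ ≤ ∑ _s : S, 1 / (m : ℝ) := by
        refine Finset.sum_le_sum fun s _ => ?_
        rw [← sub_smul, norm_smul]
        refine (mul_le_of_le_one_right (norm_nonneg _) (hu s)).trans ?_
        rw [Real.norm_eq_abs, abs_le]
        have h1 := Nat.floor_le (hnn s)
        have h2 := Nat.lt_floor_add_one ((W s + 1) * m)
        have h3 : W s - ((⌊(W s + 1) * m⌋₊ : ℝ) - m) / m =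
            ((W s + 1) * m - ⌊(W s + 1) * m⌋₊) / m := by field_simp; ring
        rw [h3]
        constructor
        · have : 0 ≤ ((W s + 1) * m - ⌊(W s + 1) * m⌋₊) / m := div_nonneg (by linarith) hm'.le
          have : 0 ≤ 1 / (m : ℝ) := by positivity
          linarith
        · exact div_le_div_of_nonneg_right (by linarith) hm'.le
    _ = _ := by rw [Finset.sum_const, Finset.card_univ, nsmul_eq_mul]; ring

/-- Two-scale covering of an absolutely convex hull. Each atom is split into its image in a coarse
`δ`-net and a remainder of norm at most `δ`: the first parts span few dimensions and are covered
by a grid of coefficients, the remainders by averages of `k ≈ (δ / ε)²` terms as in Maurey's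
method. -/
lemma exists_cover_absConvexHull {C S S' : Type*} [Fintype C] [Fintype S] [Fintype S']
    [DecidableEq S]
    (z : C → E) (π : C → S) (u : S → E) (π' : C → S') (u' : S' → E) {δ ε : ℝ} (hε : 0 < ε)
    (hεδ : ε ≤ δ) (hu : ∀ s, ‖u s‖ ≤ 1) (hπ : ∀ c, ‖z c - u (π c)‖ ≤ δ)
    (hπ' : ∀ c, ‖z c - u' (π' c)‖ ≤ ε) {m k : ℕ} (hm : 0 < m)
    (hmS : Fintype.card S ≤ m * ε) (hk : 0 < k) (hkδ : δ ^ 2 ≤ k * ε ^ 2) :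
    ∃ (N : ℕ) (c : Fin N → E),
      N ≤ (2 * m + 1) ^ Fintype.card S * (2 * (Fintype.card S * Fintype.card S') + 1) ^ k ∧
      ∀ w : C → ℝ, ∑ a, |w a| ≤ 1 → ∃ j, ‖∑ a, w a • z a - c j‖ ≤ 4 * ε := by
  classical
  have hk' : (0 : ℝ) < k := by exact_mod_cast hk
  have hm' : (0 : ℝ) < m := by exact_mod_cast hm
  let diff : S × S' → E := fun p => if ‖u' p.2 - u p.1‖ ≤ 2 * δ then u' p.2 - u p.1 else 0
  let val : Option (Bool × (S × S')) → E := fun o =>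
    match o with
    | none => 0
    | some (true, p) => diff p
    | some (false, p) => -diff p
  have hdiff : ∀ p, ‖diff p‖ ≤ 2 * δ := by
    intro p
    simp only [diff]
    split_ifs with h
    · exact h
    · rw [norm_zero]; linarith
  have hval : ∀ o, ‖val o‖ ≤ 2 * δ := by
    rintro (_ | ⟨_ | _, p⟩)
    · simp only [val, norm_zero]; linarith
    · simp only [val, norm_neg]; exact hdiff p
    · exact hdiff p
  let I := (S → Fin (2 * m + 1)) × (Fin k → Option (Bool × (S × S')))
  let ctr : I → E := fun i => ∑ s, ((((i.1 s : ℕ) : ℝ) - m) / m) • u s +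
    (k : ℝ)⁻¹ • ∑ a, val (i.2 a)
  refine ⟨Fintype.card I, fun j => ctr ((Fintype.equivFin I).symm j), ?_, ?_⟩
  · refine le_of_eq ?_
    simp only [I, Fintype.card_prod, Fintype.card_fun, Fintype.card_fin, Fintype.card_option,
      Fintype.card_bool]
  · intro w hw
    let W : S → ℝ := fun s => ∑ a with π a = s, w a
    have hW : ∀ s, |W s| ≤ 1 := by
      intro s
      refine (Finset.abs_sum_le_sum_abs _ _).trans (le_trans ?_ hw)
      exact Finset.sum_le_sum_of_subset_of_nonneg (Finset.filter_subset _ _)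
        fun _ _ _ => abs_nonneg _
    obtain ⟨g, hg⟩ := exists_grid_near u hu W hW hm
    have hWu : ∑ s, W s • u s = ∑ a, w a • u (π a) := by
      rw [← Finset.sum_fiberwise (s := Finset.univ) (g := π)]
      refine Finset.sum_congr rfl fun s _ => ?_
      simp only [W]
      rw [Finset.sum_smul]
      refine Finset.sum_congr rfl fun a ha => ?_
      rw [(Finset.mem_filter.1 ha).2]
    let e : C → E := fun a => diff (π a, π' a)
    have he : ∀ a, e a = u' (π' a) - u (π a) := by
      intro a
      have h1 : ‖u' (π' a) - u (π a)‖ ≤ 2 * δ := by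
        have h2 : u' (π' a) - u (π a) = (z a - u (π a)) - (z a - u' (π' a)) := by abel
        rw [h2]
        refine (norm_sub_le _ _).trans ?_
        linarith [hπ a, hπ' a]
      simp only [e, diff, if_pos h1]
    set x := ∑ a, w a • e a with hx
    obtain ⟨t, ht⟩ := exists_sum_near_smul val x (fun y => by
      rcases exists_inner_le_of_sum_abs_le_one w hw e y with h | ⟨a, h | h⟩
      · exact ⟨none, h⟩
      · exact ⟨some (true, (π a, π' a)), h⟩
      · exact ⟨some (false, (π a, π' a)), h⟩) hval k
    have hmaurey : ‖x - (k : ℝ)⁻¹ • ∑ a, val (t a)‖ ≤ 2 * ε := by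
      have h1 : x - (k : ℝ)⁻¹ • ∑ a, val (t a) =
          -((k : ℝ)⁻¹ • (∑ a, val (t a) - (k : ℝ) • x)) := by
        rw [smul_sub, smul_smul, inv_mul_cancel₀ hk'.ne', one_smul]; abel
      rw [h1, norm_neg, norm_smul, norm_inv, Real.norm_natCast, inv_mul_le_iff₀ hk']
      refine le_of_sq_le_sq (ht.trans ?_) (by positivity)
      nlinarith
    refine ⟨Fintype.equivFin I (g, t), ?_⟩
    simp only [Equiv.symm_apply_apply, ctr]
    have hdec : ∑ a, w a • z a - (∑ s, ((((g s : ℕ) : ℝ) - m) / m) • u s +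
        (k : ℝ)⁻¹ • ∑ a, val (t a)) =
        (∑ s, W s • u s - ∑ s, ((((g s : ℕ) : ℝ) - m) / m) • u s) +
        (∑ a, w a • (z a - u' (π' a))) + (x - (k : ℝ)⁻¹ • ∑ a, val (t a)) := by
      have h1 : ∑ a, w a • z a = ∑ a, w a • u (π a) + ∑ a, w a • (z a - u' (π' a)) + x := by
        rw [hx, ← Finset.sum_add_distrib, ← Finset.sum_add_distrib]
        refine Finset.sum_congr rfl fun a _ => ?_
        rw [he, ← smul_add, ← smul_add]
        congr 1; abel
      rw [h1, hWu]; abel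
    rw [hdec]
    have h2 : ‖∑ a, w a • (z a - u' (π' a))‖ ≤ ε := by
      calc _ ≤ ∑ a, ‖w a • (z a - u' (π' a))‖ := norm_sum_le _ _
        _ ≤ ∑ a, |w a| * ε := Finset.sum_le_sum fun a _ => by
            rw [norm_smul, Real.norm_eq_abs]
            exact mul_le_mul_of_nonneg_left (hπ' a) (abs_nonneg _)
        _ ≤ ε := by rw [← Finset.sum_mul]; exact mul_le_of_le_one_left hε.le hw
    have h3 : (Fintype.card S : ℝ) / m ≤ ε := by rw [div_le_iff₀ hm']; linarith
    refine (norm_add_le _ _).trans ?_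
    have := norm_add_le (∑ s, W s • u s - ∑ s, ((((g s : ℕ) : ℝ) - m) / m) • u s)
      (∑ a, w a • (z a - u' (π' a)))
    linarith

end ConvexHull

/-! ### Metric entropy of distribution functions of signed measures -/

section OrthantEntropy

variable {ι : Type*} [Fintype ι] {d : ℕ}

/-- The values at the points `y` of the indicator of the orthant `[u, 1]`, normalized so that the
Euclidean norm is the `L²`-norm for the uniform distribution on the points. -/
noncomputable def orthantVec (y : ι → Cube d) (u : Cube d) : EuclideanSpace ℝ ι :=
  WithLp.toLp 2 fun i => Set.indicator (Set.Ici u) (fun _ => (Real.sqrt (Fintype.card ι))⁻¹) (y i)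

/-- The set of sample points that are at least `a` in coordinate `l`. -/
noncomputable def upperPoints (y : ι → Cube d) (l : Fin d) (a : unitInterval) : Finset ι :=
  {i | a ≤ y i l}

lemma card_upperPoints_le (y : ι → Cube d) (l : Fin d) (a : unitInterval) :
    (upperPoints y l a).card ≤ Fintype.card ι := Finset.card_le_univ _

/-- The marginal proportions of sample points above `u`, rounded down to multiples of `1 / Q`. -/
noncomputable def orthantCode (y : ι → Cube d) (Q : ℕ) (u : Cube d) : Fin d → Fin (Q + 1) :=
  fun l => ⟨Q * (upperPoints y l (u l)).card / Fintype.card ι, Nat.lt_succ_of_le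
    (Nat.div_le_of_le_mul (by
      rw [mul_comm]; exact Nat.mul_le_mul_right _ (card_upperPoints_le y l (u l))))⟩

lemma norm_orthantVec_le [Nonempty ι] (y : ι → Cube d) (u : Cube d) : ‖orthantVec y u‖ ≤ 1 := by
  have hn : (0 : ℝ) < Fintype.card ι := by exact_mod_cast Fintype.card_pos
  rw [EuclideanSpace.norm_eq, Real.sqrt_le_one]
  calc ∑ i, ‖orthantVec y u i‖ ^ 2 ≤ ∑ _i : ι, ((Fintype.card ι : ℕ) : ℝ)⁻¹ := by
        refine Finset.sum_le_sum fun i _ => ?_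
        simp only [orthantVec, Set.indicator]
        split_ifs
        · rw [norm_inv, inv_pow, Real.norm_eq_abs, sq_abs, Real.sq_sqrt hn.le]
        · simp
    _ = 1 := by
        rw [Finset.sum_const, Finset.card_univ, nsmul_eq_mul, mul_inv_cancel₀ hn.ne']

/-- Orthants with the same rounded marginal proportions are close in `L²`, since the sections of the
orthants are nested in each coordinate. -/
lemma norm_orthantVec_sub_le [Nonempty ι] (y : ι → Cube d) {Q : ℕ} (hQ : 0 < Q) {u v : Cube d}
    (h : orthantCode y Q u = orthantCode y Q v) :
    ‖orthantVec y u - orthantVec y v‖ ^ 2 ≤ d / Q := by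
  classical
  have hn0 : 0 < Fintype.card ι := Fintype.card_pos
  have hn : (0 : ℝ) < Fintype.card ι := by exact_mod_cast hn0
  have hQ' : (0 : ℝ) < Q := by exact_mod_cast hQ
  let B : Fin d → Finset ι := fun l => symmDiff (upperPoints y l (u l)) (upperPoints y l (v l))
  have hB : ∀ l, ((B l).card : ℝ) ≤ Fintype.card ι / Q := by
    intro l
    have hcode : Q * (upperPoints y l (u l)).card / Fintype.card ι =
        Q * (upperPoints y l (v l)).card / Fintype.card ι := congrArg Fin.val (congrFun h l)
    have key : ∀ a b : unitInterval, a ≤ b →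
        Q * (upperPoints y l a).card / Fintype.card ι =
          Q * (upperPoints y l b).card / Fintype.card ι →
        ((symmDiff (upperPoints y l a) (upperPoints y l b)).card : ℝ) ≤ Fintype.card ι / Q := by
      intro a b hab hc
      have hsub : upperPoints y l b ⊆ upperPoints y l a := by
        intro i hi
        simp only [upperPoints, Finset.mem_filter, Finset.mem_univ, true_and] at hi ⊢
        exact hab.trans hi
      have hs : symmDiff (upperPoints y l a) (upperPoints y l b) =
          upperPoints y l a \ upperPoints y l b := symmDiff_of_ge hsub
      rw [hs, Finset.card_sdiff_of_subset hsub, le_div_iff₀ hQ']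
      have h1 := Nat.div_add_mod (Q * (upperPoints y l a).card) (Fintype.card ι)
      have h2 := Nat.div_add_mod (Q * (upperPoints y l b).card) (Fintype.card ι)
      have h3 := Nat.mod_lt (Q * (upperPoints y l a).card) hn0
      have h4 : ((upperPoints y l a).card - (upperPoints y l b).card) * Q ≤ Fintype.card ι := by
        rw [Nat.sub_mul, mul_comm _ Q, mul_comm _ Q]
        rw [hc] at h1
        omega
      exact_mod_cast h4
    rcases le_total (u l) (v l) with h' | h'
    · exact key _ _ h' hcode
    · simp only [B]; rw [symmDiff_comm]; exact key _ _ h' hcode.symm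
  have hterm : ∀ i, (orthantVec y u - orthantVec y v) i ^ 2 ≤
      ∑ l, if i ∈ B l then ((Fintype.card ι : ℕ) : ℝ)⁻¹ else 0 := by
    intro i
    have hnn : ∀ l, 0 ≤ if i ∈ B l then ((Fintype.card ι : ℕ) : ℝ)⁻¹ else 0 := fun l => by
      split_ifs <;> positivity
    by_cases hex : ∃ l, i ∈ B l
    · obtain ⟨l, hl⟩ := hex
      refine le_trans ?_ (Finset.single_le_sum (fun l _ => hnn l) (Finset.mem_univ l))
      rw [if_pos hl]
      have hsq : ((Real.sqrt (Fintype.card ι))⁻¹) ^ 2 = ((Fintype.card ι : ℕ) : ℝ)⁻¹ := by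
        rw [inv_pow, Real.sq_sqrt hn.le]
      simp only [orthantVec, Set.indicator, PiLp.sub_apply]
      split_ifs
      · simp
      · rw [sub_zero, hsq]
      · rw [zero_sub, neg_sq, hsq]
      · simp
    · push Not at hex
      have hiff : u ≤ y i ↔ v ≤ y i := by
        refine forall_congr' fun l => ?_
        have := hex l
        simp only [B, Finset.mem_symmDiff, upperPoints, Finset.mem_filter, Finset.mem_univ,
          true_and] at this
        tauto
      have h0 : (orthantVec y u - orthantVec y v) i = 0 := by
        simp only [orthantVec, Set.indicator, PiLp.sub_apply, Set.mem_Ici, hiff, sub_self]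
      rw [h0]
      simpa using Finset.sum_nonneg fun l _ => hnn l
  rw [EuclideanSpace.norm_sq_eq]
  simp_rw [Real.norm_eq_abs, sq_abs]
  calc _ ≤ ∑ i, ∑ l, (if i ∈ B l then ((Fintype.card ι : ℕ) : ℝ)⁻¹ else 0) :=
        Finset.sum_le_sum fun i _ => hterm i
    _ = ∑ l, ((B l).card : ℝ) * ((Fintype.card ι : ℕ) : ℝ)⁻¹ := by
        rw [Finset.sum_comm]
        refine Finset.sum_congr rfl fun l _ => ?_
        rw [← Finset.sum_filter, Finset.sum_const, nsmul_eq_mul]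
        congr 2
        simp
    _ ≤ ∑ _l : Fin d, (Fintype.card ι / Q) * ((Fintype.card ι : ℕ) : ℝ)⁻¹ := by
        gcongr with l
        exact hB l
    _ = d / Q := by
        rw [Finset.sum_const, Finset.card_univ, nsmul_eq_mul, Fintype.card_fin]
        field_simp

/-- The orthants form a class of polynomial covering numbers, uniformly over the points `y`. -/
lemma exists_orthant_net [Nonempty ι] (y : ι → Cube d) {Q : ℕ} (hQ : 0 < Q) {δ : ℝ} (hδ : 0 ≤ δ)
    (hQδ : d ≤ δ ^ 2 * Q) :
    ∃ u : (Fin d → Fin (Q + 1)) → EuclideanSpace ℝ ι, (∀ s, ‖u s‖ ≤ 1) ∧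
      ∀ x, ‖orthantVec y x - u (orthantCode y Q x)‖ ≤ δ := by
  classical
  have hQ' : (0 : ℝ) < Q := by exact_mod_cast hQ
  refine ⟨fun s => if h : ∃ x, orthantCode y Q x = s then orthantVec y h.choose else 0, ?_, ?_⟩
  · intro s
    dsimp only
    split_ifs
    · exact norm_orthantVec_le y _
    · simp
  · intro x
    have hx : ∃ x', orthantCode y Q x' = orthantCode y Q x := ⟨x, rfl⟩
    simp only [dif_pos hx]
    refine le_of_sq_le_sq ((norm_orthantVec_sub_le y hQ hx.choose_spec.symm).trans ?_) hδ
    rw [div_le_iff₀ hQ']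
    exact hQδ

/-- The constant in the entropy bound for convex hulls of orthants in dimension `d`: the first factor
counts the coordinates of the two parts of the covering, the second bounds the logarithm of the
number of values of each coordinate. -/
noncomputable def orthantConst (d : ℕ) : ℝ :=
  (((d : ℝ) + 3) ^ d + 2) * (5 * (((d : ℝ) + 3) ^ d) ^ 2 +
    ((2 * d + 2 * (d + 1) + 2 * (2 * (d + 1)) * d : ℕ) : ℝ))

lemma orthantConst_nonneg (d : ℕ) : 0 ≤ orthantConst d := by
  unfold orthantConst; positivity

/-- The two scales are `τ` and `τ ^ p` with `p = 2 (d + 1)`; the coarse net has at most a constant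
times `τ ^ (-2 d)` elements, so that both parts of the covering have entropy `O(τ ^ (1 - 2 p))`.
-/
lemma exists_cover_orthant_hull [Nonempty ι] (y : ι → Cube d) {C : Type*} [Fintype C]
    (x : C → Cube d) {τ : ℝ} (hτ : 0 < τ) (hτ1 : τ ≤ 1) :
    ∃ (N : ℕ) (c : Fin N → EuclideanSpace ℝ ι),
      (N : ℝ) ≤ Real.exp (orthantConst d * τ⁻¹ ^ (2 * (2 * (d + 1)) - 1)) ∧
      ∀ w : C → ℝ, ∑ a, |w a| ≤ 1 →
        ∃ j, ‖∑ a, w a • orthantVec y (x a) - c j‖ ≤ 4 * τ ^ (2 * (d + 1)) := by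
  set p := 2 * (d + 1) with hp
  set X := τ⁻¹ with hX
  have hX1 : 1 ≤ X := (one_le_inv₀ hτ).2 hτ1
  have hX0 : 0 < X := by positivity
  have hτX : τ = X⁻¹ := by rw [hX, inv_inv]
  -- resolutions of the coarse and of the fine net
  have hres : ∀ q : ℕ, ∃ Q : ℕ, 0 < Q ∧ (d : ℝ) ≤ (τ ^ q) ^ 2 * Q ∧
      ((Q : ℝ) + 1) ^ d ≤ ((d : ℝ) + 3) ^ d * X ^ (2 * q * d) := by
    intro q
    have hpos : 0 < ((d : ℝ) + 1) * X ^ (2 * q) := by positivity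
    refine ⟨⌈((d : ℝ) + 1) * X ^ (2 * q)⌉₊, Nat.ceil_pos.2 hpos, ?_, ?_⟩
    · have h1 := Nat.le_ceil (((d : ℝ) + 1) * X ^ (2 * q))
      have h2 : (τ ^ q) ^ 2 * (((d : ℝ) + 1) * X ^ (2 * q)) = d + 1 := by
        rw [hτX, ← pow_mul, mul_comm q 2, inv_pow]; field_simp
      have h3 := mul_le_mul_of_nonneg_left h1 (sq_nonneg (τ ^ q))
      linarith
    · have h1 := (Nat.ceil_lt_add_one hpos.le).le
      have h2 : 1 ≤ X ^ (2 * q) := one_le_pow₀ hX1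
      rw [pow_mul X (2 * q) d, ← mul_pow]
      refine pow_le_pow_left₀ (by positivity) ?_ _
      linarith
  obtain ⟨Q, hQ, hQd, hQc⟩ := hres 1
  obtain ⟨Q', hQ', hQd', hQc'⟩ := hres p
  obtain ⟨u, hu, hnet⟩ := exists_orthant_net y hQ (by positivity) hQd
  obtain ⟨u', hu', hnet'⟩ := exists_orthant_net y hQ' (by positivity) hQd'
  rw [pow_one] at hnet
  set G : ℝ := ((d : ℝ) + 3) ^ d with hG
  have hG1 : 1 ≤ G := one_le_pow₀ (by linarith [Nat.cast_nonneg (α := ℝ) d])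
  set nS : ℕ := (Q + 1) ^ d with hnS
  set nS' : ℕ := (Q' + 1) ^ d with hnS'
  have hS : Fintype.card (Fin d → Fin (Q + 1)) = nS := by simp [hnS]
  have hS' : Fintype.card (Fin d → Fin (Q' + 1)) = nS' := by simp [hnS']
  have hnSc : (nS : ℝ) ≤ G * X ^ (2 * d) := by
    rw [hnS]; push_cast; simpa using hQc
  have hnSc' : (nS' : ℝ) ≤ G * X ^ (2 * p * d) := by
    rw [hnS']; push_cast; exact hQc'
  have hnS0 : 0 < nS := by positivity
  have hnSr : (0 : ℝ) < nS := by exact_mod_cast hnS0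
  have hεX : τ ^ p = (X ^ p)⁻¹ := by rw [hτX, inv_pow]
  set m : ℕ := ⌈(nS : ℝ) * X ^ p⌉₊ with hm
  set k : ℕ := ⌈X ^ (2 * p - 2)⌉₊ with hk
  have hm0 : 0 < m := Nat.ceil_pos.2 (by positivity)
  have hk0 : 0 < k := Nat.ceil_pos.2 (by positivity)
  have hp1 : 1 ≤ p := by omega
  obtain ⟨N, c, hN, hc⟩ := exists_cover_absConvexHull (fun a => orthantVec y (x a))
    (fun a => orthantCode y Q (x a)) u (fun a => orthantCode y Q' (x a)) u' (δ := τ) (ε := τ ^ p)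
    (by positivity) (pow_le_of_le_one hτ.le hτ1 (by omega)) hu (fun a => hnet _) (fun a => hnet' _)
    hm0 (by
      rw [hS, hεX, ← div_eq_mul_inv, le_div_iff₀ (by positivity)]
      exact Nat.le_ceil _) hk0 (by
      have h1 := Nat.le_ceil (X ^ (2 * p - 2))
      have h2 : τ ^ 2 = X ^ (2 * p - 2) * (τ ^ p) ^ 2 := by
        rw [← pow_mul, show p * 2 = (2 * p - 2) + 2 by omega, pow_add, ← mul_assoc, ← mul_pow,
          hX, inv_mul_cancel₀ hτ.ne', one_pow, one_mul]
      rw [h2]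
      exact mul_le_mul_of_nonneg_right h1 (by positivity))
  refine ⟨N, c, ?_, hc⟩
  rw [hS, hS'] at hN
  set P : ℕ := 2 * d + p + 2 * p * d with hP
  set L : ℝ := 5 * G ^ 2 * X ^ P with hL
  have hGG : G ≤ G ^ 2 := by nlinarith
  have hm1 : ((2 * m + 1 : ℕ) : ℝ) ≤ L := by
    have h1 := (Nat.ceil_lt_add_one (a := (nS : ℝ) * X ^ p) (by positivity)).le
    have h2 : (nS : ℝ) * X ^ p ≤ G * X ^ (2 * d + p) := by
      rw [pow_add, ← mul_assoc]; gcongr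
    have h3 : X ^ (2 * d + p) ≤ X ^ P := pow_le_pow_right₀ hX1 (by omega)
    have h4 : G * X ^ (2 * d + p) ≤ G ^ 2 * X ^ P := by gcongr
    have h5 : 1 ≤ G ^ 2 * X ^ P := one_le_mul_of_one_le_of_one_le (one_le_pow₀ hG1)
      (one_le_pow₀ hX1)
    push_cast
    rw [hL]
    linarith
  have hk1 : ((2 * (nS * nS') + 1 : ℕ) : ℝ) ≤ L := by
    have h1 : (nS : ℝ) * nS' ≤ G ^ 2 * X ^ (2 * d + 2 * p * d) := by
      calc (nS : ℝ) * nS' ≤ (G * X ^ (2 * d)) * (G * X ^ (2 * p * d)) := by gcongr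
        _ = _ := by rw [pow_add]; ring
    have h3 : X ^ (2 * d + 2 * p * d) ≤ X ^ P := pow_le_pow_right₀ hX1 (by omega)
    have h4 : G ^ 2 * X ^ (2 * d + 2 * p * d) ≤ G ^ 2 * X ^ P := by gcongr
    have h5 : 1 ≤ G ^ 2 * X ^ P := one_le_mul_of_one_le_of_one_le (one_le_pow₀ hG1)
      (one_le_pow₀ hX1)
    push_cast
    rw [hL]
    linarith
  have hL1 : 1 ≤ L := le_trans (by push_cast; linarith [Nat.cast_nonneg (α := ℝ) m]) hm1
  have hlogL : Real.log L ≤ (5 * G ^ 2 + P) * X := by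
    rw [hL, Real.log_mul (by positivity) (by positivity), Real.log_pow]
    have h1 : Real.log (5 * G ^ 2) ≤ 5 * G ^ 2 := Real.log_le_self (by positivity)
    have h2 : Real.log X ≤ X := Real.log_le_self hX0.le
    have h3 : 5 * G ^ 2 ≤ 5 * G ^ 2 * X := le_mul_of_one_le_right (by positivity) hX1
    have h4 := mul_le_mul_of_nonneg_left h2 (Nat.cast_nonneg (α := ℝ) P)
    rw [add_mul]
    linarith
  have hkc : (k : ℝ) ≤ 2 * X ^ (2 * p - 2) := by
    have h1 := (Nat.ceil_lt_add_one (a := X ^ (2 * p - 2)) (by positivity)).le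
    have h2 : 1 ≤ X ^ (2 * p - 2) := one_le_pow₀ hX1
    linarith
  calc (N : ℝ) ≤ ((2 * m + 1 : ℕ) : ℝ) ^ nS * ((2 * (nS * nS') + 1 : ℕ) : ℝ) ^ k := by
        exact_mod_cast hN
    _ ≤ L ^ nS * L ^ k := by gcongr
    _ = Real.exp ((nS + k) * Real.log L) := by
        rw [← pow_add, ← Nat.cast_add, ← Real.log_pow, Real.exp_log (by positivity)]
    _ ≤ _ := by
        refine Real.exp_le_exp.2 ?_
        have h1 : (nS : ℝ) ≤ G * X ^ (2 * p - 2) := hnSc.trans (by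
          have : X ^ (2 * d) ≤ X ^ (2 * p - 2) := pow_le_pow_right₀ hX1 (by omega)
          gcongr)
        calc ((nS : ℝ) + k) * Real.log L
            ≤ ((G + 2) * X ^ (2 * p - 2)) * ((5 * G ^ 2 + P) * X) := by
              refine mul_le_mul (by linarith) hlogL (Real.log_nonneg hL1) (by positivity)
          _ = orthantConst d * X ^ (2 * p - 1) := by
              rw [show 2 * p - 1 = (2 * p - 2) + 1 by omega, pow_succ, orthantConst, ← hG, ← hp,
                ← hP]
              ring

end OrthantEntropy

/-! ### Functions of bounded sectional variation -/

section SectionalVariation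

variable {d : ℕ}

/-- A constructor for membership in `svBall d 0 s M`, from a measure dominating the signed
measure. -/
lemma mem_svBall_zero_of_dominated {s : Finset (Fin d)} {M : ℝ≥0} {f : Cube d → ℝ}
    (μ : SignedMeasure (Cube d)) (m : Measure (Cube d))
    (h : ∀ E, MeasurableSet E → ‖μ E‖ₑ ≤ m E) (hs : m {u | ∃ i, i ∉ s ∧ u i ≠ 0} = 0)
    (hm : m Set.univ ≤ M) (hf : ∀ x, f x = μ (Set.Iic x)) : f ∈ svBall d 0 s M := by
  have hle : μ.totalVariation ≤ m := by
    rw [SignedMeasure.totalVariation_eq_variation]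
    exact VectorMeasure.variation_le_of_forall_enorm_le h
  exact ⟨μ, le_antisymm ((hle _).trans hs.le) zero_le, (hle _).trans hm, hf⟩

lemma svBall_zero_add {s : Finset (Fin d)} {M N : ℝ≥0} {f g : Cube d → ℝ}
    (hf : f ∈ svBall d 0 s M) (hg : g ∈ svBall d 0 s N) : f + g ∈ svBall d 0 s (M + N) := by
  obtain ⟨μ, hμs, hμ, hf⟩ := hf
  obtain ⟨ν, hνs, hν, hg⟩ := hg
  refine mem_svBall_zero_of_dominated (μ + ν) (μ.totalVariation + ν.totalVariation) ?_ ?_ ?_ ?_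
  · intro E _
    rw [_root_.add_apply, Measure.add_apply]
    exact (enorm_add_le _ _).trans (add_le_add (μ.enorm_le_totalVariation E)
      (ν.enorm_le_totalVariation E))
  · rw [Measure.add_apply, hμs, hνs, add_zero]
  · rw [Measure.add_apply, ENNReal.coe_add]; exact add_le_add hμ hν
  · intro x; rw [Pi.add_apply, hf, hg, _root_.add_apply]

lemma svBall_zero_smul {s : Finset (Fin d)} {M : ℝ≥0} {f : Cube d → ℝ} (c : ℝ)
    (hf : f ∈ svBall d 0 s M) : c • f ∈ svBall d 0 s (‖c‖₊ * M) := by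
  obtain ⟨μ, hμs, hμ, hf⟩ := hf
  refine mem_svBall_zero_of_dominated (c • μ) (‖c‖₊ • μ.totalVariation) ?_ ?_ ?_ ?_
  · intro E _
    rw [_root_.smul_apply, Measure.coe_nnreal_smul_apply, enorm_smul, enorm_eq_nnnorm]
    gcongr
    exact μ.enorm_le_totalVariation E
  · rw [Measure.coe_nnreal_smul_apply, hμs, mul_zero]
  · rw [Measure.coe_nnreal_smul_apply, ENNReal.coe_mul]; gcongr
  · intro x; rw [Pi.smul_apply, hf, _root_.smul_apply]

lemma svBall_zero_mono {s t : Finset (Fin d)} (hst : s ⊆ t) {M N : ℝ≥0} (hMN : M ≤ N)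
    {f : Cube d → ℝ} (hf : f ∈ svBall d 0 s M) : f ∈ svBall d 0 t N := by
  obtain ⟨μ, hμs, hμ, hf⟩ := hf
  refine ⟨μ, measure_mono_null ?_ hμs, hμ.trans (by exact_mod_cast hMN), hf⟩
  rintro u ⟨i, hi, hu⟩
  exact ⟨i, fun h => hi (hst h), hu⟩

lemma zero_mem_svBall_zero (s : Finset (Fin d)) (M : ℝ≥0) : (0 : Cube d → ℝ) ∈ svBall d 0 s M :=
  ⟨0, by rw [SignedMeasure.totalVariation_zero]; simp,
    by rw [SignedMeasure.totalVariation_zero]; simp, by simp⟩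

lemma abs_le_of_mem_svBall_zero {s : Finset (Fin d)} {M : ℝ≥0} {f : Cube d → ℝ}
    (hf : f ∈ svBall d 0 s M) (x : Cube d) : |f x| ≤ M := by
  obtain ⟨μ, -, hμ, hf⟩ := hf
  rw [hf x, ← Real.norm_eq_abs]
  refine (μ.norm_le_totalVariation _).trans (ENNReal.toReal_le_of_le_ofReal M.2 ?_)
  exact (measure_mono (Set.subset_univ _)).trans (hμ.trans (by simp))

lemma measurable_of_mem_svBall_zero {s : Finset (Fin d)} {M : ℝ≥0} {f : Cube d → ℝ}
    (hf : f ∈ svBall d 0 s M) : Measurable f := by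
  obtain ⟨μ, -, -, hf⟩ := hf
  have hIic : ∀ (ν : Measure (Cube d)) [IsFiniteMeasure ν],
      Measurable fun x : Cube d => ν.real (Set.Iic x) := by
    intro ν _
    have hset : MeasurableSet {p : Cube d × Cube d | p.2 ≤ p.1} :=
      measurableSet_le measurable_snd measurable_fst
    exact (measurable_measure_prodMk_left hset).ennreal_toReal
  have h : f = fun x => μ.toJordanDecomposition.posPart.real (Set.Iic x) -
      μ.toJordanDecomposition.negPart.real (Set.Iic x) := by
    funext x
    rw [hf x, SignedMeasure.apply_eq_posPart_real_sub_negPart_real _ measurableSet_Iic]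
  rw [h]
  exact (hIic _).sub (hIic _)

lemma measurableSet_lowerSet_on (t : Finset (Fin d)) (x : Cube d) :
    MeasurableSet {u : Cube d | ∀ i ∈ t, u i ≤ x i} := by
  have h : {u : Cube d | ∀ i ∈ t, u i ≤ x i} = ⋂ i ∈ t, {u : Cube d | u i ≤ x i} := by
    ext; simp
  rw [h]
  exact Finset.measurableSet_biInter _ fun i _ =>
    measurableSet_le (measurable_pi_apply i) measurable_const

/-- The primitive of a bounded function is the distribution function of the signed measure with this
density, projected to the face of the coordinates in `t`. -/
lemma primitive_mem_svBall_zero {t : Finset (Fin d)} {g : Cube d → ℝ} (hg : Measurable g) {M : ℝ≥0}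
    (hM : ∀ x, |g x| ≤ M) : primitive t g ∈ svBall d 0 t M := by
  classical
  have hint : Integrable g (volume : Measure (Cube d)) := integrable_of_abs_le _ hg hM
  let pr : Cube d → Cube d := fun u i => if i ∈ t then u i else 0
  have hpr : Measurable pr := measurable_pi_lambda _ fun i => by
    by_cases hi : i ∈ t
    · simpa [pr, hi] using measurable_pi_apply i
    · simp [pr, hi]
  have hface : MeasurableSet {u : Cube d | ∃ i, i ∉ t ∧ u i ≠ 0} := by
    have h : {u : Cube d | ∃ i, i ∉ t ∧ u i ≠ 0} =
        ⋃ i ∈ (tᶜ : Finset (Fin d)), {u : Cube d | u i = 0}ᶜ := by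
      ext; simp
    rw [h]
    exact Finset.measurableSet_biUnion _ fun i _ =>
      (measurableSet_eq_fun (measurable_pi_apply i) measurable_const).compl
  refine mem_svBall_zero_of_dominated ((volume.withDensityᵥ g).map pr)
    (M • (volume.map pr)) ?_ ?_ ?_ ?_
  · intro E hE
    rw [VectorMeasure.map_apply _ hpr hE, withDensityᵥ_apply hint (hpr hE),
      Measure.coe_nnreal_smul_apply, Measure.map_apply hpr hE]
    refine (enorm_integral_le_lintegral_enorm _).trans ?_
    calc ∫⁻ x in pr ⁻¹' E, ‖g x‖ₑ ≤ ∫⁻ _x in pr ⁻¹' E, (M : ℝ≥0∞) := by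
          refine lintegral_mono fun x => ?_
          rw [← ofReal_norm, Real.norm_eq_abs, ← ENNReal.ofReal_coe_nnreal]
          exact ENNReal.ofReal_le_ofReal (hM x)
      _ = M * volume (pr ⁻¹' E) := by simp
  · rw [Measure.coe_nnreal_smul_apply, Measure.map_apply hpr hface]
    have : pr ⁻¹' {u : Cube d | ∃ i, i ∉ t ∧ u i ≠ 0} = ∅ := by
      ext u
      simp only [Set.mem_preimage, Set.mem_ofPred_eq, Set.mem_empty_iff_false, iff_false,
        not_exists, not_and, not_not, pr]
      intro i hi
      simp [hi]
    rw [this, measure_empty, mul_zero]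
  · rw [Measure.coe_nnreal_smul_apply, Measure.map_apply hpr MeasurableSet.univ]
    simp
  · intro x
    have hpre : pr ⁻¹' Set.Iic x = {u : Cube d | ∀ i ∈ t, u i ≤ x i} := by
      ext u
      simp only [Set.mem_preimage, Set.mem_Iic, Set.mem_ofPred_eq, Pi.le_def, pr]
      refine forall_congr' fun i => ?_
      by_cases hi : i ∈ t
      · simp [hi]
      · simp [hi]
    rw [VectorMeasure.map_apply _ hpr measurableSet_Iic,
      withDensityᵥ_apply hint (hpr measurableSet_Iic), hpre, primitive,
      integral_indicator (measurableSet_lowerSet_on t x)]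

lemma svBall_zero_sum {ι : Type*} (S : Finset ι) {s : Finset (Fin d)} (f : ι → Cube d → ℝ)
    (c : ι → ℝ≥0) (h : ∀ i ∈ S, f i ∈ svBall d 0 s (c i)) :
    ∑ i ∈ S, f i ∈ svBall d 0 s (∑ i ∈ S, c i) := by
  classical
  induction S using Finset.induction_on with
  | empty => simpa using zero_mem_svBall_zero s 0
  | insert i S hi ih =>
    rw [Finset.sum_insert hi, Finset.sum_insert hi]
    exact svBall_zero_add (h i (Finset.mem_insert_self _ _))
      (ih fun j hj => h j (Finset.mem_insert_of_mem hj))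

/-- The sectional variation norm of order zero is bounded by the norms of higher order. -/
lemma svBall_subset_svBall_zero (k : ℕ) (s : Finset (Fin d)) (M : ℝ≥0) :
    svBall d k s M ⊆ svBall d 0 s M := by
  induction k generalizing s M with
  | zero => exact subset_rfl
  | succ k ih =>
    rintro f ⟨g, c, hg, hc, hf⟩
    have hf' : f = ∑ t ∈ s.powerset, primitive t (g t) := by
      funext x; rw [hf x, Finset.sum_apply]
    rw [hf']
    refine svBall_zero_mono subset_rfl hc (svBall_zero_sum _ _ _ fun t ht => ?_)
    have h0 := ih t (c t) (hg t ht)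
    exact svBall_zero_mono (Finset.mem_powerset.1 ht) le_rfl
      (primitive_mem_svBall_zero (measurable_of_mem_svBall_zero h0) (abs_le_of_mem_svBall_zero h0))

lemma measurable_of_mem_svBall {k : ℕ} {s : Finset (Fin d)} {M : ℝ≥0} {f : Cube d → ℝ}
    (hf : f ∈ svBall d k s M) : Measurable f :=
  measurable_of_mem_svBall_zero (svBall_subset_svBall_zero k s M hf)

lemma abs_le_of_mem_svBall {k : ℕ} {s : Finset (Fin d)} {M : ℝ≥0} {f : Cube d → ℝ}
    (hf : f ∈ svBall d k s M) (x : Cube d) : |f x| ≤ M :=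
  abs_le_of_mem_svBall_zero (svBall_subset_svBall_zero k s M hf) x

lemma primitive_add {t : Finset (Fin d)} {f g : Cube d → ℝ} (hf : Integrable f)
    (hg : Integrable g) : primitive t (f + g) = primitive t f + primitive t g := by
  funext x
  simp only [primitive, Pi.add_apply, Set.indicator_add']
  exact integral_add (hf.indicator (measurableSet_lowerSet_on t x))
    (hg.indicator (measurableSet_lowerSet_on t x))

lemma primitive_smul (t : Finset (Fin d)) (c : ℝ) (g : Cube d → ℝ) :
    primitive t (c • g) = c • primitive t g := by
  funext x
  simp only [primitive, Pi.smul_apply, smul_eq_mul]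
  rw [← integral_const_mul]
  refine integral_congr_ae (Eventually.of_forall fun u => ?_)
  by_cases hu : u ∈ {u : Cube d | ∀ i ∈ t, u i ≤ x i}
  · simp only [Set.indicator_of_mem hu, Pi.smul_apply, smul_eq_mul]
  · simp only [Set.indicator_of_notMem hu, mul_zero]

lemma integrable_of_mem_svBall {k : ℕ} {s : Finset (Fin d)} {M : ℝ≥0} {f : Cube d → ℝ}
    (hf : f ∈ svBall d k s M) : Integrable f :=
  integrable_of_abs_le _ (measurable_of_mem_svBall hf) (abs_le_of_mem_svBall hf)

lemma svBall_add {k : ℕ} {s : Finset (Fin d)} {M N : ℝ≥0} {f g : Cube d → ℝ}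
    (hf : f ∈ svBall d k s M) (hg : g ∈ svBall d k s N) : f + g ∈ svBall d k s (M + N) := by
  induction k generalizing s M N f g with
  | zero => exact svBall_zero_add hf hg
  | succ k ih =>
    obtain ⟨f', c, hf', hc, hf⟩ := hf
    obtain ⟨g', e, hg', he, hg⟩ := hg
    refine ⟨f' + g', c + e, fun t ht => ih (hf' t ht) (hg' t ht), ?_, fun x => ?_⟩
    · simp only [Pi.add_apply, Finset.sum_add_distrib]; exact add_le_add hc he
    · rw [Pi.add_apply, hf, hg, ← Finset.sum_add_distrib]
      refine Finset.sum_congr rfl fun t ht => ?_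
      rw [Pi.add_apply, primitive_add (integrable_of_mem_svBall (hf' t ht))
        (integrable_of_mem_svBall (hg' t ht)), Pi.add_apply]

lemma svBall_smul {k : ℕ} {s : Finset (Fin d)} {M : ℝ≥0} {f : Cube d → ℝ} (c : ℝ)
    (hf : f ∈ svBall d k s M) : c • f ∈ svBall d k s (‖c‖₊ * M) := by
  induction k generalizing s M f with
  | zero => exact svBall_zero_smul c hf
  | succ k ih =>
    obtain ⟨g, e, hg, he, hf⟩ := hf
    refine ⟨fun t => c • g t, fun t => ‖c‖₊ * e t, fun t ht => ih (hg t ht), ?_, fun x => ?_⟩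
    · rw [← Finset.mul_sum]; gcongr
    · rw [Pi.smul_apply, hf, Finset.smul_sum]
      simp_rw [primitive_smul, Pi.smul_apply]

lemma zero_mem_svBall (k : ℕ) (s : Finset (Fin d)) (M : ℝ≥0) :
    (0 : Cube d → ℝ) ∈ svBall d k s M := by
  induction k generalizing s M with
  | zero => exact zero_mem_svBall_zero s M
  | succ k ih =>
    refine ⟨fun _ => 0, fun _ => 0, fun t _ => ih t 0, by simp, fun x => ?_⟩
    simp [primitive]

/-- Spline basis functions have sectional variation norm at most one. -/
lemma splines_subset_svBall (k : ℕ) (s : Finset (Fin d)) : splines d k s ⊆ svBall d k s 1 := by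
  classical
  induction k generalizing s with
  | zero =>
    rintro φ ⟨u, hu, rfl⟩
    refine mem_svBall_zero_of_dominated (Measure.dirac u).toSignedMeasure (Measure.dirac u)
      ?_ ?_ ?_ ?_
    · intro E hE
      rw [Measure.toSignedMeasure_apply_measurable hE, Measure.real,
        Real.enorm_of_nonneg ENNReal.toReal_nonneg, ENNReal.ofReal_toReal (measure_ne_top _ _)]
    · rw [Measure.dirac_apply, Set.indicator_of_notMem]
      rintro ⟨i, hi, hui⟩
      exact hui (hu i hi)
    · simp
    · intro x
      rw [Measure.toSignedMeasure_apply_measurable measurableSet_Iic, Measure.real,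
        Measure.dirac_apply]
      simp only [Set.indicator, Set.mem_Ici, Set.mem_Iic, Pi.one_apply]
      split_ifs <;> simp
  | succ k ih =>
    rintro φ ⟨t, ht, g, hg, rfl⟩
    refine ⟨Pi.single t g, Pi.single t 1, fun t' _ => ?_, ?_, fun x => ?_⟩
    · by_cases h : t' = t
      · subst h; simpa using ih t' hg
      · simpa [h] using zero_mem_svBall k t' 0
    · rw [Finset.sum_pi_single', if_pos ht]
    · rw [Finset.sum_eq_single t]
      · simp
      · intro t' _ h
        simp [h, primitive]
      · exact fun h => absurd ht h

/-- `D^(k)([0,1]^d)` as a linear space. -/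
def DSubmodule (d k : ℕ) : Submodule ℝ (Cube d → ℝ) where
  carrier := DSpace d k
  zero_mem' := ⟨0, zero_mem_svBall _ _ _⟩
  add_mem' := by rintro f g ⟨M, hf⟩ ⟨N, hg⟩; exact ⟨M + N, svBall_add hf hg⟩
  smul_mem' := by rintro c f ⟨M, hf⟩; exact ⟨‖c‖₊ * M, svBall_smul c hf⟩

lemma DSpace_subset_zero (d k : ℕ) : DSpace d k ⊆ DSpace d 0 :=
  fun _ ⟨M, hf⟩ => ⟨M, svBall_subset_svBall_zero _ _ _ hf⟩

lemma PCDesign.basis_mem {k : ℕ} (B : PCDesign d k) (l : Fin B.p) : B.basis l ∈ DSpace d k :=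
  (DSubmodule d k).sum_mem fun j _ => (DSubmodule d k).smul_mem _
    ⟨1, splines_subset_svBall k _ (B.phi_mem j)⟩

lemma PCDesign.fn_eq {k : ℕ} (B : PCDesign d k) (a : Fin B.p → ℝ) :
    B.fn a = ∑ l, a l • B.basis l := by
  simp [PCDesign.fn, Fintype.linearCombination_apply]

lemma PCDesign.fn_mem {k : ℕ} (B : PCDesign d k) (a : Fin B.p → ℝ) : B.fn a ∈ DSpace d k := by
  rw [B.fn_eq]
  exact (DSubmodule d k).sum_mem fun l _ => (DSubmodule d k).smul_mem _ (B.basis_mem l)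

end SectionalVariation

section DBallEntropy

variable {d : ℕ} {ι : Type*} [Fintype ι]

/-- On finitely many points, the distribution function of a signed measure is a combination of
orthant indicators, one for each cell of points of the cube that lie below the same sample points.
-/
lemma exists_orthant_combination (y : ι → Cube d) :
    ∃ (C : Type) (_ : Fintype C) (x : C → Cube d), ∀ (μ : SignedMeasure (Cube d)),
      ∃ w : C → ℝ, ∑ a, |w a| ≤ μ.totalVariation.real Set.univ ∧
        ∀ i, μ (Set.Iic (y i)) * (Real.sqrt (Fintype.card ι))⁻¹ =
          (∑ a, w a • orthantVec y (x a)) i := by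
  classical
  let e := Fintype.equivFin ι
  let cell : Cube d → Finset (Fin (Fintype.card ι)) := fun u => {i | u ≤ y (e.symm i)}
  let C := {A : Finset (Fin (Fintype.card ι)) // ∃ u, cell u = A}
  let x : C → Cube d := fun A => A.2.choose
  have hx : ∀ A : C, cell (x A) = A.1 := fun A => A.2.choose_spec
  let D : C → Set (Cube d) := fun A => {u | cell u = A.1}
  have hDm : ∀ A, MeasurableSet (D A) := by
    intro A
    have h : D A = ⋂ i, {u : Cube d | u ≤ y (e.symm i) ↔ i ∈ A.1} := by
      ext u
      simp only [D, cell, Set.mem_ofPred_eq, Finset.ext_iff, Finset.mem_filter, Finset.mem_univ,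
        true_and, Set.mem_iInter]
    rw [h]
    refine MeasurableSet.iInter fun i => ?_
    by_cases hi : i ∈ A.1
    · have h1 : {u : Cube d | u ≤ y (e.symm i) ↔ i ∈ A.1} = Set.Iic (y (e.symm i)) := by
        ext; simp [hi]
      rw [h1]; exact measurableSet_Iic
    · have h1 : {u : Cube d | u ≤ y (e.symm i) ↔ i ∈ A.1} = (Set.Iic (y (e.symm i)))ᶜ := by
        ext; simp [hi]
      rw [h1]; exact measurableSet_Iic.compl
  have hDd : ∀ A A' : C, A ≠ A' → Disjoint (D A) (D A') := by
    intro A A' h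
    refine Set.disjoint_left.2 fun u hu hu' => h (Subtype.ext ?_)
    exact (show cell u = A.1 from hu).symm.trans hu'
  refine ⟨C, inferInstance, x, fun μ => ⟨fun A => μ (D A), ?_, fun i => ?_⟩⟩
  · calc ∑ A, |μ (D A)| ≤ ∑ A, μ.totalVariation.real (D A) :=
          Finset.sum_le_sum fun A _ => μ.norm_le_totalVariation _
      _ = μ.totalVariation.real (⋃ A ∈ Finset.univ, D A) :=
          (measureReal_biUnion_finset (fun A _ A' _ h => hDd A A' h) fun A _ => hDm A).symm
      _ ≤ _ := measureReal_mono (Set.subset_univ _)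
  · have hunion : Set.Iic (y i) = ⋃ A ∈ (Finset.univ.filter fun A : C => e i ∈ A.1), D A := by
      ext u
      simp only [Set.mem_Iic, Set.mem_iUnion, Finset.mem_filter, Finset.mem_univ, true_and, D,
        Set.mem_ofPred_eq, exists_prop]
      constructor
      · intro hu
        exact ⟨⟨cell u, u, rfl⟩, by simpa [cell] using hu, rfl⟩
      · rintro ⟨A, hA, hu⟩
        rw [← hu] at hA
        simpa [cell] using hA
    have hval : ∀ A : C, orthantVec y (x A) i =
        if e i ∈ A.1 then (Real.sqrt (Fintype.card ι))⁻¹ else 0 := by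
      intro A
      have : e i ∈ A.1 ↔ x A ≤ y i := by
        rw [← hx A]; simp [cell]
      simp only [orthantVec, Set.indicator, Set.mem_Ici, this]
    have hsum : (∑ A, μ (D A) • orthantVec y (x A)) i =
        ∑ A : C, μ (D A) * orthantVec y (x A) i := by
      simp [WithLp.ofLp_sum, Finset.sum_apply]
    rw [hsum, hunion, VectorMeasure.of_biUnion_finset (fun A _ A' _ h => hDd A A' h)
      fun A _ => hDm A, Finset.sum_mul, Finset.sum_filter]
    refine Finset.sum_congr rfl fun A _ => ?_
    rw [hval A]
    split_ifs <;> simp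

/-- The exponent of the metric entropy of functions of bounded sectional variation. -/
noncomputable def svExponent (d : ℕ) : ℝ := 2 - 1 / ((2 * (d + 1) : ℕ) : ℝ)

lemma svExponent_lt (d : ℕ) : svExponent d < 2 := by
  unfold svExponent
  have : (0 : ℝ) < 1 / ((2 * (d + 1) : ℕ) : ℝ) := by positivity
  linarith

lemma svExponent_pos (d : ℕ) : 0 < svExponent d := by
  unfold svExponent
  have h1 : (1 : ℝ) ≤ ((2 * (d + 1) : ℕ) : ℝ) := by exact_mod_cast (by omega)
  have : 1 / ((2 * (d + 1) : ℕ) : ℝ) ≤ 1 := by rw [div_le_one (by linarith)]; exact h1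
  linarith

/-- The restrictions of `D^(k)_M([0,1]^d)` to finite samples have metric entropy of order `ε ^ (-r)`
with `r < 2`, uniformly over the samples. -/
lemma entropyBound_DBall [Nonempty ι] (k : ℕ) {M : ℝ≥0} (hM : 0 < M) (y : ι → Cube d) :
    EntropyBound ((fun f i => f (y i)) '' DBall d k M)
      (orthantConst d * (4 * M) ^ svExponent d) (svExponent d) := by
  intro ε hε
  have hM' : (0 : ℝ) < M := hM
  have hn : (0 : ℝ) < Fintype.card ι := by exact_mod_cast Fintype.card_pos
  have hsn : 0 < Real.sqrt (Fintype.card ι) := Real.sqrt_pos.2 hn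
  rcases le_or_gt (4 * (M : ℝ)) ε with hεM | hεM
  · refine ⟨1, fun _ => 0, ?_, ?_⟩
    · have := orthantConst_nonneg d
      simpa using (by positivity :
        0 ≤ orthantConst d * (4 * (M : ℝ)) ^ svExponent d * ε ^ (-svExponent d))
    · rintro _ ⟨f, hf, rfl⟩
      refine ⟨0, ?_⟩
      calc ∑ i, (f (y i) - (0 : ι → ℝ) i) ^ 2 ≤ ∑ _i : ι, ε ^ 2 := by
            refine Finset.sum_le_sum fun i _ => ?_
            have := abs_le.1 (abs_le_of_mem_svBall hf (y i))
            rw [Pi.zero_apply, sub_zero]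
            exact sq_le_sq' (by linarith) (by linarith)
        _ = _ := by rw [Finset.sum_const, Finset.card_univ, nsmul_eq_mul]
  · set p : ℕ := 2 * (d + 1) with hp
    have hp0 : (0 : ℝ) < p := by rw [hp]; positivity
    set x : ℝ := ε / (4 * M) with hx
    have hx0 : 0 < x := by positivity
    have hx1 : x ≤ 1 := by rw [hx, div_le_one (by positivity)]; exact hεM.le
    set τ : ℝ := x ^ ((p : ℝ)⁻¹) with hτ
    have hτ0 : 0 < τ := Real.rpow_pos_of_pos hx0 _
    have hτ1 : τ ≤ 1 := Real.rpow_le_one hx0.le hx1 (by positivity)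
    have hτp : τ ^ p = x := by
      rw [hτ, ← Real.rpow_natCast, ← Real.rpow_mul hx0.le, inv_mul_cancel₀ hp0.ne', Real.rpow_one]
    obtain ⟨C, hC, z, hz⟩ := exists_orthant_combination y
    obtain ⟨N, c, hN, hc⟩ := exists_cover_orthant_hull y z hτ0 hτ1
    refine ⟨N, fun j i => M * Real.sqrt (Fintype.card ι) * c j i, ?_, ?_⟩
    · refine hN.trans (le_of_eq ?_)
      congr 1
      rw [mul_assoc]
      congr 1
      have h1 : τ⁻¹ ^ (2 * p - 1) = x ^ (-svExponent d) := by
        rw [inv_pow, hτ, ← Real.rpow_natCast, ← Real.rpow_mul hx0.le, ← Real.rpow_neg hx0.le]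
        congr 2
        rw [svExponent, ← hp, Nat.cast_sub (by omega)]
        push_cast
        field_simp
      rw [← hp, h1, hx, Real.div_rpow hε.le (by positivity),
        Real.rpow_neg (by positivity : 0 ≤ 4 * (M : ℝ)), div_inv_eq_mul, mul_comm]
    · rintro _ ⟨f, hf, rfl⟩
      obtain ⟨μ, -, hμ, hf⟩ := svBall_subset_svBall_zero k _ M hf
      obtain ⟨w, hw, hrep⟩ := hz μ
      have hTV : μ.totalVariation.real Set.univ ≤ M :=
        ENNReal.toReal_le_of_le_ofReal M.2 (hμ.trans (by simp))
      obtain ⟨j, hj⟩ := hc (fun a => w a / M) (by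
        simp_rw [abs_div, abs_of_pos hM']
        rw [← Finset.sum_div, div_le_one hM']
        exact hw.trans hTV)
      refine ⟨j, ?_⟩
      rw [hτp] at hj
      set v := ∑ a, (w a / M) • orthantVec y (z a) with hv
      have hvi : ∀ i, f (y i) = M * Real.sqrt (Fintype.card ι) * v i := by
        intro i
        have h1 : v = (M : ℝ)⁻¹ • ∑ a, w a • orthantVec y (z a) := by
          rw [hv, Finset.smul_sum]
          refine Finset.sum_congr rfl fun a _ => ?_
          rw [smul_smul, div_eq_inv_mul]
        rw [h1, PiLp.smul_apply, ← hrep i, hf, smul_eq_mul]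
        field_simp
      have hsq : ∑ i, (v i - c j i) ^ 2 ≤ (4 * x) ^ 2 := by
        have h1 := EuclideanSpace.norm_sq_eq (v - c j)
        simp_rw [Real.norm_eq_abs, sq_abs, PiLp.sub_apply] at h1
        rw [← h1]
        exact pow_le_pow_left₀ (norm_nonneg _) hj 2
      have hsq' : Real.sqrt (Fintype.card ι) ^ 2 = ((Fintype.card ι : ℕ) : ℝ) :=
        Real.sq_sqrt hn.le
      calc ∑ i, (f (y i) - M * Real.sqrt (Fintype.card ι) * c j i) ^ 2
          = (M : ℝ) ^ 2 * ((Fintype.card ι : ℕ) : ℝ) * ∑ i, (v i - c j i) ^ 2 := by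
            rw [Finset.mul_sum]
            refine Finset.sum_congr rfl fun i _ => ?_
            rw [hvi i]
            linear_combination (M : ℝ) ^ 2 * (v i - c j i) ^ 2 * hsq'
        _ ≤ (M : ℝ) ^ 2 * ((Fintype.card ι : ℕ) : ℝ) * (4 * x) ^ 2 := by gcongr
        _ = _ := by rw [hx]; field_simp

end DBallEntropy

/-! ### Sign vectors and the active model -/

section Signs

variable {p : ℕ} (α : Fin p → ℝ)

lemma signVec_sq (l : Fin p) : signVec α l ^ 2 = if α l ≠ 0 then 1 else 0 := by
  unfold signVec
  rcases lt_trichotomy (α l) 0 with h | h | h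
  · rw [Real.sign_of_neg h, if_pos h.ne]; norm_num
  · simp [h]
  · rw [Real.sign_of_pos h, if_pos h.ne']; norm_num

lemma abs_signVec (l : Fin p) : |signVec α l| = signVec α l ^ 2 := by
  unfold signVec
  rcases lt_trichotomy (α l) 0 with h | h | h
  · rw [Real.sign_of_neg h]; norm_num
  · simp [h]
  · rw [Real.sign_of_pos h]; norm_num

lemma sum_signVec_sq : ∑ l, signVec α l ^ 2 = numActive α := by
  classical
  simp_rw [signVec_sq]
  rw [Finset.sum_boole, numActive, Set.ncard_eq_toFinset_card']
  congr 2
  ext l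
  rw [Set.mem_toFinset]
  simp [active]

lemma signVec_mem_activeSpace : signVec α ∈ activeSpace α := by
  intro l hl
  have : α l = 0 := by simpa [active] using hl
  simp [signVec, this]

lemma starDir_mem_activeSpace : starDir α ∈ activeSpace α := by
  intro l hl
  simp [starDir, signVec_mem_activeSpace α l hl]

lemma sum_starDir_mul_signVec (h : 0 < numActive α) : ∑ l, starDir α l * signVec α l = 1 := by
  have hJ : (numActive α : ℝ) ≠ 0 := by exact_mod_cast h.ne'
  have h1 : ∀ l, starDir α l * signVec α l = signVec α l ^ 2 / numActive α := fun l => by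
    rw [starDir]; ring
  simp_rw [h1]
  rw [← Finset.sum_div, sum_signVec_sq, div_self hJ]

lemma l2_unitDir (h : 0 < numActive α) : l2 (unitDir α) = 1 := by
  have hJ : (0 : ℝ) < numActive α := by exact_mod_cast h
  rw [l2, Real.sqrt_eq_one]
  simp_rw [unitDir, div_pow, Real.sq_sqrt hJ.le]
  rw [← Finset.sum_div, sum_signVec_sq, div_self hJ.ne']

lemma l1_starDir (h : 0 < numActive α) : l1 (starDir α) = 1 := by
  have hJ : (0 : ℝ) < numActive α := by exact_mod_cast h
  rw [l1]
  simp_rw [starDir, abs_div, abs_of_pos hJ, abs_signVec]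
  rw [← Finset.sum_div, sum_signVec_sq, div_self hJ.ne']

lemma l2_starDir (h : 0 < numActive α) : l2 (starDir α) = (Real.sqrt (numActive α))⁻¹ := by
  have hJ : (0 : ℝ) < numActive α := by exact_mod_cast h
  rw [l2]
  simp_rw [starDir, div_pow]
  rw [← Finset.sum_div, sum_signVec_sq, ← Real.sqrt_inv]
  congr 1
  field_simp

lemma sqrt_mul_sum_unitDir (a : Fin p → ℝ) (h : 0 < numActive α) :
    Real.sqrt (numActive α) * ∑ l, a l * unitDir α l = ∑ l, a l * signVec α l := by
  have hJ : 0 < Real.sqrt (numActive α) := Real.sqrt_pos.2 (by exact_mod_cast h)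
  rw [Finset.mul_sum]
  refine Finset.sum_congr rfl fun l _ => ?_
  rw [unitDir]; field_simp

lemma eq_zero_of_numActive_eq_zero (h : numActive α = 0) {a : Fin p → ℝ}
    (ha : a ∈ activeSpace α) : a = 0 := by
  have h1 : active α = ∅ := by
    rwa [numActive, Set.ncard_eq_zero (Set.toFinite _)] at h
  funext l
  exact ha l (by simp [h1])

/-- Cauchy–Schwarz against the sign vector. -/
lemma abs_sum_mul_signVec_le {a : Fin p → ℝ} (ha : l2 a ≤ (Real.sqrt (numActive α))⁻¹) :
    |∑ l, a l * signVec α l| ≤ 1 := by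
  rw [← sq_le_one_iff_abs_le_one]
  have h1 := Finset.sum_mul_sq_le_sq_mul_sq Finset.univ a (signVec α)
  rw [sum_signVec_sq] at h1
  have hnn : 0 ≤ ∑ l, a l ^ 2 := Finset.sum_nonneg fun l _ => sq_nonneg _
  have h2 : ∑ l, a l ^ 2 ≤ (numActive α : ℝ)⁻¹ := by
    rw [l2, ← Real.sqrt_inv] at ha
    exact (Real.sqrt_le_sqrt_iff (by positivity)).1 ha
  refine h1.trans ((mul_le_mul_of_nonneg_right h2 (Nat.cast_nonneg _)).trans ?_)
  exact inv_mul_le_one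

/-- Along directions supported on the active set and orthogonal to the sign vector, small steps do
not change the `L₁`-norm. -/
lemma eventually_l1_add_smul {a : Fin p → ℝ} (ha : a ∈ orthSpace α) :
    ∀ᶠ t : ℝ in 𝓝 0, l1 (α + t • a) = l1 α := by
  have key : ∀ l, ∀ᶠ t : ℝ in 𝓝 0, |α l + t * a l| = |α l| + t * (a l * signVec α l) := by
    intro l
    have hc : Tendsto (fun t : ℝ => α l + t * a l) (𝓝 0) (𝓝 (α l)) := by
      have : Continuous fun t : ℝ => α l + t * a l := by fun_prop
      simpa using this.tendsto 0
    unfold signVec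
    rcases lt_trichotomy (α l) 0 with h | h | h
    · filter_upwards [hc.eventually (gt_mem_nhds h)] with t ht
      rw [abs_of_neg ht, abs_of_neg h, Real.sign_of_neg h]; ring
    · have : a l = 0 := ha.1 l (by simp [active, h])
      simp [this]
    · filter_upwards [hc.eventually (lt_mem_nhds h)] with t ht
      rw [abs_of_pos ht, abs_of_pos h, Real.sign_of_pos h]; ring
  filter_upwards [eventually_all.2 key] with t ht
  simp only [l1, Pi.add_apply, Pi.smul_apply, smul_eq_mul]
  simp_rw [ht]
  rw [Finset.sum_add_distrib, ← Finset.mul_sum, ha.2, mul_zero, add_zero]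

/-- Coefficient vectors of the active model are functions on the active set. -/
noncomputable def activeSpaceEquiv : activeSpace α ≃ₗ[ℝ] ({l // α l ≠ 0} → ℝ) where
  toFun a l := a.1 l
  map_add' _ _ := rfl
  map_smul' _ _ := rfl
  invFun g := ⟨fun l => if h : α l = 0 then 0 else g ⟨l, h⟩, fun l hl => by
    have : α l = 0 := by simpa [active] using hl
    simp [this]⟩
  left_inv a := by
    ext l
    by_cases h : α l = 0
    · have : a.1 l = 0 := a.2 l (by simp [active, h])
      simp [h, this]
    · simp [h]
  right_inv g := by
    ext ⟨l, h⟩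
    simp [h]

lemma finrank_orthSpace (h : 0 < numActive α) :
    Module.finrank ℝ (orthSpace α) + 1 = numActive α := by
  classical
  let f : activeSpace α →ₗ[ℝ] ℝ :=
    { toFun := fun a => ∑ l, a.1 l * signVec α l
      map_add' := fun a b => by simp [add_mul, Finset.sum_add_distrib]
      map_smul' := fun c a => by simp [mul_assoc, Finset.mul_sum] }
  have hsurj : Function.Surjective f := by
    intro c
    refine ⟨c • ⟨starDir α, starDir_mem_activeSpace α⟩, ?_⟩
    rw [map_smul]
    have : f ⟨starDir α, starDir_mem_activeSpace α⟩ = 1 := sum_starDir_mul_signVec α h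
    rw [this, smul_eq_mul, mul_one]
  have hker : (LinearMap.ker f).map (activeSpace α).subtype = orthSpace α := by
    ext a
    simp only [Submodule.mem_map, LinearMap.mem_ker, Submodule.subtype_apply]
    constructor
    · rintro ⟨b, hb, rfl⟩; exact ⟨b.2, hb⟩
    · rintro ⟨h1, h2⟩; exact ⟨⟨a, h1⟩, h2, rfl⟩
  have h1 := f.finrank_range_add_finrank_ker
  rw [LinearMap.range_eq_top.2 hsurj, finrank_top, Module.finrank_self,
    (activeSpaceEquiv α).finrank_eq, Module.finrank_fintype_fun_eq_card] at h1
  rw [← hker, Submodule.finrank_map_subtype_eq, add_comm, h1, numActive,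
    Set.ncard_eq_toFinset_card', Fintype.card_subtype]
  congr 1
  ext l
  rw [Set.mem_toFinset]
  simp [active]

end Signs

/-! ### Score equations of the PC-HAL fit -/

section Scores

variable {d k : ℕ} {𝒪 : Type*}

/-- The principal component functions are linearly independent: if `θ_a` vanishes at the design
points, then `Hᵀ W H E a = E (eig · a)` vanishes, and the columns of `E` are orthonormal. -/
lemma PCDesign.fn_injective (B : PCDesign d k) : Function.Injective B.fn := by
  rw [injective_iff_map_eq_zero]
  intro a ha
  set H : Matrix (Fin B.m) (Fin B.N) ℝ := Matrix.of fun i j => B.phi j (B.x i) with hH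
  have h1 : H.mulVec (B.E.mulVec a) = 0 := by
    funext i
    have h2 := congrFun ha (B.x i)
    rw [B.fn_eq] at h2
    simp only [Finset.sum_apply, Pi.smul_apply, PCDesign.basis, smul_eq_mul, Pi.zero_apply] at h2
    simp only [Matrix.mulVec, dotProduct, hH, Matrix.of_apply, Pi.zero_apply]
    rw [← h2]
    simp_rw [Finset.mul_sum]
    rw [Finset.sum_comm]
    refine Finset.sum_congr rfl fun l _ => Finset.sum_congr rfl fun j _ => by ring
  have h3 : (H.transpose * B.W * H * B.E).mulVec a = 0 := by
    rw [← Matrix.mulVec_mulVec, ← Matrix.mulVec_mulVec, h1, Matrix.mulVec_zero]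
  have h4 : (Matrix.diagonal B.eig).mulVec a = 0 := by
    have h5 := congrArg (fun v => B.E.transpose.mulVec v) h3
    simp only [Matrix.mulVec_zero] at h5
    rw [show H.transpose * B.W * H * B.E = B.E * Matrix.diagonal B.eig from B.E_eig,
      Matrix.mulVec_mulVec, ← Matrix.mul_assoc, B.E_orthonormal, Matrix.one_mul] at h5
    exact h5
  funext l
  have h6 := congrFun h4 l
  rw [Matrix.mulVec_diagonal] at h6
  exact (mul_eq_zero.1 h6).resolve_left (B.eig_ne_zero l)

/-- The empirical score as a linear functional of the coefficients of the direction. -/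
lemma exists_empirical_score_linear {L : (Cube d → ℝ) → 𝒪 → ℝ} {B : PCDesign d k}
    {θ : Cube d → ℝ} (hL : GateauxAt L θ (Set.range B.fn)) (n : ℕ) (o : ℕ → 𝒪) :
    ∃ S : (Fin B.p → ℝ) →ₗ[ℝ] ℝ, ∀ a, empMean n o (score L θ (B.fn a)) = S a ∧
      HasDerivAt (fun t : ℝ => empMean n o (L (θ + t • B.fn a))) (S a) 0 := by
  choose A hA using hL
  refine ⟨(n : ℝ)⁻¹ • ∑ i ∈ Finset.range n, (A (o i)).comp B.fn, fun a => ⟨?_, ?_⟩⟩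
  · simp only [empMean, LinearMap.smul_apply, LinearMap.sum_apply, LinearMap.comp_apply,
      smul_eq_mul]
    rw [div_eq_inv_mul]
    congr 1
    exact Finset.sum_congr rfl fun i _ => (hA (o i) _ ⟨a, rfl⟩).deriv
  · simp only [empMean, LinearMap.smul_apply, LinearMap.sum_apply, LinearMap.comp_apply,
      smul_eq_mul]
    simp_rw [div_eq_inv_mul]
    exact (HasDerivAt.fun_sum fun i _ => hA (o i) _ ⟨a, rfl⟩).const_mul _

/-- The constraint on the `L₁`-norm is inactive in first order along `orthSpace α`, so the score
equations of the unconstrained problem hold in these directions. -/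
lemma empMean_score_eq_zero {L : (Cube d → ℝ) → 𝒪 → ℝ} {B : PCDesign d k} {n : ℕ} {o : ℕ → 𝒪}
    {C : ℝ} {α : Fin B.p → ℝ} (hα : IsPCHAL L n o B C α)
    (hL : GateauxAt L (B.fn α) (Set.range B.fn)) {a : Fin B.p → ℝ} (ha : a ∈ orthSpace α) :
    empMean n o (score L (B.fn α) (B.fn a)) = 0 := by
  obtain ⟨S, hS⟩ := exists_empirical_score_linear hL n o
  rw [(hS a).1]
  refine IsLocalMin.hasDerivAt_eq_zero ?_ (hS a).2
  filter_upwards [eventually_l1_add_smul α ha] with t ht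
  have h1 := hα.2 (α + t • a) (ht.le.trans hα.1)
  rw [map_add, map_smul] at h1
  simpa using h1

/-- Modulo directions with vanishing score, each direction of the active model is a multiple of the
residual `f*_ℓ - f̃_ℓ`. -/
lemma empMean_score_eq_mul {L : (Cube d → ℝ) → 𝒪 → ℝ} {B : PCDesign d k} {n : ℕ} {o : ℕ → 𝒪}
    {C : ℝ} {α b : Fin B.p → ℝ} (hα : IsPCHAL L n o B C α)
    (hL : GateauxAt L (B.fn α) (Set.range B.fn)) (hb : b ∈ orthSpace α)
    (hJ : 0 < numActive α) {a : Fin B.p → ℝ} (ha : a ∈ activeSpace α) :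
    empMean n o (score L (B.fn α) (B.fn a)) = (∑ l, a l * signVec α l) *
      empMean n o (score L (B.fn α) (B.fn (starDir α) - B.fn b)) := by
  obtain ⟨S, hS⟩ := exists_empirical_score_linear hL n o
  set s := ∑ l, a l * signVec α l with hs
  have hmem : a - s • (starDir α - b) ∈ orthSpace α := by
    refine ⟨Submodule.sub_mem _ ha (Submodule.smul_mem _ _
      (Submodule.sub_mem _ (starDir_mem_activeSpace α) hb.1)), ?_⟩
    have h1 : ∀ l, (a - s • (starDir α - b)) l * signVec α l =
        a l * signVec α l - s * (starDir α l * signVec α l - b l * signVec α l) := fun l => by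
      simp only [Pi.sub_apply, Pi.smul_apply, smul_eq_mul]; ring
    simp_rw [h1]
    rw [Finset.sum_sub_distrib, ← Finset.mul_sum, Finset.sum_sub_distrib,
      sum_starDir_mul_signVec α hJ, hb.2, ← hs]
    ring
  have h0 := empMean_score_eq_zero hα hL hmem
  rw [(hS _).1, map_sub, map_smul, smul_eq_mul, sub_eq_zero] at h0
  rw [(hS a).1, h0, ← map_sub, (hS _).1]

lemma empMean_score_of_numActive_eq_zero {L : (Cube d → ℝ) → 𝒪 → ℝ} {B : PCDesign d k} {n : ℕ}
    {o : ℕ → 𝒪} {θ : Cube d → ℝ} {α a : Fin B.p → ℝ} (hL : GateauxAt L θ (Set.range B.fn))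
    (hJ : numActive α = 0) (ha : a ∈ activeSpace α) :
    empMean n o (score L θ (B.fn a)) = 0 := by
  obtain ⟨S, hS⟩ := exists_empirical_score_linear hL n o
  rw [(hS a).1, eq_zero_of_numActive_eq_zero α hJ ha, map_zero]

lemma abs_empMean_score_le {L : (Cube d → ℝ) → 𝒪 → ℝ} {B : PCDesign d k} {n : ℕ} {o : ℕ → 𝒪}
    {C : ℝ} {α b : Fin B.p → ℝ} (hα : IsPCHAL L n o B C α)
    (hL : GateauxAt L (B.fn α) (Set.range B.fn)) (hb : b ∈ orthSpace α)
    {a : Fin B.p → ℝ} (ha : a ∈ activeSpace α) (ha2 : l2 a ≤ (Real.sqrt (numActive α))⁻¹) :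
    |empMean n o (score L (B.fn α) (B.fn a))| ≤
      |empMean n o (score L (B.fn α) (B.fn (starDir α) - B.fn b))| := by
  rcases Nat.eq_zero_or_pos (numActive α) with hJ | hJ
  · rw [empMean_score_of_numActive_eq_zero hL hJ ha, abs_zero]
    exact abs_nonneg _
  · rw [empMean_score_eq_mul hα hL hb hJ ha, abs_mul]
    exact mul_le_of_le_one_left (abs_nonneg _) (abs_sum_mul_signVec_le α ha2)

end Scores

section Projection

variable {d k : ℕ} {𝒪 : Type*} [MeasurableSpace 𝒪]

lemma eLpNorm_two_eq_sqrt (P : Measure 𝒪) [IsFiniteMeasure P] {f : 𝒪 → ℝ} (hf : Measurable f)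
    {c : ℝ} (hc : ∀ o, |f o| ≤ c) :
    eLpNorm f 2 P = ENNReal.ofReal (Real.sqrt (∫ o, f o ^ 2 ∂P)) := by
  have hmem : MemLp f 2 P := MemLp.of_bound hf.aestronglyMeasurable c (Eventually.of_forall hc)
  rw [hmem.eLpNorm_eq_integral_rpow_norm two_ne_zero ENNReal.ofNat_ne_top, Real.sqrt_eq_rpow]
  simp

lemma PCDesign.fn_comp_measurable (B : PCDesign d k) {X : 𝒪 → Cube d} (hX : Measurable X)
    (a : Fin B.p → ℝ) : (Measurable fun o => B.fn a (X o)) ∧ ∃ c, ∀ o, |B.fn a (X o)| ≤ c := by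
  obtain ⟨M, hM⟩ := B.fn_mem a
  exact ⟨(measurable_of_mem_svBall hM).comp hX, M, fun o => abs_le_of_mem_svBall hM (X o)⟩

/-- The projection residual is at most as large as any one active basis function, since moving
`f*_ℓ` to that basis function (up to sign) is an admissible step in `orthSpace α`. -/
lemma normP_residual_le {X : 𝒪 → Cube d} (hX : Measurable X) (P0 : Measure 𝒪)
    [IsProbabilityMeasure P0] {B : PCDesign d k} {α b : Fin B.p → ℝ}
    (hb : IsProjCoef X P0 B α b) {l : Fin B.p} (hl : l ∈ active α) {q : ℝ≥0∞}
    (hq : q = 1 ∨ q = 2) :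
    normP q X P0 (B.fn (starDir α) - B.fn b) ≤ normP 2 X P0 (B.basis l) := by
  classical
  have hJ : 0 < numActive α := (Set.ncard_pos (Set.toFinite _)).2 ⟨l, hl⟩
  have hsl : signVec α l ^ 2 = 1 := by rw [signVec_sq]; exact if_pos hl
  let a : Fin B.p → ℝ := starDir α - Pi.single l (signVec α l)
  have ha : a ∈ orthSpace α := by
    refine ⟨Submodule.sub_mem _ (starDir_mem_activeSpace α) ?_, ?_⟩
    · intro j hj
      rw [Pi.single_eq_of_ne]
      rintro rfl
      exact hj hl
    · have h1 : ∀ j, a j * signVec α j = starDir α j * signVec α j -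
          (Pi.single l (signVec α l) : Fin B.p → ℝ) j * signVec α j := fun j => by
        simp only [a, Pi.sub_apply, sub_mul]
      simp_rw [h1]
      rw [Finset.sum_sub_distrib, sum_starDir_mul_signVec α hJ, Finset.sum_eq_single l]
      · rw [Pi.single_eq_same, ← sq, hsl, sub_self]
      · intro j _ hj; rw [Pi.single_eq_of_ne hj, zero_mul]
      · simp
  have hdiff : B.fn (starDir α) - B.fn a = signVec α l • B.basis l := by
    rw [← map_sub, sub_sub_cancel, B.fn_eq, Finset.sum_eq_single l]
    · rw [Pi.single_eq_same]
    · intro j _ hj; rw [Pi.single_eq_of_ne hj, zero_smul]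
    · simp
  have hmin := hb.2 a ha
  have hsq : ∀ o, (B.fn (starDir α) (X o) - B.fn a (X o)) ^ 2 = B.basis l (X o) ^ 2 := by
    intro o
    have := congrFun hdiff (X o)
    rw [Pi.sub_apply, Pi.smul_apply, smul_eq_mul] at this
    rw [this, mul_pow, hsl, one_mul]
  simp_rw [hsq] at hmin
  have hbasis : B.basis l = B.fn (Pi.single l 1) := by
    rw [B.fn_eq, Finset.sum_eq_single l]
    · rw [Pi.single_eq_same, one_smul]
    · intro j _ hj; rw [Pi.single_eq_of_ne hj, zero_smul]
    · simp
  obtain ⟨hm1, c1, hc1⟩ := B.fn_comp_measurable hX (starDir α - b)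
  obtain ⟨hm2, c2, hc2⟩ := B.fn_comp_measurable hX (Pi.single l 1)
  rw [map_sub] at hm1 hc1
  have h2 : normP 2 X P0 (B.fn (starDir α) - B.fn b) ≤ normP 2 X P0 (B.basis l) := by
    rw [hbasis] at hmin ⊢
    rw [normP, normP, eLpNorm_two_eq_sqrt P0 hm1 hc1, eLpNorm_two_eq_sqrt P0 hm2 hc2]
    exact ENNReal.ofReal_le_ofReal (Real.sqrt_le_sqrt hmin)
  rcases hq with rfl | rfl
  · exact (eLpNorm_le_eLpNorm_of_exponent_le one_le_two hm1.aestronglyMeasurable).trans h2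
  · exact h2

end Projection

/-! ### From uniform covering numbers to entropy bounds -/

section Covering

variable {T : Type*}

lemma sqrt_sum_sq_div_le_iff {m : ℕ} (v : Fin (m + 1) → ℝ) {ε : ℝ} (hε : 0 ≤ ε) :
    Real.sqrt ((∑ i, v i ^ 2) / (m + 1)) ≤ ε ↔
      ∑ i, v i ^ 2 ≤ (Fintype.card (Fin (m + 1)) : ℝ) * ε ^ 2 := by
  have hm : (0 : ℝ) < (m : ℝ) + 1 := by positivity
  rw [Real.sqrt_le_left hε, div_le_iff₀ hm, Fintype.card_fin, Nat.cast_add, Nat.cast_one,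
    mul_comm]

/-- Centres in `ℝ ^ (m + 1)` are replaced by members of the class, at the cost of doubling the
radius. -/
lemma coveringAt_le_of_entropyBound {m : ℕ} (y : Fin (m + 1) → T) (F : Set (T → ℝ)) {A r ε : ℝ}
    (hε : 0 < ε) (h : EntropyBound ((fun (f : T → ℝ) i => f (y i)) '' F) A r) :
    coveringAt y F ε ≤ (⌊Real.exp (A * (ε / 2) ^ (-r))⌋₊ : ℕ∞) := by
  classical
  obtain ⟨N, c, hN, hc⟩ := h (ε / 2) (by positivity)
  refine le_trans ?_ (Nat.cast_le.2 (Nat.le_floor hN))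
  refine iInf₂_le N ⟨fun j => if hj : ∃ f ∈ F,
    ∑ i, (f (y i) - c j i) ^ 2 ≤ (Fintype.card (Fin (m + 1)) : ℝ) * (ε / 2) ^ 2 then
      hj.choose else 0, fun f hf => ?_⟩
  obtain ⟨j, hj⟩ := hc _ ⟨f, hf, rfl⟩
  have hex : ∃ f ∈ F,
      ∑ i, (f (y i) - c j i) ^ 2 ≤ (Fintype.card (Fin (m + 1)) : ℝ) * (ε / 2) ^ 2 := ⟨f, hf, hj⟩
  refine ⟨j, ?_⟩
  simp only [dif_pos hex]
  rw [sqrt_sum_sq_div_le_iff (fun i => f (y i) - hex.choose (y i)) hε.le]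
  have h1 := hex.choose_spec.2
  have h2 := sum_sub_sq_le (fun i => f (y i)) (fun i => hex.choose (y i)) (c j)
  have hsymm : ∀ g : T → ℝ, ∑ i, (c j i - g (y i)) ^ 2 = ∑ i, (g (y i) - c j i) ^ 2 := fun g =>
    Finset.sum_congr rfl fun i _ => by ring
  rw [hsymm, hsymm] at h2
  refine h2.trans ?_
  dsimp only at hj
  linarith

lemma exists_cover_of_coveringAt_le {m : ℕ} {y : Fin (m + 1) → T} {F : Set (T → ℝ)} {ε : ℝ}
    {N₀ : ℕ} (h : coveringAt y F ε ≤ N₀) :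
    ∃ N ≤ N₀, ∃ c : Fin N → T → ℝ, ∀ f ∈ F, ∃ j,
      Real.sqrt ((∑ i, (f (y i) - c j (y i)) ^ 2) / (m + 1)) ≤ ε := by
  have h1 : coveringAt y F ε < ((N₀ + 1 : ℕ) : ℕ∞) :=
    h.trans_lt (Nat.cast_lt.2 (Nat.lt_succ_self _))
  rw [coveringAt, iInf_lt_iff] at h1
  obtain ⟨N, hN⟩ := h1
  rw [iInf_lt_iff] at hN
  obtain ⟨hc, hN⟩ := hN
  exact ⟨N, Nat.lt_succ_iff.1 (Nat.cast_lt.1 hN), hc⟩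

/-- The constant in the entropy bound of a class whose covering number at `ε` is at most the `K`-th
power of that of `D^(k)_M` at `ε / K`. -/
noncomputable def classConst (d : ℕ) (M : ℝ≥0) (K : ℕ) : ℝ :=
  K * (orthantConst d * (4 * M) ^ svExponent d * (2 * K) ^ svExponent d)

lemma classConst_nonneg (d : ℕ) (M : ℝ≥0) (K : ℕ) : 0 ≤ classConst d M K := by
  have := orthantConst_nonneg d
  unfold classConst; positivity

lemma unifCovering_DBall_le (d k : ℕ) {M : ℝ≥0} (hM : 0 < M) {ε : ℝ} (hε : 0 < ε) :
    unifCovering (DBall d k M) ε ≤ (⌊Real.exp (orthantConst d * (4 * M) ^ svExponent d *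
      (ε / 2) ^ (-svExponent d))⌋₊ : ℕ∞) :=
  iSup₂_le fun _ y => coveringAt_le_of_entropyBound y _ hε (entropyBound_DBall k hM y)

lemma entropyBound_of_unifCovering_le {d k : ℕ} {M : ℝ≥0} (hM : 0 < M) {K : ℕ} (hK : 0 < K)
    {F : Set (T → ℝ)}
    (hF : ∀ ε : ℝ, 0 < ε → unifCovering F ε ≤ unifCovering (DBall d k M) (ε / K) ^ K)
    {m : ℕ} (y : Fin (m + 1) → T) :
    EntropyBound ((fun (f : T → ℝ) i => f (y i)) '' F) (classConst d M K) (svExponent d) := by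
  intro ε hε
  have hK' : (0 : ℝ) < K := by exact_mod_cast hK
  set E := Real.exp (orthantConst d * (4 * M) ^ svExponent d *
    (ε / K / 2) ^ (-svExponent d)) with hE
  have h1 : coveringAt y F ε ≤ ((⌊E⌋₊ ^ K : ℕ) : ℕ∞) := by
    rw [Nat.cast_pow]
    exact (le_iSup₂ (f := fun (m : ℕ) (y : Fin (m + 1) → T) => coveringAt y F ε) m y).trans
      ((hF ε hε).trans (pow_le_pow_left' (unifCovering_DBall_le d k hM (div_pos hε hK')) K))
  obtain ⟨N, hN, c, hc⟩ := exists_cover_of_coveringAt_le h1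
  refine ⟨N, fun j i => c j (y i), ?_, ?_⟩
  · calc (N : ℝ) ≤ ((⌊E⌋₊ ^ K : ℕ) : ℝ) := by exact_mod_cast hN
      _ ≤ E ^ K := by
        rw [Nat.cast_pow]
        exact pow_le_pow_left₀ (Nat.cast_nonneg _) (Nat.floor_le (Real.exp_pos _).le) K
      _ = _ := by
        rw [hE, ← Real.exp_nat_mul]
        congr 1
        rw [classConst, div_div, Real.div_rpow hε.le (by positivity),
          Real.rpow_neg (by positivity : 0 ≤ (K : ℝ) * 2), div_inv_eq_mul, mul_comm (K : ℝ) 2]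
        ring
  · rintro _ ⟨f, hf, rfl⟩
    obtain ⟨j, hj⟩ := hc f hf
    exact ⟨j, (sqrt_sum_sq_div_le_iff (fun i => f (y i) - c j (y i)) hε.le).1 hj⟩

/-- At radius `K M` one ball suffices, so a class that contains the zero function is uniformly
bounded. -/
lemma abs_le_of_unifCovering_le {d k : ℕ} {M : ℝ≥0} (hM : 0 < M) {K : ℕ} (hK : 0 < K)
    {F : Set (T → ℝ)}
    (hF : ∀ ε : ℝ, 0 < ε → unifCovering F ε ≤ unifCovering (DBall d k M) (ε / K) ^ K)
    (h0 : (0 : T → ℝ) ∈ F) {f : T → ℝ} (hf : f ∈ F) (t : T) : |f t| ≤ 2 * K * M := by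
  have hK' : (0 : ℝ) < K := by exact_mod_cast hK
  have hM' : (0 : ℝ) < M := hM
  have hone : unifCovering (DBall d k M) M ≤ (1 : ℕ) := by
    refine iSup₂_le fun m y => iInf₂_le 1 ⟨fun _ => 0, fun f hf => ⟨0, ?_⟩⟩
    rw [sqrt_sum_sq_div_le_iff (fun i => f (y i) - (0 : Cube d → ℝ) (y i)) hM'.le]
    calc ∑ i, (f (y i) - (0 : Cube d → ℝ) (y i)) ^ 2 ≤ ∑ _i : Fin (m + 1), (M : ℝ) ^ 2 := by
          refine Finset.sum_le_sum fun i _ => ?_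
          rw [Pi.zero_apply, sub_zero]
          have := abs_le.1 (abs_le_of_mem_svBall hf (y i))
          exact sq_le_sq' this.1 this.2
      _ = _ := by rw [Finset.sum_const, Finset.card_univ, nsmul_eq_mul]
  have h1 : coveringAt (fun _ : Fin 1 => t) F (K * M) ≤ (1 : ℕ) := by
    refine (le_iSup₂ (f := fun (m : ℕ) (y : Fin (m + 1) → T) => coveringAt y F (K * M)) 0
      (fun _ => t)).trans ((hF (K * M) (by positivity)).trans ?_)
    rw [mul_div_cancel_left₀ _ hK'.ne']
    calc unifCovering (DBall d k M) M ^ K ≤ ((1 : ℕ) : ℕ∞) ^ K := pow_le_pow_left' hone K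
      _ = (1 : ℕ) := by simp
  obtain ⟨N, hN, c, hc⟩ := exists_cover_of_coveringAt_le h1
  have hval : ∀ g ∈ F, ∃ j, |g t - c j t| ≤ K * M := fun g hg => by
    obtain ⟨j, hj⟩ := hc g hg
    refine ⟨j, ?_⟩
    simpa [Real.sqrt_sq_eq_abs] using hj
  obtain ⟨i, hi⟩ := hval f hf
  obtain ⟨j, hj⟩ := hval 0 h0
  have hij : i = j := by
    apply Fin.ext
    have := i.2
    have := j.2
    omega
  subst hij
  rw [Pi.zero_apply, zero_sub, abs_neg] at hj
  have := abs_sub_abs_le_abs_sub (f t) (c i t)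
  linarith

end Covering

/-! ### Asymptotic equicontinuity -/

section Equicontinuity

lemma empMean_sub_eq {T : Type*} {n : ℕ} (hn : 0 < n) (o : ℕ → T) (f : T → ℝ) (c : ℝ) :
    empMean n o f - c = (∑ i : Fin n, (f (o i) - c)) / n := by
  have hn' : (n : ℝ) ≠ 0 := by exact_mod_cast hn.ne'
  rw [empMean, Finset.sum_range, Finset.sum_sub_distrib, Finset.sum_const, Finset.card_univ,
    Fintype.card_fin, nsmul_eq_mul]
  field_simp

variable {T Ω : Type*} [MeasurableSpace T] [MeasurableSpace Ω]

/-- Bound on the outer probability of a large value of the empirical process on the part of the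
class within `L²(P)`-distance `δ` of zero. -/
noncomputable def equicontBound (A r b δ ε : ℝ) (n : ℕ) : ℝ :=
  2 * chainConst A r b / ε * (2 * δ ^ (1 - r / 2) + δ ^ (1 - r / 2 - 2) *
    (2 * (chainConst (A * (2 * b) ^ r) r (b ^ 2) * (b ^ 2) ^ (1 - r / 2) / Real.sqrt n)))

/-- The supremum over the uncountable class is dominated by the measurable supremum over the
countable subset, to which Markov's inequality and the maximal inequality apply. -/
lemma measure_empirical_gt_le (μ : Measure Ω) [IsProbabilityMeasure μ] (P0 : Measure T)
    [IsProbabilityMeasure P0] (O : ℕ → Ω → T) (hO_meas : ∀ i, Measurable (O i))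
    (hO_indep : iIndepFun O μ) (hO_law : ∀ i, μ.map (O i) = P0) {F : Set (T → ℝ)}
    (hFm : ∀ h ∈ F, Measurable h) (hFs : PointwiseSeparable F) {A r b δ ε : ℝ} (hA : 0 ≤ A)
    (hr : 0 < r) (hr2 : r < 2) (hδ : 0 < δ) (hδb : δ ≤ b) (hε : 0 < ε)
    (hFb : ∀ f ∈ F, ∀ t, |f t| ≤ b) (m : ℕ)
    (hFe : ∀ y : Fin (m + 1) → T, EntropyBound ((fun (f : T → ℝ) i => f (y i)) '' F) A r) :
    μ {ω | ∃ f ∈ F, ∫ t, f t ^ 2 ∂P0 < δ ^ 2 ∧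
      ε * (Real.sqrt (m + 1 : ℕ))⁻¹ < |empMean (m + 1) (fun i => O i ω) f - ∫ t, f t ∂P0|} ≤
      ENNReal.ofReal (equicontBound A r b δ ε (m + 1)) := by
  obtain ⟨G, hGF, hGc, hG⟩ := hFs
  let κ := {g : T → ℝ // g ∈ G ∧ ∫ t, g t ^ 2 ∂P0 ≤ δ ^ 2}
  have : Countable κ := (hGc.mono fun g (hg : g ∈ G ∧ ∫ t, g t ^ 2 ∂P0 ≤ δ ^ 2) => hg.1).to_subtype
  let h : κ → T → ℝ := fun g => g.1
  have hκF : ∀ g : κ, h g ∈ F := fun g => hGF g.2.1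
  set n : ℝ := ((m + 1 : ℕ) : ℝ) with hn
  have hn0 : 0 < n := by rw [hn]; positivity
  have hsn : 0 < Real.sqrt n := Real.sqrt_pos.2 hn0
  let Z : (Fin (m + 1) → T) → ℝ≥0∞ := fun x =>
    ⨆ g, ENNReal.ofReal |∑ i, (h g (x i) - ∫ t, h g t ∂P0)|
  have hZm : Measurable Z := measurable_iSup_abs fun g => Finset.measurable_sum _ fun i _ =>
    ((hFm _ (hκF g)).comp (measurable_pi_apply i)).sub_const _
  have hZ := lintegral_iSup_empirical_le (ι := Fin (m + 1)) P0 h (fun g => hFm _ (hκF g)) hA hr hr2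
    hδ hδb (fun g => hFb _ (hκF g)) (fun y ε hε => by
      obtain ⟨N, c, hN, hc⟩ := hFe y ε hε
      exact ⟨N, c, hN, by rintro _ ⟨g, rfl⟩; exact hc _ ⟨h g, hκF g, rfl⟩⟩) fun g => g.2.2
  rw [Fintype.card_fin, ← hn] at hZ
  let samp : Ω → Fin (m + 1) → T := fun ω i => O i ω
  have hsamp : Measurable samp := measurable_pi_lambda _ fun i => hO_meas i
  have hlaw : μ.map samp = Measure.pi fun _ => P0 := by
    have hind : iIndepFun (fun i : Fin (m + 1) => O i) μ := hO_indep.precomp Fin.val_injective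
    have h1 := iIndepFun.map_fun_eq_pi_map (f := fun i : Fin (m + 1) => O i)
      (fun i => (hO_meas i).aemeasurable) hind
    simp_rw [hO_law] at h1
    exact h1
  have hsub : {ω | ∃ f ∈ F, ∫ t, f t ^ 2 ∂P0 < δ ^ 2 ∧
      ε * (Real.sqrt n)⁻¹ < |empMean (m + 1) (fun i => O i ω) f - ∫ t, f t ∂P0|} ⊆
      samp ⁻¹' {x | ENNReal.ofReal (ε * Real.sqrt n) ≤ Z x} := by
    rintro ω ⟨f, hfF, hfδ, hf⟩
    obtain ⟨g, hgG, hgf⟩ := hG f hfF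
    -- dominated convergence along the approximating sequence
    have hint : Tendsto (fun j => ∫ t, g j t ∂P0) atTop (𝓝 (∫ t, f t ∂P0)) :=
      tendsto_integral_of_dominated_convergence (fun _ => b)
        (fun j => (hFm _ (hGF (hgG j))).aestronglyMeasurable) (integrable_const _)
        (fun j => Eventually.of_forall (hFb _ (hGF (hgG j)))) (Eventually.of_forall hgf)
    have hint2 : Tendsto (fun j => ∫ t, g j t ^ 2 ∂P0) atTop (𝓝 (∫ t, f t ^ 2 ∂P0)) :=
      tendsto_integral_of_dominated_convergence (fun _ => b ^ 2)
        (fun j => ((hFm _ (hGF (hgG j))).pow_const 2).aestronglyMeasurable) (integrable_const _)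
        (fun j => Eventually.of_forall fun t => by
          rw [Real.norm_eq_abs, abs_pow]
          exact pow_le_pow_left₀ (abs_nonneg _) (hFb _ (hGF (hgG j)) t) 2)
        (Eventually.of_forall fun t => (hgf t).pow 2)
    have hemp : Tendsto (fun j => |empMean (m + 1) (fun i => O i ω) (g j) - ∫ t, g j t ∂P0|) atTop
        (𝓝 |empMean (m + 1) (fun i => O i ω) f - ∫ t, f t ∂P0|) := by
      refine (Tendsto.sub ?_ hint).abs
      exact (tendsto_finsetSum _ fun i _ => hgf (O i ω)).div_const _
    obtain ⟨j, hj1, hj2⟩ := ((hint2.eventually (gt_mem_nhds hfδ)).and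
      (hemp.eventually (lt_mem_nhds hf))).exists
    refine le_trans ?_ (le_iSup (fun g : κ =>
      ENNReal.ofReal |∑ i, (h g (samp ω i) - ∫ t, h g t ∂P0)|) ⟨g j, hgG j, hj1.le⟩)
    refine ENNReal.ofReal_le_ofReal ?_
    rw [empMean_sub_eq (Nat.succ_pos m), abs_div, ← hn, abs_of_pos hn0, lt_div_iff₀ hn0] at hj2
    have hnn : (Real.sqrt n)⁻¹ * n = Real.sqrt n := by
      rw [inv_mul_eq_div, div_eq_iff hsn.ne', Real.mul_self_sqrt hn0.le]
    rw [mul_assoc, hnn] at hj2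
    exact hj2.le
  have hset : MeasurableSet {x | ENNReal.ofReal (ε * Real.sqrt n) ≤ Z x} :=
    measurableSet_le measurable_const hZm
  have hpos : 0 < ε * Real.sqrt n := by positivity
  calc _ ≤ μ (samp ⁻¹' {x | ENNReal.ofReal (ε * Real.sqrt n) ≤ Z x}) := measure_mono hsub
    _ = (Measure.pi fun _ => P0) {x | ENNReal.ofReal (ε * Real.sqrt n) ≤ Z x} := by
        rw [← hlaw, Measure.map_apply hsamp hset]
    _ ≤ (∫⁻ x, Z x ∂(Measure.pi fun _ => P0)) / ENNReal.ofReal (ε * Real.sqrt n) :=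
        meas_ge_le_lintegral_div hZm.aemeasurable
          (by simpa using hpos) ENNReal.ofReal_ne_top
    _ ≤ _ := ENNReal.div_le_div_right hZ _
    _ = _ := by
        rw [← ENNReal.ofReal_div_of_pos hpos, equicontBound, ← hn]
        congr 1
        field_simp

/-- Asymptotic equicontinuity at zero of the empirical process over bounded classes with a common
entropy bound. -/
lemma exists_eventually_measure_empirical_le (μ : Measure Ω) [IsProbabilityMeasure μ]
    (P0 : Measure T) [IsProbabilityMeasure P0] (O : ℕ → Ω → T) (hO_meas : ∀ i, Measurable (O i))
    (hO_indep : iIndepFun O μ) (hO_law : ∀ i, μ.map (O i) = P0) {F : ℕ → Set (T → ℝ)}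
    (hF : ∀ n, (∀ h ∈ F n, Measurable h) ∧ PointwiseSeparable (F n)) {A r b : ℝ} (hA : 0 ≤ A)
    (hr : 0 < r) (hr2 : r < 2) (hb : 0 < b) (hFb : ∀ᶠ n in atTop, ∀ f ∈ F n, ∀ t, |f t| ≤ b)
    (hFe : ∀ n m, ∀ y : Fin (m + 1) → T,
      EntropyBound ((fun (f : T → ℝ) i => f (y i)) '' F n) A r)
    {ε η : ℝ} (hε : 0 < ε) (hη : 0 < η) :
    ∃ δ > 0, ∀ᶠ n in atTop, μ {ω | ∃ f ∈ F n, ∫ t, f t ^ 2 ∂P0 < δ ^ 2 ∧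
      ε * (Real.sqrt n)⁻¹ < |empMean n (fun i => O i ω) f - ∫ t, f t ∂P0|} ≤
      ENNReal.ofReal η := by
  set s := 1 - r / 2 with hs
  have hs0 : 0 < s := by rw [hs]; linarith
  set c₁ := 2 * chainConst A r b / ε with hc₁
  set c₂ := chainConst (A * (2 * b) ^ r) r (b ^ 2) * (b ^ 2) ^ s with hc₂
  have hlim : Tendsto (fun δ : ℝ => c₁ * (2 * δ ^ s)) (𝓝[>] 0) (𝓝 0) := by
    have h1 : Tendsto (fun δ : ℝ => δ ^ s) (𝓝 0) (𝓝 0) := by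
      have := (Real.continuousAt_rpow_const (0 : ℝ) s (Or.inr hs0.le)).tendsto
      rwa [Real.zero_rpow hs0.ne'] at this
    have h2 := ((h1.const_mul 2).const_mul c₁).mono_left (nhdsWithin_le_nhds (s := Set.Ioi 0))
    simpa using h2
  have hev : ∀ᶠ δ : ℝ in 𝓝[>] 0, 0 < δ ∧ δ < b :=
    (eventually_mem_nhdsWithin).and ((gt_mem_nhds hb).filter_mono nhdsWithin_le_nhds)
  obtain ⟨δ, hδη, hδ, hδb⟩ := ((hlim.eventually (gt_mem_nhds (half_pos hη))).and hev).exists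
  refine ⟨δ, hδ, ?_⟩
  have hlim2 : Tendsto (fun n : ℕ => c₁ * (δ ^ (s - 2) * (2 * (c₂ / Real.sqrt n)))) atTop
      (𝓝 0) := by
    have h1 : Tendsto (fun n : ℕ => c₂ / Real.sqrt n) atTop (𝓝 0) :=
      tendsto_const_nhds.div_atTop
        (Real.tendsto_sqrt_atTop.comp tendsto_natCast_atTop_atTop)
    have h2 := ((h1.const_mul 2).const_mul (δ ^ (s - 2))).const_mul c₁
    simpa using h2
  filter_upwards [hlim2.eventually (gt_mem_nhds (half_pos hη)), hFb, eventually_gt_atTop 0]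
    with n h1 h2 hn
  obtain ⟨m, rfl⟩ := Nat.exists_eq_succ_of_ne_zero hn.ne'
  refine (measure_empirical_gt_le μ P0 O hO_meas hO_indep hO_law (hF _).1 (hF _).2 hA hr hr2 hδ
    hδb.le hε h2 m (hFe _ m)).trans (ENNReal.ofReal_le_ofReal ?_)
  rw [equicontBound, ← hs, ← hc₁, ← hc₂, mul_add]
  linarith

end Equicontinuity

/-! ### The population score and the remainder -/

section Population

lemma zero_mem_scoreClass {d k : ℕ} {𝒪 : Type*} (L : (Cube d → ℝ) → 𝒪 → ℝ)
    (B : PCDesign d k) (α : Fin B.p → ℝ) (M : ℝ≥0) : (0 : 𝒪 → ℝ) ∈ scoreClass L B α M := by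
  have h0 : (0 : Fin B.p → ℝ) ∈ activeBall α M :=
    ⟨Submodule.zero_mem _, by simp [l1]⟩
  refine ⟨0, h0, 0, h0, ?_⟩
  funext o
  simp [score]

variable {d k : ℕ} {𝒪 : Type*} [MeasurableSpace 𝒪]

/-- Each direction `f` in `D^(k)` keeps `ψ0 + t f` in `D^(0)` for `t` of either sign, so the
derivative of the risk at its minimizer vanishes. -/
lemma integral_score_eq_zero {L : (Cube d → ℝ) → 𝒪 → ℝ} {P0 : Measure 𝒪} {ψ0 : Cube d → ℝ}
    (hψ0 : IsRiskMinimizer L P0 ψ0) (hdiff : RiskDifferentiableAt k L P0 ψ0) {f : Cube d → ℝ}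
    (hf : f ∈ DSpace d k) : ∫ o, score L ψ0 f o ∂P0 = 0 := by
  obtain ⟨hint, -, hder⟩ := hdiff f hf
  refine IsLocalMin.hasDerivAt_eq_zero ?_ hder
  filter_upwards [hint] with t ht
  have hmem : ψ0 + t • f ∈ DSpace d 0 := (DSubmodule d 0).add_mem hψ0.1
    ((DSubmodule d 0).smul_mem t (DSpace_subset_zero d k hf))
  simpa using hψ0.2.2 _ hmem ht

end Population

section Assembly

variable {d k : ℕ} {Ω 𝒪 : Type*} [MeasurableSpace Ω] [MeasurableSpace 𝒪]

/-- The asymptotic part for a generic second-order bound `Y n ω` on the population score. -/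
lemma isLittleOP_sup_score (μ : Measure Ω) [IsProbabilityMeasure μ]
    (P0 : Measure 𝒪) [IsProbabilityMeasure P0] (O : ℕ → Ω → 𝒪) (hO_meas : ∀ i, Measurable (O i))
    (hO_indep : iIndepFun O μ) (hO_law : ∀ i, μ.map (O i) = P0)
    (L : (Cube d → ℝ) → 𝒪 → ℝ) (B : ℕ → Ω → PCDesign d k) (C : ℕ → Ω → ℝ)
    (α : (n : ℕ) → (ω : Ω) → Fin (B n ω).p → ℝ)
    (hα : ∀ n ω, IsPCHAL L n (fun i => O i ω) (B n ω) (C n ω) (α n ω))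
    (hL : ∀ n ω, GateauxAt L ((B n ω).fn (α n ω)) (Set.range (B n ω).fn))
    (b : (n : ℕ) → (ω : Ω) → Fin (B n ω).p → ℝ) (hb : ∀ n ω, b n ω ∈ orthSpace (α n ω))
    {M : ℝ≥0} (hM : 0 < M) (F : ℕ → Set (𝒪 → ℝ))
    (hF : ∀ n, (∀ h ∈ F n, Measurable h) ∧ PointwiseSeparable (F n)) {K : ℕ} (hK : 0 < K)
    (hFK : ∀ n, ∀ ε : ℝ, 0 < ε →
      unifCovering (F n) ε ≤ unifCovering (DBall d k M) (ε / K) ^ K)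
    (hE : WithProbTendingToOne μ (fun n => {ω |
      scoreClass L (B n ω) (α n ω) M ⊆ F n ∧
      α n ω ∈ activeBall (α n ω) M ∧
      starDir (α n ω) - b n ω ∈ activeBall (α n ω) M}))
    (hcons : IsLittleOP μ (fun n ω => eLpNorm (score L ((B n ω).fn (α n ω))
      ((B n ω).fn (starDir (α n ω)) - (B n ω).fn (b n ω))) 2 P0) (fun _ => 1))
    (Y : ℕ → Ω → ℝ≥0∞) (K' : ℝ≥0)
    (hY : IsLittleOP μ Y (fun n => (Real.sqrt n)⁻¹))
    (hbound : ∀ n ω, α n ω ∈ activeBall (α n ω) M →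
      starDir (α n ω) - b n ω ∈ activeBall (α n ω) M →
      ENNReal.ofReal |∫ o, score L ((B n ω).fn (α n ω))
        ((B n ω).fn (starDir (α n ω)) - (B n ω).fn (b n ω)) o ∂P0| ≤ K' * Y n ω) :
    IsLittleOP μ (fun n ω => ⨆ a ∈ {a : Fin (B n ω).p → ℝ | a ∈ activeBall (α n ω) M ∧
          l2 a ≤ (Real.sqrt (numActive (α n ω)))⁻¹},
        ENNReal.ofReal
          |empMean n (fun i => O i ω) (score L ((B n ω).fn (α n ω)) ((B n ω).fn a))|)
      (fun n => (Real.sqrt n)⁻¹) := by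
  intro ε hε
  set E : ℕ → Set Ω := fun n => {ω | scoreClass L (B n ω) (α n ω) M ⊆ F n ∧
      α n ω ∈ activeBall (α n ω) M ∧ starDir (α n ω) - b n ω ∈ activeBall (α n ω) M} with hEdef
  set b₀ : ℝ := 2 * K * M with hb₀
  have hK' : (0 : ℝ) < K := by exact_mod_cast hK
  have hM' : (0 : ℝ) < M := hM
  have hb₀pos : 0 < b₀ := by positivity
  -- the event is non-empty for large `n`, so that the class contains the zero function
  have hFb : ∀ᶠ n in atTop, ∀ f ∈ F n, ∀ t, |f t| ≤ b₀ := by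
    filter_upwards [hE.eventually (gt_mem_nhds (zero_lt_one : (0 : ℝ≥0∞) < 1))] with n hn f hf t
    have hne : (E n).Nonempty := by
      by_contra hempty
      rw [Set.not_nonempty_iff_eq_empty] at hempty
      have : μ (E n)ᶜ < 1 := hn
      rw [hempty, Set.compl_empty, measure_univ] at this
      exact lt_irrefl _ this
    obtain ⟨ω, hω⟩ := hne
    exact abs_le_of_unifCovering_le hM hK (hFK n) (hω.1 (zero_mem_scoreClass L _ _ M)) hf t
  rw [ENNReal.tendsto_nhds_zero]
  intro η hη
  obtain ⟨η', hη', hη'η⟩ : ∃ η' : ℝ, 0 < η' ∧ ENNReal.ofReal η' ≤ η / 4 := by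
    rcases eq_or_ne η ∞ with rfl | htop
    · exact ⟨1, one_pos, by simp [ENNReal.top_div]⟩
    · have h4 : η / 4 ≠ ∞ := ENNReal.div_ne_top htop (by norm_num)
      have h0 : η / 4 ≠ 0 := (ENNReal.div_pos hη.ne' (by norm_num)).ne'
      exact ⟨(η / 4).toReal, ENNReal.toReal_pos h0 h4, by rw [ENNReal.ofReal_toReal h4]⟩
  have hη4 : 0 < η / 4 := ENNReal.div_pos hη.ne' (by norm_num)
  obtain ⟨δ, hδ, hproc⟩ := exists_eventually_measure_empirical_le μ P0 O hO_meas hO_indep hO_law hF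
    (classConst_nonneg d M K) (svExponent_pos d) (svExponent_lt d) hb₀pos hFb
    (fun n m y => entropyBound_of_unifCovering_le hM hK (hFK n) y) (half_pos hε) hη'
  set ε₂ : ℝ := ε / (2 * (K' + 1)) with hε₂
  have hε₂pos : 0 < ε₂ := by positivity
  filter_upwards [hproc, hFb, hE.eventually (ge_mem_nhds hη4),
    (hcons (δ / 2) (half_pos hδ)).eventually (ge_mem_nhds hη4),
    (hY ε₂ hε₂pos).eventually (ge_mem_nhds hη4)] with n h1 hbd h2 h3 h4
  set g : Ω → 𝒪 → ℝ := fun ω => score L ((B n ω).fn (α n ω))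
    ((B n ω).fn (starDir (α n ω)) - (B n ω).fn (b n ω)) with hg
  set S1 : Set Ω := {ω | ∃ f ∈ F n, ∫ t, f t ^ 2 ∂P0 < δ ^ 2 ∧
      ε / 2 * (Real.sqrt n)⁻¹ < |empMean n (fun i => O i ω) f - ∫ t, f t ∂P0|} with hS1
  set S3 : Set Ω := {ω | ENNReal.ofReal (δ / 2 * 1) < eLpNorm (g ω) 2 P0} with hS3
  set S4 : Set Ω := {ω | ENNReal.ofReal (ε₂ * (Real.sqrt n)⁻¹) < Y n ω} with hS4
  have hrn : 0 ≤ (Real.sqrt n)⁻¹ := inv_nonneg.2 (Real.sqrt_nonneg _)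
  have hsub : {ω | ENNReal.ofReal (ε * (Real.sqrt n)⁻¹) <
      ⨆ a ∈ {a : Fin (B n ω).p → ℝ | a ∈ activeBall (α n ω) M ∧
          l2 a ≤ (Real.sqrt (numActive (α n ω)))⁻¹},
        ENNReal.ofReal
          |empMean n (fun i => O i ω) (score L ((B n ω).fn (α n ω)) ((B n ω).fn a))|} ⊆
      S1 ∪ (E n)ᶜ ∪ S3 ∪ S4 := by
    intro ω hω
    by_contra hnot
    simp only [Set.mem_union, not_or, Set.mem_compl_iff, not_not] at hnot
    obtain ⟨⟨⟨hn1, hnE⟩, hn3⟩, hn4⟩ := hnot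
    have hgF : g ω ∈ F n := hnE.1 ⟨α n ω, hnE.2.1, _, hnE.2.2, by rw [map_sub]⟩
    have hgm := (hF n).1 _ hgF
    have hgb := hbd _ hgF
    have hg2 : ∫ t, g ω t ^ 2 ∂P0 < δ ^ 2 := by
      have h5 : eLpNorm (g ω) 2 P0 ≤ ENNReal.ofReal (δ / 2 * 1) := not_lt.1 hn3
      rw [eLpNorm_two_eq_sqrt P0 hgm hgb, mul_one,
        ENNReal.ofReal_le_ofReal_iff (half_pos hδ).le,
        Real.sqrt_le_left (half_pos hδ).le] at h5
      nlinarith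
    have hemp : |empMean n (fun i => O i ω) (g ω) - ∫ t, g ω t ∂P0| ≤
        ε / 2 * (Real.sqrt n)⁻¹ := by
      by_contra hlt
      exact hn1 ⟨g ω, hgF, hg2, not_le.1 hlt⟩
    have hpop : |∫ t, g ω t ∂P0| ≤ ε / 2 * (Real.sqrt n)⁻¹ := by
      have h5 := hbound n ω hnE.2.1 hnE.2.2
      have h6 : Y n ω ≤ ENNReal.ofReal (ε₂ * (Real.sqrt n)⁻¹) := not_lt.1 hn4
      have h7 : ENNReal.ofReal |∫ t, g ω t ∂P0| ≤
          ENNReal.ofReal (K' * (ε₂ * (Real.sqrt n)⁻¹)) := by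
        rw [ENNReal.ofReal_mul K'.coe_nonneg, ENNReal.ofReal_coe_nnreal]
        exact h5.trans (mul_le_mul_right h6 _)
      rw [ENNReal.ofReal_le_ofReal_iff (by positivity)] at h7
      refine h7.trans ?_
      rw [← mul_assoc]
      refine mul_le_mul_of_nonneg_right ?_ hrn
      rw [hε₂, mul_div_assoc', div_le_div_iff₀ (by positivity) (by norm_num)]
      nlinarith [K'.2]
    have htot : |empMean n (fun i => O i ω) (g ω)| ≤ ε * (Real.sqrt n)⁻¹ := by
      have h5 := abs_sub_abs_le_abs_sub (empMean n (fun i => O i ω) (g ω)) (∫ t, g ω t ∂P0)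
      linarith
    refine absurd hω (not_lt.2 (iSup₂_le fun a ha => ENNReal.ofReal_le_ofReal ?_))
    exact (abs_empMean_score_le (hα n ω) (hL n ω) (hb n ω) ha.1.1 ha.2).trans htot
  calc _ ≤ μ (S1 ∪ (E n)ᶜ ∪ S3 ∪ S4) := measure_mono hsub
    _ ≤ μ S1 + μ (E n)ᶜ + μ S3 + μ S4 :=
        (measure_union_le _ _).trans (add_le_add_left ((measure_union_le _ _).trans
          (add_le_add_left (measure_union_le _ _) _)) _)
    _ ≤ η / 4 + η / 4 + η / 4 + η / 4 :=
        add_le_add (add_le_add (add_le_add (h1.trans hη'η) h2) h3) h4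
    _ = η := by
        rw [← ENNReal.add_div, ← ENNReal.add_div, ← ENNReal.add_div,
          show η + η + η + η = η * 4 by ring, ENNReal.mul_div_cancel_right (by norm_num)
          (by norm_num)]

end Assembly

end PCHAL

theorem mainTheorem7
    {d k : ℕ} {Ω 𝒪 : Type*} [MeasurableSpace Ω] [MeasurableSpace 𝒪]
    (μ : Measure Ω) [IsProbabilityMeasure μ]
    (P0 : Measure 𝒪) [IsProbabilityMeasure P0]
    -- i.i.d. observations with law `P0`
    (O : ℕ → Ω → 𝒪) (hO_meas : ∀ i, Measurable (O i)) (hO_indep : iIndepFun O μ)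
    (hO_law : ∀ i, μ.map (O i) = P0)
    (X : 𝒪 → Cube d) (hX : Measurable X)
    -- loss and target
    (L : (Cube d → ℝ) → 𝒪 → ℝ) (ψ0 : Cube d → ℝ)
    (hψ0 : IsRiskMinimizer L P0 ψ0) (hψ0_diff : RiskDifferentiableAt k L P0 ψ0)
    -- design, bound, PC-HAL coefficients, and coefficients of the projection
    (B : ℕ → Ω → PCDesign d k) (C : ℕ → Ω → ℝ)
    (α : (n : ℕ) → (ω : Ω) → Fin (B n ω).p → ℝ)
    (hα : ∀ n ω, IsPCHAL L n (fun i => O i ω) (B n ω) (C n ω) (α n ω))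
    (hL : ∀ n ω, GateauxAt L ((B n ω).fn (α n ω)) (Set.range (B n ω).fn))
    (b : (n : ℕ) → (ω : Ω) → Fin (B n ω).p → ℝ)
    (hb : ∀ n ω, IsProjCoef X P0 (B n ω) (α n ω) (b n ω)) :
    -- deterministic part
    (∀ n ω,
      -- minimization over the active model, and the score equations
      (∀ a ∈ activeBall (α n ω) (C n ω),
        empMean n (fun i => O i ω) (L ((B n ω).fn (α n ω))) ≤
          empMean n (fun i => O i ω) (L ((B n ω).fn a))) ∧
      (∀ a ∈ orthSpace (α n ω),
        empMean n (fun i => O i ω) (score L ((B n ω).fn (α n ω)) ((B n ω).fn a)) = 0) ∧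
      -- normalizations and dimension
      (0 < numActive (α n ω) →
        l2 (unitDir (α n ω)) = 1 ∧ l1 (starDir (α n ω)) = 1 ∧
        l2 (starDir (α n ω)) = (Real.sqrt (numActive (α n ω)))⁻¹ ∧
        Module.finrank ℝ ((orthSpace (α n ω)).map (B n ω).fn) + 1 = numActive (α n ω)) ∧
      -- reduction to the one unsolved direction
      (∀ a ∈ activeSpace (α n ω),
        empMean n (fun i => O i ω) (score L ((B n ω).fn (α n ω)) ((B n ω).fn a)) =
          Real.sqrt (numActive (α n ω)) * (∑ l, a l * unitDir (α n ω) l) *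
            empMean n (fun i => O i ω) (score L ((B n ω).fn (α n ω))
              ((B n ω).fn (starDir (α n ω)) - (B n ω).fn (b n ω)))) ∧
      (∀ a ∈ activeSpace (α n ω), l2 a ≤ (Real.sqrt (numActive (α n ω)))⁻¹ →
        |empMean n (fun i => O i ω) (score L ((B n ω).fn (α n ω)) ((B n ω).fn a))| ≤
          |empMean n (fun i => O i ω) (score L ((B n ω).fn (α n ω))
            ((B n ω).fn (starDir (α n ω)) - (B n ω).fn (b n ω)))|) ∧
      -- conservative bounds for the projection error
      (∀ l ∈ active (α n ω), ∀ q : ℝ≥0∞, q = 1 ∨ q = 2 →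
        normP q X P0 ((B n ω).fn (starDir (α n ω)) - (B n ω).fn (b n ω)) ≤
          normP 2 X P0 ((B n ω).basis l))) ∧
    -- asymptotic part
    (∀ (M : ℝ≥0), 0 < M →
      -- the scores lie in classes with covering numbers of the order of those of `D^(k)_M([0,1]^d)`
      ∀ (F : ℕ → Set (𝒪 → ℝ)),
      (∀ n, (∀ h ∈ F n, Measurable h) ∧ PointwiseSeparable (F n)) →
      (∃ K : ℕ, 0 < K ∧ ∀ n, ∀ ε : ℝ, 0 < ε →
        unifCovering (F n) ε ≤ unifCovering (DBall d k M) (ε / K) ^ K) →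
      WithProbTendingToOne μ (fun n => {ω |
        scoreClass L (B n ω) (α n ω) M ⊆ F n ∧
        α n ω ∈ activeBall (α n ω) M ∧
        starDir (α n ω) - b n ω ∈ activeBall (α n ω) M}) →
      -- the remaining score vanishes in `L²(P0)`
      IsLittleOP μ (fun n ω => eLpNorm (score L ((B n ω).fn (α n ω))
        ((B n ω).fn (starDir (α n ω)) - (B n ω).fn (b n ω))) 2 P0) (fun _ => 1) →
      -- second order term: sup-norm and `L¹(P0)`, or dissimilarity and `L²(P0)`
      (((∃ K : ℝ≥0, ∀ n ω, ∀ a ∈ activeBall (α n ω) M, ∀ c ∈ activeBall (α n ω) M,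
            ENNReal.ofReal |(∫ o, score L ((B n ω).fn a) ((B n ω).fn c) o ∂P0) -
                ∫ o, score L ψ0 ((B n ω).fn c) o ∂P0| ≤
              K * supDist ((B n ω).fn a) ψ0 * normP 1 X P0 ((B n ω).fn c)) ∧
          IsLittleOP μ (fun n ω => supDist ((B n ω).fn (α n ω)) ψ0 *
            normP 1 X P0 ((B n ω).fn (starDir (α n ω)) - (B n ω).fn (b n ω)))
            (fun n => (Real.sqrt n)⁻¹)) ∨
        ((∃ K : ℝ≥0, ∀ n ω, ∀ a ∈ activeBall (α n ω) M, ∀ c ∈ activeBall (α n ω) M,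
            Integrable (L ((B n ω).fn a)) P0 ∧
            ENNReal.ofReal |(∫ o, score L ((B n ω).fn a) ((B n ω).fn c) o ∂P0) -
                ∫ o, score L ψ0 ((B n ω).fn c) o ∂P0| ≤
              K * ENNReal.ofReal (Real.sqrt (dissim L P0 ((B n ω).fn a) ψ0)) *
                normP 2 X P0 ((B n ω).fn c)) ∧
          IsLittleOP μ (fun n ω =>
            ENNReal.ofReal (Real.sqrt (dissim L P0 ((B n ω).fn (α n ω)) ψ0)) *
            normP 2 X P0 ((B n ω).fn (starDir (α n ω)) - (B n ω).fn (b n ω)))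
            (fun n => (Real.sqrt n)⁻¹))) →
      IsLittleOP μ (fun n ω => ⨆ a ∈ {a : Fin (B n ω).p → ℝ | a ∈ activeBall (α n ω) M ∧
            l2 a ≤ (Real.sqrt (numActive (α n ω)))⁻¹},
          ENNReal.ofReal
            |empMean n (fun i => O i ω) (score L ((B n ω).fn (α n ω)) ((B n ω).fn a))|)
        (fun n => (Real.sqrt n)⁻¹)) := by
  refine ⟨fun n ω => ⟨fun a ha => (hα n ω).2 a ha.2,
    fun a ha => empMean_score_eq_zero (hα n ω) (hL n ω) ha,
    fun hJ => ⟨l2_unitDir _ hJ, l1_starDir _ hJ, l2_starDir _ hJ, ?_⟩, fun a ha => ?_,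
    fun a ha ha2 => abs_empMean_score_le (hα n ω) (hL n ω) (hb n ω).1 ha ha2,
    fun l hl q hq => normP_residual_le hX P0 (hb n ω) hl hq⟩, ?_⟩
  · rw [(Submodule.equivMapOfInjective _ (B n ω).fn_injective _).symm.finrank_eq]
    exact finrank_orthSpace _ hJ
  · rcases Nat.eq_zero_or_pos (numActive (α n ω)) with hJ | hJ
    · rw [empMean_score_of_numActive_eq_zero (hL n ω) hJ ha, hJ]
      simp
    · rw [empMean_score_eq_mul (hα n ω) (hL n ω) (hb n ω).1 hJ ha, sqrt_mul_sum_unitDir _ _ hJ]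
  · intro M hM F hF hcov hE hcons hsecond
    obtain ⟨K, hK, hFK⟩ := hcov
    -- the population score at `ψ0` vanishes, so the second-order conditions bound the population
    -- score at the fit
    have hψ : ∀ n ω, ∫ o, score L ψ0
        ((B n ω).fn (starDir (α n ω)) - (B n ω).fn (b n ω)) o ∂P0 = 0 := fun n ω => by
      rw [← map_sub]
      exact integral_score_eq_zero hψ0 hψ0_diff ((B n ω).fn_mem _)
    rcases hsecond with ⟨⟨K', hK'⟩, hY⟩ | ⟨⟨K', hK'⟩, hY⟩
    · refine isLittleOP_sup_score μ P0 O hO_meas hO_indep hO_law L B C α hα hL b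
        (fun n ω => (hb n ω).1) hM F hF hK hFK hE hcons _ K' hY fun n ω h1 h2 => ?_
      have h3 := hK' n ω _ h1 _ h2
      rw [map_sub, hψ, sub_zero, mul_assoc] at h3
      exact h3
    · refine isLittleOP_sup_score μ P0 O hO_meas hO_indep hO_law L B C α hα hL b
        (fun n ω => (hb n ω).1) hM F hF hK hFK hE hcons _ K' hY fun n ω h1 h2 => ?_
      have h3 := (hK' n ω _ h1 _ h2).2
      rw [map_sub, hψ, sub_zero, mul_assoc] at h3
      exact h3
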